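/- Let $0<q<1$ be such that $\log(1-q)/\log q\in\mathbb Z$, let $\alpha\ge-\tfrac12$, and put $\mathbb R_q=\{\pm q^n:n\in\mathbb Z\}$, $\mathbb R_{q,+}=\{q^n:n\in\mathbb Z\}$, $\mathbb R_q^2=\mathbb R_q\times\mathbb R_q$, $\|x\|=\sqrt{x_1^2+x_2^2}$. **Notation.** $(x;b)_n=\prod_{k=0}^{n-1}(1-xb^k)$, $(x;b)_\infty=\prod_{k\ge0}(1-xb^k)$, $\Gamma_{b}(x)=\frac{(b;b)_\infty}{(b^x;b)_\infty}(1-b)^{1-x}$, and $$j_\alpha(z;q^2)=\sum_{n\ge0}(-1)^n\frac{\Gamma_{q^2}(\alpha+1)\,q^{n(n+1)}}{(1+q)^{2n}\,\Gamma_{q^2}(\alpha+n+1)\Gamma_{q^2}(n+1)}z^{2n},$$ $\cos(z;q^2)=j_{-1/2}(z;q^2)$, $\sin(z;q^2)=z\,j_{1/2}(z;q^2)$, $e(z;q^2)=\cos(-iz;q^2)+i\sin(-iz;q^2)$. For a complex function $f$ on $\mathbb R_q$, $$\partial_qf(z)=\frac{f(q^{-1}z)+f(-q^{-1}z)-f(qz)+f(-qz)-2f(-z)}{2(1-q)z}.$$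 On functions on $\mathbb R_q^2$, let $\partial_{x,q},\partial_{y,q}$ be the corresponding partial operators, $D_q^\beta=\partial_{x,q}^{\beta_1}\partial_{y,q}^{\beta_2}$ for $\beta\in\mathbb N^2$, and $$\Delta_{\alpha,q}f=\partial_{x,q}^2f+|y|^{-(2\alpha+1)}\,\partial_{y,q}\bigl(|y|^{2\alpha+1}\partial_{y,q}f\bigr).$$ A function $f:\mathbb R_q^2\to\mathbb C$ is called $q$-smooth if for every $\beta\in\mathbb N^2$ the function $D_q^\beta f$ extends continuously to $(\mathbb R_q\cup\{0\})^2$, i.e. has limits along $\mathbb R_q^2$ at the origin and at the points $(0,y),(x,0)$ with $x,y\in\mathbb R_q$. * $\mathscr D_{*,q}(\mathbb R_q^2)$ is the space of $q$-smooth functions that are even in the last variable and vanish outside $\{x\in\mathbb R_q^2:\|x\|\le a\}$ for some $a>0$. * $\mathscr S_{*,q}(\mathbb R_q^2)$ is the space of $q$-smooth functions that are even in the last variable and satisfy $\sup_{x\in\mathbb R_q^2}\sup_{|\beta|\le n}|D_q^\beta(\|x\|^{2n}f)(x)|<\infty$ for all $n\in\mathbb N$. * For $m\in\mathbb N$, $PW^m_{\alpha,q}$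 is the space of all $f\in\mathscr S_{*,q}(\mathbb R_q^2)$ for which there is $a>0$ with $$\sup_{x\in\mathbb R_q^2,\ n\ge m}a^{-2n}B_{n,m,q}(1+\|x\|^2)^m\,|\Delta_{\alpha,q}^nf(x)|<\infty,\qquad B_{n,m,q}=\Bigl(\frac{(1-q)^{2m}}{(q^{2n};q^{-1})_{2m}}\Bigr)^2 .$$ With the Jackson integrals $\int_0^\infty g\,d_qx=(1-q)\sum_{n\in\mathbb Z}q^ng(q^n)$ and $\int_{-\infty}^\infty g\,d_qx=(1-q)\sum_{n\in\mathbb Z}q^n\bigl(g(q^n)+g(-q^n)\bigr)$, the $q$-Weinstein transform of $f$ is the function on $\mathbb R_q^2$ given by $$\mathscr F_W^{\alpha,q}(f)(\lambda)=K_{\alpha,q}\int_0^\infty\!\!\int_{-\infty}^\infty f(x,y)\,e(-i\lambda_1x;q^2)\,j_\alpha(\lambda_2y;q^2)\,y^{2\alpha+1}\,d_qx\,d_qy,\qquad K_{\alpha,q}=\frac{(1+q)^{1/2-\alpha}}{2\,\Gamma_{q^2}(1/2)\,\Gamma_{q^2}(\alpha+1)} .$$ **Theorem.** Let $m\in\mathbb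 N$ with $m>\alpha+\tfrac32$. Every $f\in\mathscr D_{*,q}(\mathbb R_q^2)$ is absolutely integrable over $\mathbb R_q\times\mathbb R_{q,+}$ with respect to $y^{2\alpha+1}d_qx\,d_qy$, and $\mathscr F_W^{\alpha,q}$ is a bijection from $\mathscr D_{*,q}(\mathbb R_q^2)$ onto $PW^m_{\alpha,q}$. -/

import Mathlib

open Filter Topology

noncomputable section

namespace QWeinstein

/-! ### q-shifted factorials and the q-Gamma function -/

/-- The finite q-shifted factorial `(x; b)_n = ∏_{k<n} (1 - x b^k)`. -/
def qPoch (x b : ℝ) (n : ℕ) : ℝ := ∏ k ∈ Finset.range n, (1 - x * b ^ k)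

/-- The infinite q-shifted factorial `(x; b)_∞ = ∏_{k≥0} (1 - x b^k)`, used for `0 < b < 1`. -/
def qPochInf (x b : ℝ) : ℝ := ∏' k : ℕ, (1 - x * b ^ k)

/-- The q-Gamma function `Γ_b(x) = (b; b)_∞ / (b^x; b)_∞ · (1 - b)^(1 - x)`. -/
def qGamma (b x : ℝ) : ℝ := qPochInf b b / qPochInf (b ^ x) b * (1 - b) ^ (1 - x)

/-! ### q-special functions -/

/-- The normalized third Jackson q-Bessel function `j_α(z; q²)`. -/
def qBessel (q α : ℝ) (z : ℂ) : ℂ :=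
  ∑' n : ℕ, (((-1) ^ n * (qGamma (q ^ 2) (α + 1) * q ^ (n * (n + 1)))
    / ((1 + q) ^ (2 * n) * qGamma (q ^ 2) (α + n + 1) * qGamma (q ^ 2) (n + 1)) : ℝ) : ℂ)
    * z ^ (2 * n)

/-- The q-cosine `cos(z; q²)`. -/
def qCos (q : ℝ) (z : ℂ) : ℂ := qBessel q (-(1 / 2)) z

/-- The q-sine `sin(z; q²)`. -/
def qSin (q : ℝ) (z : ℂ) : ℂ := z * qBessel q (1 / 2) z

/-- The q-exponential `e(z; q²) = cos(-iz; q²) + i sin(-iz; q²)`. -/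
def qExp (q : ℝ) (z : ℂ) : ℂ :=
  qCos q (-Complex.I * z) + Complex.I * qSin q (-Complex.I * z)

/-- The q-Weinstein kernel
`Λ_{q,λ}^α(x) = e(-i λ₁ x₁; q²) j_α(λ₂ x₂; q²)`. -/
def kernel (q α : ℝ) (lam x : ℝ × ℝ) : ℂ :=
  qExp q (-Complex.I * lam.1 * x.1) * qBessel q α (lam.2 * x.2)

/-! ### The lattice and functions on it -/

/-- `ℝ_q = {± q^n : n ∈ ℤ}`. -/
def Rq (q : ℝ) : Set ℝ := {x | ∃ n : ℤ, x = q ^ n ∨ x = -q ^ n}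

/-- `ℝ_q² = ℝ_q × ℝ_q`. -/
abbrev Rq2 (q : ℝ) : Type := Rq q × Rq q

/-- The point `q^n` of `ℝ_q`. -/
def pos (q : ℝ) (n : ℤ) : Rq q := ⟨q ^ n, n, Or.inl rfl⟩

/-- The point `-q^n` of `ℝ_q`. -/
def neg (q : ℝ) (n : ℤ) : Rq q := ⟨-q ^ n, n, Or.inr rfl⟩

/-- The inclusion `ℝ_q² ⊆ ℝ²`. -/
def toPlane {q : ℝ} (x : Rq2 q) : ℝ × ℝ := ((x.1 : ℝ), (x.2 : ℝ))

/-- The Euclidean norm `‖x‖ = √(x₁² + x₂²)` on `ℝ_q²`. -/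
def enorm2 {q : ℝ} (x : Rq2 q) : ℝ := Real.sqrt ((x.1 : ℝ) ^ 2 + (x.2 : ℝ) ^ 2)

open Classical in
/-- The value `f(w)` of a function `f` on `ℝ_q` at a real number `w`. It is only used at points
`w = ± q^{±1} z` and `w = -z` with `z ∈ ℝ_q`; these lie in `ℝ_q` (see `mul_mem_Rq`,
`inv_mul_mem_Rq`, `neg_mem_Rq`), so that the value `0` outside `ℝ_q` plays no role. -/
def value {q : ℝ} (f : Rq q → ℂ) (w : ℝ) : ℂ := if h : w ∈ Rq q then f ⟨w, h⟩ else 0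

theorem neg_mem_Rq {q z : ℝ} (hz : z ∈ Rq q) : -z ∈ Rq q := by
  obtain ⟨n, rfl | rfl⟩ := hz
  · exact ⟨n, Or.inr rfl⟩
  · exact ⟨n, Or.inl (neg_neg _)⟩

theorem mul_mem_Rq {q z : ℝ} (hq : q ≠ 0) (hz : z ∈ Rq q) : q * z ∈ Rq q := by
  obtain ⟨n, rfl | rfl⟩ := hz
  · exact ⟨1 + n, Or.inl (by rw [zpow_add₀ hq, zpow_one])⟩
  · exact ⟨1 + n, Or.inr (by rw [zpow_add₀ hq, zpow_one]; ring)⟩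

theorem inv_mul_mem_Rq {q z : ℝ} (hq : q ≠ 0) (hz : z ∈ Rq q) : q⁻¹ * z ∈ Rq q := by
  obtain ⟨n, rfl | rfl⟩ := hz
  · exact ⟨-1 + n, Or.inl (by rw [zpow_add₀ hq, zpow_neg_one])⟩
  · exact ⟨-1 + n, Or.inr (by rw [zpow_add₀ hq, zpow_neg_one]; ring)⟩

/-- The reflection `x ↦ -x` of `ℝ_q`. -/
def negRq {q : ℝ} (x : Rq q) : Rq q := ⟨-(x : ℝ), neg_mem_Rq x.2⟩

/-! ### The q-differential operators -/

/-- The `q²`-analogue differential operator on functions on `ℝ_q`: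
`∂_q f(z) = [f(q⁻¹z) + f(-q⁻¹z) - f(qz) + f(-qz) - 2 f(-z)] / (2 (1-q) z)`. -/
def qDeriv {q : ℝ} (f : Rq q → ℂ) (z : Rq q) : ℂ :=
  (value f (q⁻¹ * z) + value f (-(q⁻¹ * z)) - value f (q * z) + value f (-(q * z))
    - 2 * value f (-z)) / (2 * (1 - q) * (z : ℝ) : ℝ)

/-- The partial operator `∂_{x,q}`. -/
def partialX {q : ℝ} (f : Rq2 q → ℂ) : Rq2 q → ℂ :=
  fun p => qDeriv (fun x => f (x, p.2)) p.1

/-- The partial operator `∂_{y,q}`. -/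
def partialY {q : ℝ} (f : Rq2 q → ℂ) : Rq2 q → ℂ :=
  fun p => qDeriv (fun y => f (p.1, y)) p.2

/-- `D_q^β = ∂_{x,q}^{β₁} ∂_{y,q}^{β₂}`. -/
def Dq {q : ℝ} (β : ℕ × ℕ) (f : Rq2 q → ℂ) : Rq2 q → ℂ :=
  partialX^[β.1] (partialY^[β.2] f)

/-- The q-Weinstein operator
`Δ_{α,q} f = ∂_{x,q}² f + |y|^{-(2α+1)} ∂_{y,q} (|y|^{2α+1} ∂_{y,q} f)`. -/
def weinsteinOp {q : ℝ} (α : ℝ) (f : Rq2 q → ℂ) : Rq2 q → ℂ :=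
  fun p => partialX (partialX f) p
    + (1 / |(p.2 : ℝ)| ^ (2 * α + 1) : ℝ)
      * partialY (fun s => (|(s.2 : ℝ)| ^ (2 * α + 1) : ℝ) * partialY f s) p

/-! ### The function spaces -/

/-- `f` is q-smooth: each `D_q^β f` has a limit, along `ℝ_q²`, at the origin and at every other
point of the coordinate axes. (All other points of `ℝ_q²` are isolated, and the closure of `ℝ_q²`
is `(ℝ_q ∪ {0})²`; so this says that each `D_q^β f` extends continuously to `(ℝ_q ∪ {0})²`.
At the points `p` of the axes outside this closure the filter is trivial.) -/
def QSmooth {q : ℝ} (f : Rq2 q → ℂ) : Prop :=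
  ∀ β : ℕ × ℕ, ∀ p : ℝ × ℝ, p.1 = 0 ∨ p.2 = 0 →
    ∃ l : ℂ, Tendsto (Dq β f) (comap toPlane (𝓝 p)) (𝓝 l)

/-- `f` is even with respect to the last variable. -/
def EvenLast {q : ℝ} (f : Rq2 q → ℂ) : Prop := ∀ x y, f (x, negRq y) = f (x, y)

/-- `𝒟_{*,q}(ℝ_q²)`: the q-smooth functions, even in the last variable, supported in
`B(0,a) = {x ∈ ℝ_q² : ‖x‖ ≤ a}` for some `a > 0`. -/
def testSpace (q : ℝ) : Set (Rq2 q → ℂ) :=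
  {f | QSmooth f ∧ EvenLast f ∧ ∃ a : ℝ, 0 < a ∧ ∀ x, a < enorm2 x → f x = 0}

/-- The q-Schwartz space `𝒮_{*,q}(ℝ_q²)`: the q-smooth functions, even in the last variable, with
`sup_x sup_{|β| ≤ n} |D_q^β (‖x‖^{2n} f)(x)| < ∞` for every `n`. -/
def schwartzSpace (q : ℝ) : Set (Rq2 q → ℂ) :=
  {f | QSmooth f ∧ EvenLast f ∧
    ∀ n : ℕ, ∃ C : ℝ, ∀ x : Rq2 q, ∀ β : ℕ × ℕ, β.1 + β.2 ≤ n →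
      ‖Dq β (fun t => ((enorm2 t ^ (2 * n) : ℝ) : ℂ) * f t) x‖ ≤ C}

/-- The weight `B_{n,m,q} = ((1-q)^{2m} / (q^{2n}; q⁻¹)_{2m})²`. -/
def weightB (n m : ℕ) (q : ℝ) : ℝ := ((1 - q) ^ (2 * m) / qPoch (q ^ (2 * n)) q⁻¹ (2 * m)) ^ 2

/-- The real Paley-Wiener space `PW_{α,q}^m`. -/
def paleyWiener (q α : ℝ) (m : ℕ) : Set (Rq2 q → ℂ) :=
  {f | f ∈ schwartzSpace q ∧ ∃ a : ℝ, 0 < a ∧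
    BddAbove {s : ℝ | ∃ (x : Rq2 q) (n : ℕ), m ≤ n ∧
      s = (a ^ (2 * n))⁻¹ * weightB n m q * (1 + enorm2 x ^ 2) ^ m
        * ‖(weinsteinOp α)^[n] f x‖}}

/-! ### Jackson integrals and the q-Weinstein transform -/

/-- The Jackson integral `∫_0^∞ f(x) d_q x` of a function on `ℝ_q`. -/
def jacksonPos {q : ℝ} (f : Rq q → ℂ) : ℂ :=
  ((1 - q : ℝ) : ℂ) * ∑' n : ℤ, ((q ^ n : ℝ) : ℂ) * f (pos q n)

/-- The Jackson integral `∫_{-∞}^∞ f(x) d_q x`. -/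
def jacksonLine {q : ℝ} (f : Rq q → ℂ) : ℂ :=
  ((1 - q : ℝ) : ℂ) * ∑' n : ℤ, ((q ^ n : ℝ) : ℂ) * f (pos q n)
    + ((1 - q : ℝ) : ℂ) * ∑' n : ℤ, ((q ^ n : ℝ) : ℂ) * f (neg q n)

/-- `f ∈ L¹_{α,q}(ℝ_{q,+}²)`: the Jackson integral of `f` over `ℝ_q × ℝ_{q,+}` with respect to
`x₂^{2α+1} d_q x₁ d_q x₂` converges absolutely. -/
def IntegrableQ {q : ℝ} (α : ℝ) (f : Rq2 q → ℂ) : Prop :=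
  Summable (fun k : ℤ × ℤ =>
    q ^ k.1 * q ^ k.2 * (q ^ k.2) ^ (2 * α + 1)
      * (‖f (pos q k.1, pos q k.2)‖ + ‖f (neg q k.1, pos q k.2)‖))

/-- `K_{α,q} = (1+q)^{1/2-α} / (2 Γ_{q²}(1/2) Γ_{q²}(α+1))`. -/
def constK (q α : ℝ) : ℝ :=
  (1 + q) ^ (1 / 2 - α) / (2 * qGamma (q ^ 2) (1 / 2) * qGamma (q ^ 2) (α + 1))

/-- The q-Weinstein transform
`F(f)(λ) = K_{α,q} ∫_0^∞ ∫_{-∞}^∞ f(x,y) Λ_{q,λ}^α(x,y) y^{2α+1} d_q x d_q y`, as a function of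
`λ ∈ ℝ_q²`. -/
def weinsteinTransform {q : ℝ} (α : ℝ) (f : Rq2 q → ℂ) : Rq2 q → ℂ := fun lam =>
  (constK q α : ℂ) * jacksonPos (fun y : Rq q => jacksonLine (fun x : Rq q =>
    f (x, y) * kernel q α (toPlane lam) (toPlane (x, y)) * (((y : ℝ) ^ (2 * α + 1) : ℝ) : ℂ)))

end QWeinstein

end

noncomputable section

namespace QWeinstein

/-! ### Infinite q-shifted factorials and Euler's expansion -/

section QSeries

variable {p : ℝ}

lemma multipliable_qPochInf (hp0 : 0 < p) (hp1 : p < 1) (x : ℝ) :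
    Multipliable fun k : ℕ => 1 - x * p ^ k := by
  have h : Summable fun k : ℕ => ‖-(x * p ^ k)‖ := by
    simp only [norm_neg, norm_mul, norm_pow]
    exact (summable_geometric_of_lt_one (norm_nonneg _)
      (by rwa [Real.norm_of_nonneg hp0.le])).mul_left _
  simpa [sub_eq_add_neg] using multipliable_one_add_of_summable h

lemma qPochInf_eq_qPoch_mul (hp0 : 0 < p) (hp1 : p < 1) (x : ℝ) (n : ℕ) :
    qPochInf x p = qPoch x p n * qPochInf (x * p ^ n) p := by
  have h2 : ∀ k : ℕ, 1 - x * p ^ n * p ^ k = 1 - x * p ^ (k + n) := fun k => by ring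
  have h3 : Multipliable fun k : ℕ => 1 - x * p ^ (k + n) :=
    (multipliable_qPochInf hp0 hp1 (x * p ^ n)).congr h2
  have h4 := Multipliable.prod_mul_tprod_nat_mul' (f := fun k : ℕ => 1 - x * p ^ k) h3
  rw [qPochInf, qPoch, qPochInf, ← h4]
  simp only [h2]

lemma qPochInf_eq_mul (hp0 : 0 < p) (hp1 : p < 1) (x : ℝ) :
    qPochInf x p = (1 - x) * qPochInf (x * p) p := by
  simpa [qPoch] using qPochInf_eq_qPoch_mul hp0 hp1 x 1

lemma tendsto_qPoch (hp0 : 0 < p) (hp1 : p < 1) (x : ℝ) :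
    Tendsto (fun n => qPoch x p n) atTop (𝓝 (qPochInf x p)) :=
  (multipliable_qPochInf hp0 hp1 x).tendsto_prod_tprod_nat

lemma mul_pow_lt_one (hp0 : 0 < p) (hp1 : p < 1) {x : ℝ} (hx0 : 0 ≤ x) (hx1 : x < 1) (k : ℕ) :
    x * p ^ k < 1 :=
  (mul_le_of_le_one_right hx0 (pow_le_one₀ hp0.le hp1.le)).trans_lt hx1

lemma qPoch_pos (hp0 : 0 < p) (hp1 : p < 1) {x : ℝ} (hx0 : 0 ≤ x) (hx1 : x < 1) (n : ℕ) :
    0 < qPoch x p n :=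
  Finset.prod_pos fun k _ => sub_pos.2 (mul_pow_lt_one hp0 hp1 hx0 hx1 k)

lemma qPoch_le_one (hp0 : 0 < p) (hp1 : p < 1) {x : ℝ} (hx0 : 0 ≤ x) (hx1 : x < 1) (n : ℕ) :
    qPoch x p n ≤ 1 :=
  Finset.prod_le_one (fun k _ => (sub_pos.2 (mul_pow_lt_one hp0 hp1 hx0 hx1 k)).le)
    fun k _ => sub_le_self _ (by positivity)

lemma qPochInf_pos (hp0 : 0 < p) (hp1 : p < 1) {x : ℝ} (hx0 : 0 ≤ x) (hx1 : x < 1) :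
    0 < qPochInf x p := by
  refine lt_of_le_of_ne (ge_of_tendsto' (tendsto_qPoch hp0 hp1 x)
    fun n => (qPoch_pos hp0 hp1 hx0 hx1 n).le) (Ne.symm ?_)
  have h : Summable fun k : ℕ => ‖-(x * p ^ k)‖ := by
    simp only [norm_neg, norm_mul, norm_pow]
    exact (summable_geometric_of_lt_one (norm_nonneg _)
      (by rwa [Real.norm_of_nonneg hp0.le])).mul_left _
  have := tprod_one_add_ne_zero_of_summable
    (fun k => by linarith [mul_pow_lt_one hp0 hp1 hx0 hx1 k]) h
  simpa [sub_eq_add_neg, qPochInf] using this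

lemma qPochInf_le_one (hp0 : 0 < p) (hp1 : p < 1) {x : ℝ} (hx0 : 0 ≤ x) (hx1 : x < 1) :
    qPochInf x p ≤ 1 :=
  le_of_tendsto' (tendsto_qPoch hp0 hp1 x) fun n => qPoch_le_one hp0 hp1 hx0 hx1 n

/-- The coefficients of Euler's expansion `(z; p)_∞ = ∑ eulerCoeff p n * z ^ n`. -/
def eulerCoeff (p : ℝ) (n : ℕ) : ℝ := (-1) ^ n * p ^ (n.choose 2) / qPoch p p n

@[simp] lemma eulerCoeff_zero : eulerCoeff p 0 = 1 := by simp [eulerCoeff, qPoch]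

lemma eulerCoeff_ne_zero (hp0 : 0 < p) (hp1 : p < 1) (n : ℕ) : eulerCoeff p n ≠ 0 :=
  div_ne_zero (mul_ne_zero (by simp) (pow_ne_zero _ hp0.ne'))
    (qPoch_pos hp0 hp1 hp0.le hp1 n).ne'

lemma one_sub_pow_pos (hp0 : 0 < p) (hp1 : p < 1) (n : ℕ) : 0 < 1 - p ^ (n + 1) :=
  sub_pos.2 (pow_lt_one₀ hp0.le hp1 n.succ_ne_zero)

lemma eulerCoeff_succ (hp0 : 0 < p) (hp1 : p < 1) (n : ℕ) :
    (1 - p ^ (n + 1)) * eulerCoeff p (n + 1) = -p ^ n * eulerCoeff p n := by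
  have h1 := (qPoch_pos hp0 hp1 hp0.le hp1 n).ne'
  have h2 := (one_sub_pow_pos hp0 hp1 n).ne'
  have h3 : qPoch p p (n + 1) = qPoch p p n * (1 - p ^ (n + 1)) := by
    rw [qPoch, Finset.prod_range_succ, ← qPoch]; ring
  have h4 : (n + 1).choose 2 = n + n.choose 2 := by
    rw [Nat.choose_succ_succ' n 1, Nat.choose_one_right]
  rw [eulerCoeff, eulerCoeff, h3, h4]
  field_simp
  ring

lemma summable_eulerCoeff (hp0 : 0 < p) (hp1 : p < 1) {z : ℝ} (hz : 0 ≤ z) :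
    Summable fun n => |eulerCoeff p n| * z ^ n := by
  rcases hz.eq_or_lt with rfl | hz
  · refine summable_of_ne_finset_zero (s := {0}) fun n hn => ?_
    simp at hn
    simp [hn]
  refine summable_of_ratio_test_tendsto_lt_one (l := 0) one_pos
    (Eventually.of_forall fun n => mul_ne_zero (abs_ne_zero.2 (eulerCoeff_ne_zero hp0 hp1 n))
      (pow_ne_zero _ hz.ne')) ?_
  have key : ∀ n, ‖|eulerCoeff p (n + 1)| * z ^ (n + 1)‖ / ‖|eulerCoeff p n| * z ^ n‖
      = p ^ n * (z / (1 - p ^ (n + 1))) := by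
    intro n
    have h2 := one_sub_pow_pos hp0 hp1 n
    have h3 : |eulerCoeff p (n + 1)| = p ^ n / (1 - p ^ (n + 1)) * |eulerCoeff p n| := by
      have : eulerCoeff p (n + 1) = -(p ^ n / (1 - p ^ (n + 1)) * eulerCoeff p n) := by
        have := eulerCoeff_succ hp0 hp1 n
        field_simp
        linarith
      rw [this, abs_neg, abs_mul, abs_of_pos (by positivity)]
    have h4 := abs_pos.2 (eulerCoeff_ne_zero hp0 hp1 n)
    rw [Real.norm_of_nonneg (by positivity), Real.norm_of_nonneg (by positivity), h3]
    field_simp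
    ring
  simp_rw [key]
  have h0 : Tendsto (fun n : ℕ => p ^ n) atTop (𝓝 0) :=
    tendsto_pow_atTop_nhds_zero_of_lt_one hp0.le hp1
  have h1 : Tendsto (fun n : ℕ => z / (1 - p ^ (n + 1))) atTop (𝓝 (z / (1 - 0))) :=
    tendsto_const_nhds.div (tendsto_const_nhds.sub (h0.comp (tendsto_add_atTop_nat 1)))
      (by simp)
  simpa using h0.mul h1

lemma summable_eulerCoeff' (hp0 : 0 < p) (hp1 : p < 1) (z : ℝ) :
    Summable fun n => eulerCoeff p n * z ^ n := by
  refine Summable.of_norm ?_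
  simpa [abs_mul] using summable_eulerCoeff hp0 hp1 (abs_nonneg z)

lemma tendsto_tsum_mul_pow {c : ℕ → ℝ} (hp0 : 0 < p) (hp1 : p < 1)
    (hc : Summable fun n => |c n|) :
    Tendsto (fun n : ℕ => ∑' k, c k * (p ^ n) ^ k) atTop (𝓝 (c 0)) := by
  have h := tendsto_tsum_of_dominated_convergence (𝓕 := atTop)
    (f := fun n k => c k * (p ^ n) ^ k) (g := fun k => if k = 0 then c 0 else 0) hc ?_ ?_
  · simpa using h
  · intro k
    rcases Nat.eq_zero_or_pos k with rfl | hk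
    · simp
    · have : Tendsto (fun n : ℕ => (p ^ k) ^ n) atTop (𝓝 0) :=
        tendsto_pow_atTop_nhds_zero_of_lt_one (by positivity) (pow_lt_one₀ hp0.le hp1 hk.ne')
      simpa [hk.ne', ← pow_mul, mul_comm] using this.const_mul (c k)
  · refine Eventually.of_forall fun n k => ?_
    rw [norm_mul, norm_pow, norm_pow, Real.norm_of_nonneg hp0.le, Real.norm_eq_abs]
    exact mul_le_of_le_one_right (abs_nonneg _)
      (pow_le_one₀ (by positivity) (pow_le_one₀ hp0.le hp1.le))

/-- Euler's expansion of the infinite q-shifted factorial. -/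
lemma qPochInf_eq_tsum (hp0 : 0 < p) (hp1 : p < 1) (z : ℝ) :
    qPochInf z p = ∑' n, eulerCoeff p n * z ^ n := by
  have hs := summable_eulerCoeff' hp0 hp1
  have rec1 : ∀ z, ∑' n, eulerCoeff p n * z ^ n
      = (1 - z) * ∑' n, eulerCoeff p n * (z * p) ^ n := by
    intro z
    rw [sub_mul, one_mul, ← tsum_mul_left, (hs z).tsum_eq_zero_add,
      (hs (z * p)).tsum_eq_zero_add]
    simp only [pow_zero, mul_one, eulerCoeff_zero]
    rw [add_sub_assoc, ← Summable.tsum_sub ((summable_nat_add_iff 1).2 (hs (z * p)))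
      ((hs (z * p)).mul_left z)]
    congr 1
    refine tsum_congr fun n => ?_
    have := eulerCoeff_succ hp0 hp1 n
    rw [mul_pow, mul_pow]
    linear_combination z ^ (n + 1) * this
  have rec2 : ∀ n : ℕ, ∑' k, eulerCoeff p k * z ^ k
      = qPoch z p n * ∑' k, eulerCoeff p k * z ^ k * (p ^ n) ^ k := by
    intro n
    induction n with
    | zero => simp [qPoch]
    | succ n ih =>
      rw [ih, qPoch, qPoch, Finset.prod_range_succ, mul_assoc]
      congr 1
      have := rec1 (z * p ^ n)
      simp only [mul_pow, ← mul_assoc] at this ⊢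
      rw [this]
      congr 1
      refine tsum_congr fun k => ?_
      ring
  have h1 : Tendsto (fun n : ℕ => qPoch z p n * ∑' k, eulerCoeff p k * z ^ k * (p ^ n) ^ k)
      atTop (𝓝 (qPochInf z p * (eulerCoeff p 0 * z ^ 0))) := by
    refine (tendsto_qPoch hp0 hp1 z).mul (tendsto_tsum_mul_pow hp0 hp1 ?_)
    exact (hs z).abs
  simp only [← rec2, eulerCoeff_zero, pow_zero, mul_one] at h1
  exact (tendsto_nhds_unique h1 tendsto_const_nhds)

/-- `(p^{j+1}; p)_∞`, which vanishes for negative `j`. -/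
def shiftPoch (p : ℝ) (j : ℤ) : ℝ := qPochInf (p ^ (j + 1)) p

lemma shiftPoch_of_neg {j : ℤ} (hp0 : 0 < p) (hj : j < 0) : shiftPoch p j = 0 := by
  refine tprod_of_exists_eq_zero ⟨(-j - 1).toNat, ?_⟩
  have h : (((-j - 1).toNat : ℕ) : ℤ) = -j - 1 := Int.toNat_of_nonneg (by omega)
  rw [← zpow_natCast, h, ← zpow_add₀ hp0.ne']
  simp

lemma zpow_succ_lt_one (hp0 : 0 < p) (hp1 : p < 1) {j : ℤ} (hj : 0 ≤ j) : p ^ (j + 1) < 1 := by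
  simpa using (zpow_lt_zpow_iff_right_of_lt_one₀ hp0 hp1).2 (show 0 < j + 1 by omega)

lemma shiftPoch_nonneg (hp0 : 0 < p) (hp1 : p < 1) (j : ℤ) : 0 ≤ shiftPoch p j := by
  rcases lt_or_ge j 0 with hj | hj
  · exact (shiftPoch_of_neg hp0 hj).ge
  · exact (qPochInf_pos hp0 hp1 (zpow_pos hp0 _).le (zpow_succ_lt_one hp0 hp1 hj)).le

lemma shiftPoch_le_one (hp0 : 0 < p) (hp1 : p < 1) (j : ℤ) : shiftPoch p j ≤ 1 := by
  rcases lt_or_ge j 0 with hj | hj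
  · exact (shiftPoch_of_neg hp0 hj).le.trans zero_le_one
  · exact qPochInf_le_one hp0 hp1 (zpow_pos hp0 _).le (zpow_succ_lt_one hp0 hp1 hj)

lemma shiftPoch_sub_one (hp0 : 0 < p) (hp1 : p < 1) (j : ℤ) :
    shiftPoch p (j - 1) = (1 - p ^ j) * shiftPoch p j := by
  rw [shiftPoch, shiftPoch, sub_add_cancel, qPochInf_eq_mul hp0 hp1, zpow_add_one₀ hp0.ne']

/-! ### The q-Bessel function on the lattice -/

/-- Up to the factor `(a; p)_∞`, the q-Bessel function `₁φ₁(0; a; p, p x)` at `x = p^N`. -/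
def besselLat (p a : ℝ) (N : ℤ) : ℝ := ∑' n : ℕ, eulerCoeff p n * a ^ n * shiftPoch p (N + n)

lemma summable_besselLat (hp0 : 0 < p) (hp1 : p < 1) (a : ℝ) (N : ℤ) :
    Summable fun n : ℕ => eulerCoeff p n * a ^ n * shiftPoch p (N + n) := by
  refine Summable.of_norm_bounded (summable_eulerCoeff hp0 hp1 (abs_nonneg a)) fun n => ?_
  rw [norm_mul, norm_mul, norm_pow, Real.norm_eq_abs, Real.norm_eq_abs,
    Real.norm_of_nonneg (shiftPoch_nonneg hp0 hp1 _)]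
  exact mul_le_of_le_one_right (by positivity) (shiftPoch_le_one hp0 hp1 _)

lemma besselLat_sub (hp0 : 0 < p) (hp1 : p < 1) (a : ℝ) (N : ℤ) :
    besselLat p a (N - 1) - besselLat p a N = -p ^ N * besselLat p (a * p) N := by
  rw [besselLat, besselLat, besselLat, ← tsum_mul_left,
    ← (summable_besselLat hp0 hp1 a (N - 1)).tsum_sub (summable_besselLat hp0 hp1 a N)]
  refine tsum_congr fun n => ?_
  rw [show N - 1 + (n : ℤ) = N + n - 1 by ring, shiftPoch_sub_one hp0 hp1, zpow_add₀ hp0.ne',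
    zpow_natCast]
  ring

lemma besselLat_contig (hp0 : 0 < p) (hp1 : p < 1) (a : ℝ) (N : ℤ) :
    besselLat p (a * p) N - a * besselLat p (a * p) (N + 1) = besselLat p a N := by
  have h1 := summable_besselLat hp0 hp1 (a * p) N
  have h2 := summable_besselLat hp0 hp1 (a * p) (N + 1)
  have h3 := summable_besselLat hp0 hp1 a N
  rw [besselLat, besselLat, besselLat, ← tsum_mul_left, h1.tsum_eq_zero_add, h3.tsum_eq_zero_add,
    add_sub_assoc, ← ((summable_nat_add_iff 1).2 h1).tsum_sub (h2.mul_left a)]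
  simp only [pow_zero]
  congr 1
  refine tsum_congr fun n => ?_
  have := eulerCoeff_succ hp0 hp1 n
  rw [show N + 1 + (n : ℤ) = N + ((n + 1 : ℕ) : ℤ) by push_cast; ring]
  rw [mul_pow, mul_pow]
  linear_combination (-a ^ (n + 1) * shiftPoch p (N + ((n + 1 : ℕ) : ℤ))) * this

lemma zpow_mul_abs_besselLat_le (hp0 : 0 < p) (hp1 : p < 1) (a : ℝ) (M : ℕ) :
    ∃ C, 0 < C ∧ ∀ N : ℤ, (p ^ N) ^ M * |besselLat p a N| ≤ C := by
  have hs := summable_eulerCoeff hp0 hp1 (z := |a| * (p ^ M)⁻¹) (by positivity)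
  refine ⟨∑' n, |eulerCoeff p n| * (|a| * (p ^ M)⁻¹) ^ n + 1, by positivity, fun N => ?_⟩
  have hn := (summable_besselLat hp0 hp1 a N)
  rw [besselLat, ← abs_of_pos (show 0 < (p ^ N) ^ M by positivity), ← abs_mul, ← tsum_mul_left,
    ← Real.norm_eq_abs]
  refine (tsum_of_norm_bounded hs.hasSum fun n => ?_).trans (by linarith)
  rw [norm_mul, norm_mul, norm_mul, norm_pow a, Real.norm_eq_abs, Real.norm_eq_abs,
    Real.norm_eq_abs, Real.norm_of_nonneg (shiftPoch_nonneg hp0 hp1 _),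
    abs_of_pos (show 0 < (p ^ N) ^ M by positivity), mul_pow]
  have key : (p ^ N) ^ M * shiftPoch p (N + n) ≤ ((p ^ M)⁻¹) ^ n := by
    rcases lt_or_ge (N + n) 0 with h | h
    · rw [shiftPoch_of_neg hp0 h, mul_zero]; positivity
    · have h1 : (p ^ N) ^ M ≤ ((p ^ M)⁻¹) ^ n := by
        rw [inv_pow, ← pow_mul, mul_comm M n, pow_mul, ← inv_pow]
        refine pow_le_pow_left₀ (zpow_pos hp0 _).le ?_ _
        rw [← zpow_natCast, ← zpow_neg]
        exact (zpow_le_zpow_iff_right_of_lt_one₀ hp0 hp1).2 (by omega)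
      exact (mul_le_of_le_one_right (by positivity) (shiftPoch_le_one hp0 hp1 _)).trans h1
  calc (p ^ N) ^ M * (|eulerCoeff p n| * |a| ^ n * shiftPoch p (N + n))
      = |eulerCoeff p n| * |a| ^ n * ((p ^ N) ^ M * shiftPoch p (N + n)) := by ring
    _ ≤ |eulerCoeff p n| * |a| ^ n * ((p ^ M)⁻¹) ^ n := by gcongr
    _ = _ := by ring

lemma abs_besselLat_le (hp0 : 0 < p) (hp1 : p < 1) (a : ℝ) :
    ∃ C, 0 < C ∧ ∀ N : ℤ, |besselLat p a N| ≤ C := by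
  simpa using zpow_mul_abs_besselLat_le hp0 hp1 a 0

lemma exists_besselLat_ne_zero (hp0 : 0 < p) (hp1 : p < 1) (a : ℝ) :
    ∃ N : ℤ, besselLat p a N ≠ 0 := by
  by_contra! h
  have h1 : ∀ i : ℕ, ∀ N : ℤ, besselLat p (a * p ^ i) N = 0 := by
    intro i
    induction i with
    | zero => simpa using h
    | succ i ih =>
      intro N
      have := besselLat_sub hp0 hp1 (a * p ^ i) N
      rw [ih, ih, sub_zero, zero_eq_mul] at this
      rw [pow_succ, ← mul_assoc]
      exact this.resolve_left (neg_ne_zero.2 (zpow_ne_zero _ hp0.ne'))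
  have h2 := tendsto_tsum_mul_pow hp0 hp1 (summable_besselLat hp0 hp1 a 0).abs
  have h3 : ∀ n : ℕ, ∑' k : ℕ, eulerCoeff p k * a ^ k * shiftPoch p (0 + k) * (p ^ n) ^ k = 0 := by
    intro n
    rw [← h1 n 0, besselLat]
    exact tsum_congr fun k => by ring
  simp only [h3] at h2
  have h4 := tendsto_nhds_unique h2 tendsto_const_nhds
  have h5 : 0 < shiftPoch p 0 := qPochInf_pos hp0 hp1 (zpow_pos hp0 _).le (by simpa using hp1)
  simp at h4
  exact h5.ne' h4

/-- The power series of the q-Bessel function on the lattice. -/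
lemma besselLat_eq_tsum (hp0 : 0 < p) (hp1 : p < 1) {a : ℝ} (ha0 : 0 ≤ a) (ha1 : a < 1) (N : ℤ) :
    besselLat p a N
      = qPochInf a p * ∑' n : ℕ, eulerCoeff p n * (p ^ (N + 1)) ^ n / qPoch a p n := by
  have hsum : Summable (Function.uncurry fun k n : ℕ =>
      eulerCoeff p k * a ^ k * (eulerCoeff p n * (p ^ (N + k + 1)) ^ n)) := by
    have h0 := (summable_eulerCoeff hp0 hp1 ha0).mul_of_nonneg
      (summable_eulerCoeff hp0 hp1 (zpow_pos hp0 (N + 1)).le)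
      (fun n => by positivity) (fun n => by positivity)
    refine Summable.of_norm_bounded h0 fun ⟨k, n⟩ => ?_
    simp only [Function.uncurry, norm_mul, norm_pow, Real.norm_eq_abs, abs_of_nonneg ha0]
    refine mul_le_mul_of_nonneg_left ?_ (by positivity)
    refine mul_le_mul_of_nonneg_left (pow_le_pow_left₀ (abs_nonneg _) ?_ _) (abs_nonneg _)
    rw [abs_of_pos (zpow_pos hp0 _)]
    exact (zpow_le_zpow_iff_right_of_lt_one₀ hp0 hp1).2 (by omega)
  calc besselLat p a N
      = ∑' k : ℕ, ∑' n : ℕ, eulerCoeff p k * a ^ k * (eulerCoeff p n * (p ^ (N + k + 1)) ^ n) := by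
        refine tsum_congr fun k => ?_
        rw [tsum_mul_left, shiftPoch, qPochInf_eq_tsum hp0 hp1]
    _ = ∑' n : ℕ, ∑' k : ℕ, eulerCoeff p k * a ^ k * (eulerCoeff p n * (p ^ (N + k + 1)) ^ n) :=
        (hsum.tsum_comm).symm
    _ = _ := by
        rw [← tsum_mul_left]
        refine tsum_congr fun n => ?_
        have h1 : ∀ k : ℕ, eulerCoeff p k * a ^ k * (eulerCoeff p n * (p ^ (N + k + 1)) ^ n)
            = eulerCoeff p n * (p ^ (N + 1)) ^ n * (eulerCoeff p k * (a * p ^ n) ^ k) := by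
          intro k
          rw [show N + k + 1 = N + 1 + k by ring, zpow_add₀ hp0.ne', zpow_natCast]
          ring
        simp_rw [h1]
        rw [tsum_mul_left, ← qPochInf_eq_tsum hp0 hp1, qPochInf_eq_qPoch_mul hp0 hp1 a n]
        have := (qPoch_pos hp0 hp1 ha0 ha1 n).ne'
        field_simp

end QSeries

/-! ### Difference operators on functions on `ℤ × ℤ` -/

/-- Functions of `(p^k, p^l)`. -/
abbrev LatFun := ℤ → ℤ → ℂ

/-- The backward difference quotient `(F(s/p, t) - F(s, t)) / s` at `s = p^k`. -/
def T1 (p : ℝ) : Module.End ℂ LatFun where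
  toFun F k l := ((p ^ (-k) : ℝ) : ℂ) * (F (k - 1) l - F k l)
  map_add' F G := by ext k l; simp only [Pi.add_apply]; ring
  map_smul' c F := by ext k l; simp only [Pi.smul_apply, smul_eq_mul, RingHom.id_apply]; ring

/-- The backward difference quotient in the second variable. -/
def T2 (p : ℝ) : Module.End ℂ LatFun where
  toFun F k l := ((p ^ (-l) : ℝ) : ℂ) * (F k (l - 1) - F k l)
  map_add' F G := by ext k l; simp only [Pi.add_apply]; ring
  map_smul' c F := by ext k l; simp only [Pi.smul_apply, smul_eq_mul, RingHom.id_apply]; ring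

/-- Multiplication by `s = p^k`. -/
def S1 (p : ℝ) : Module.End ℂ LatFun where
  toFun F k l := ((p ^ k : ℝ) : ℂ) * F k l
  map_add' F G := by ext k l; simp only [Pi.add_apply]; ring
  map_smul' c F := by ext k l; simp only [Pi.smul_apply, smul_eq_mul, RingHom.id_apply]; ring

/-- Multiplication by `t = p^l`. -/
def S2 (p : ℝ) : Module.End ℂ LatFun where
  toFun F k l := ((p ^ l : ℝ) : ℂ) * F k l
  map_add' F G := by ext k l; simp only [Pi.add_apply]; ring
  map_smul' c F := by ext k l; simp only [Pi.smul_apply, smul_eq_mul, RingHom.id_apply]; ring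

/-- The dilation `s ↦ p s`. -/
def D1 : Module.End ℂ LatFun where
  toFun F k l := F (k + 1) l
  map_add' _ _ := rfl
  map_smul' _ _ := rfl

/-- The dilation `t ↦ p t`. -/
def D2 : Module.End ℂ LatFun where
  toFun F k l := F k (l + 1)
  map_add' _ _ := rfl
  map_smul' _ _ := rfl

/-- The interchange of the two variables. -/
def swapL : Module.End ℂ LatFun where
  toFun F k l := F l k
  map_add' _ _ := rfl
  map_smul' _ _ := rfl

/-- The operator `F(s, t) ↦ F(s, t) - b F(p s, t)`. -/
def L1 (b : ℝ) : Module.End ℂ LatFun := 1 - (b : ℂ) • D1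

/-- The operator `F(s, t) ↦ F(s, t) - b F(s, p t)`. -/
def L2 (b : ℝ) : Module.End ℂ LatFun := 1 - (b : ℂ) • D2

/-- The q-Bessel operator in the first variable, up to normalization. -/
def B1 (p b : ℝ) : Module.End ℂ LatFun := L1 b * T1 p

/-- The q-Bessel operator in the second variable, up to normalization. -/
def B2 (p b : ℝ) : Module.End ℂ LatFun := L2 b * T2 p

section Operators

variable {p : ℝ}

lemma T1_apply (F : LatFun) (k l : ℤ) :
    T1 p F k l = ((p ^ (-k) : ℝ) : ℂ) * (F (k - 1) l - F k l) := rfl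

lemma T2_apply (F : LatFun) (k l : ℤ) :
    T2 p F k l = ((p ^ (-l) : ℝ) : ℂ) * (F k (l - 1) - F k l) := rfl

lemma S1_apply (F : LatFun) (k l : ℤ) : S1 p F k l = ((p ^ k : ℝ) : ℂ) * F k l := rfl

lemma S2_apply (F : LatFun) (k l : ℤ) : S2 p F k l = ((p ^ l : ℝ) : ℂ) * F k l := rfl

lemma D1_apply (F : LatFun) (k l : ℤ) : D1 F k l = F (k + 1) l := rfl

lemma swapL_apply (F : LatFun) (k l : ℤ) : swapL F k l = F l k := rfl

lemma swapL_swapL (F : LatFun) : swapL (swapL F) = F := rfl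

lemma L1_apply (b : ℝ) (F : LatFun) (k l : ℤ) : L1 b F k l = F k l - b * F (k + 1) l := rfl

lemma L2_apply (b : ℝ) (F : LatFun) (k l : ℤ) : L2 b F k l = F k l - b * F k (l + 1) := rfl

lemma B1_apply (b : ℝ) (F : LatFun) (k l : ℤ) :
    B1 p b F k l = T1 p F k l - b * T1 p F (k + 1) l := rfl

lemma B2_apply (b : ℝ) (F : LatFun) (k l : ℤ) :
    B2 p b F k l = T2 p F k l - b * T2 p F k (l + 1) := rfl

lemma commute_T1_T2 : Commute (T1 p) (T2 p) := by
  refine LinearMap.ext fun F => ?_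
  ext k l
  simp only [Module.End.mul_apply, T1_apply, T2_apply]
  ring

lemma commute_S1_T2 : Commute (S1 p) (T2 p) := by
  refine LinearMap.ext fun F => ?_
  ext k l
  simp only [Module.End.mul_apply, S1_apply, T2_apply]
  ring

lemma commute_S2_T1 : Commute (S2 p) (T1 p) := by
  refine LinearMap.ext fun F => ?_
  ext k l
  simp only [Module.End.mul_apply, S2_apply, T1_apply]
  ring

lemma commute_D1_T2 : Commute D1 (T2 p) := rfl

lemma commute_D2_T1 : Commute D2 (T1 p) := rfl

lemma T1_S1 (hp0 : 0 < p) (F : LatFun) :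
    T1 p (S1 p F) = ((p⁻¹ : ℝ) : ℂ) • S1 p (T1 p F) + ((p⁻¹ - 1 : ℝ) : ℂ) • F := by
  ext k l
  have h : (p : ℂ) ≠ 0 := by exact_mod_cast hp0.ne'
  have h2 : (p : ℂ) ^ k ≠ 0 := zpow_ne_zero _ h
  simp only [T1_apply, S1_apply, Pi.add_apply, Pi.smul_apply, smul_eq_mul]
  push_cast
  rw [zpow_sub_one₀ h, zpow_neg]
  field_simp
  ring

lemma T1_pow_S1 (hp0 : 0 < p) (i : ℕ) (F : LatFun) :
    (T1 p ^ i) (S1 p F) = ((p⁻¹ ^ i : ℝ) : ℂ) • S1 p ((T1 p ^ i) F)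
      + ((p⁻¹ ^ i - 1 : ℝ) : ℂ) • (T1 p ^ (i - 1)) F := by
  induction i with
  | zero => simp
  | succ i ih =>
    rw [pow_succ', Module.End.mul_apply, ih, map_add, map_smul, map_smul, T1_S1 hp0,
      Module.End.mul_apply]
    rcases Nat.eq_zero_or_pos i with rfl | hi
    · simp
    · have : T1 p ((T1 p ^ (i - 1)) F) = (T1 p ^ i) F := by
        rw [← Module.End.mul_apply, ← pow_succ', Nat.sub_add_cancel hi]
      rw [this, Nat.add_sub_cancel]
      ext k l
      simp only [Pi.add_apply, Pi.smul_apply, smul_eq_mul]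
      push_cast
      ring

lemma T1_D1 (hp0 : 0 < p) (F : LatFun) : T1 p (D1 F) = (p : ℂ) • D1 (T1 p F) := by
  ext k l
  have h : (p : ℂ) ≠ 0 := by exact_mod_cast hp0.ne'
  simp only [T1_apply, D1_apply, Pi.smul_apply, smul_eq_mul]
  push_cast
  rw [neg_add, zpow_add₀ h, zpow_neg_one, show k - 1 + 1 = k + 1 - 1 by ring]
  field_simp

lemma T1_pow_D1 (hp0 : 0 < p) (i : ℕ) (F : LatFun) :
    (T1 p ^ i) (D1 F) = ((p ^ i : ℝ) : ℂ) • D1 ((T1 p ^ i) F) := by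
  induction i with
  | zero => simp
  | succ i ih =>
    rw [pow_succ', Module.End.mul_apply, ih, map_smul, T1_D1 hp0, Module.End.mul_apply, smul_smul]
    push_cast
    ring_nf

lemma T1_L1 (hp0 : 0 < p) (b : ℝ) (F : LatFun) : T1 p (L1 b F) = L1 (b * p) (T1 p F) := by
  rw [L1, LinearMap.sub_apply, LinearMap.smul_apply, map_sub, map_smul, T1_D1 hp0]
  ext k l
  simp only [L1_apply, Pi.sub_apply, Pi.smul_apply, smul_eq_mul, Module.End.one_apply, D1_apply]
  push_cast
  ring

lemma T1_pow_L1 (hp0 : 0 < p) (b : ℝ) (i : ℕ) (F : LatFun) :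
    (T1 p ^ i) (L1 b F) = L1 (b * p ^ i) ((T1 p ^ i) F) := by
  induction i with
  | zero => simp
  | succ i ih =>
    rw [pow_succ', Module.End.mul_apply, ih, T1_L1 hp0, Module.End.mul_apply, mul_assoc, pow_succ]

lemma T1_swapL (F : LatFun) : T1 p (swapL F) = swapL (T2 p F) := rfl

lemma S1_swapL (F : LatFun) : S1 p (swapL F) = swapL (S2 p F) := rfl

lemma T1_pow_swapL (i : ℕ) (F : LatFun) : (T1 p ^ i) (swapL F) = swapL ((T2 p ^ i) F) := by
  induction i with
  | zero => rfl
  | succ i ih => rw [pow_succ', Module.End.mul_apply, ih, T1_swapL, pow_succ', Module.End.mul_apply]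

lemma T2_pow_swapL (i : ℕ) (F : LatFun) : (T2 p ^ i) (swapL F) = swapL ((T1 p ^ i) F) := by
  rw [← swapL_swapL ((T2 p ^ i) (swapL F)), ← T1_pow_swapL, swapL_swapL]

lemma T2_pow_S2 (hp0 : 0 < p) (i : ℕ) (F : LatFun) :
    (T2 p ^ i) (S2 p F) = ((p⁻¹ ^ i : ℝ) : ℂ) • S2 p ((T2 p ^ i) F)
      + ((p⁻¹ ^ i - 1 : ℝ) : ℂ) • (T2 p ^ (i - 1)) F := by
  have h := congrArg swapL (T1_pow_S1 hp0 i (swapL F))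
  rw [T1_pow_swapL, T1_pow_swapL, S1_swapL, S1_swapL, T1_pow_swapL] at h
  exact h

lemma T1_pow_T2_pow (i j : ℕ) (F : LatFun) :
    (T1 p ^ i) ((T2 p ^ j) F) = (T2 p ^ j) ((T1 p ^ i) F) :=
  LinearMap.congr_fun (commute_T1_T2.pow_pow i j).eq F

lemma S1_T2_pow (j : ℕ) (F : LatFun) : S1 p ((T2 p ^ j) F) = (T2 p ^ j) (S1 p F) :=
  LinearMap.congr_fun (commute_S1_T2.pow_right j).eq F

lemma S2_T1_pow (j : ℕ) (F : LatFun) : S2 p ((T1 p ^ j) F) = (T1 p ^ j) (S2 p F) :=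
  LinearMap.congr_fun (commute_S2_T1.pow_right j).eq F

lemma D1_T2_pow (j : ℕ) (F : LatFun) : D1 ((T2 p ^ j) F) = (T2 p ^ j) (D1 F) :=
  LinearMap.congr_fun (commute_D1_T2.pow_right j).eq F

/-! ### Rapidly decreasing smooth lattice functions -/

/-- `F` decays faster than any power of `s` and `t`. -/
def Decay (p : ℝ) (F : LatFun) : Prop :=
  ∀ M N : ℕ, ∃ C : ℝ, ∀ k l : ℤ, (p ^ k) ^ M * (p ^ l) ^ N * ‖F k l‖ ≤ C

lemma Decay.add {F G : LatFun} (hp0 : 0 < p) (hF : Decay p F) (hG : Decay p G) :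
    Decay p (F + G) := by
  intro M N
  obtain ⟨C, hC⟩ := hF M N
  obtain ⟨C', hC'⟩ := hG M N
  refine ⟨C + C', fun k l => ?_⟩
  calc (p ^ k) ^ M * (p ^ l) ^ N * ‖(F + G) k l‖
      ≤ (p ^ k) ^ M * (p ^ l) ^ N * (‖F k l‖ + ‖G k l‖) := by
        gcongr
        exact norm_add_le _ _
    _ ≤ C + C' := by linarith [hC k l, hC' k l]

lemma Decay.smul {F : LatFun} (hF : Decay p F) (c : ℂ) : Decay p (c • F) := by
  intro M N
  obtain ⟨C, hC⟩ := hF M N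
  refine ⟨‖c‖ * C, fun k l => ?_⟩
  simp only [Pi.smul_apply, norm_smul]
  calc _ = ‖c‖ * ((p ^ k) ^ M * (p ^ l) ^ N * ‖F k l‖) := by ring
    _ ≤ _ := by gcongr; exact hC k l

lemma Decay.S1 {F : LatFun} (hp0 : 0 < p) (hF : Decay p F) : Decay p (S1 p F) := by
  intro M N
  obtain ⟨C, hC⟩ := hF (M + 1) N
  refine ⟨C, fun k l => (le_of_eq ?_).trans (hC k l)⟩
  rw [S1_apply, norm_mul, Complex.norm_of_nonneg (zpow_pos hp0 _).le]
  ring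

lemma Decay.swapL {F : LatFun} (hF : Decay p F) : Decay p (swapL F) := by
  intro M N
  obtain ⟨C, hC⟩ := hF N M
  refine ⟨C, fun k l => (le_of_eq ?_).trans (hC l k)⟩
  rw [swapL_apply]
  ring

lemma Decay.D1 {F : LatFun} (hp0 : 0 < p) (hF : Decay p F) : Decay p (D1 F) := by
  intro M N
  obtain ⟨C, hC⟩ := hF M N
  refine ⟨(p ^ M)⁻¹ * C, fun k l => ?_⟩
  refine (le_of_eq ?_).trans (mul_le_mul_of_nonneg_left (hC (k + 1) l) (by positivity))
  rw [D1_apply, zpow_add_one₀ hp0.ne', mul_pow]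
  field_simp

/-- The lattice version of the Schwartz space. -/
def IsRapid (p : ℝ) (F : LatFun) : Prop := ∀ i j : ℕ, Decay p ((T1 p ^ i) ((T2 p ^ j) F))

lemma IsRapid.decay {F : LatFun} (hF : IsRapid p F) : Decay p F := hF 0 0

lemma IsRapid.add {F G : LatFun} (hp0 : 0 < p) (hF : IsRapid p F) (hG : IsRapid p G) :
    IsRapid p (F + G) := fun i j => by
  rw [map_add, map_add]
  exact (hF i j).add hp0 (hG i j)

lemma IsRapid.smul {F : LatFun} (hF : IsRapid p F) (c : ℂ) : IsRapid p (c • F) := fun i j => by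
  rw [map_smul, map_smul]
  exact (hF i j).smul c

lemma IsRapid.sub {F G : LatFun} (hp0 : 0 < p) (hF : IsRapid p F) (hG : IsRapid p G) :
    IsRapid p (F - G) := by
  rw [show F - G = F + (-1 : ℂ) • G by simp [sub_eq_add_neg]]
  exact hF.add hp0 (hG.smul _)

lemma IsRapid.swapL {F : LatFun} (hF : IsRapid p F) : IsRapid p (swapL F) := fun i j => by
  rw [T2_pow_swapL, T1_pow_swapL, ← T1_pow_T2_pow]
  exact (hF j i).swapL

lemma IsRapid.T1 {F : LatFun} (hF : IsRapid p F) : IsRapid p (T1 p F) := fun i j => by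
  rw [T1_pow_T2_pow, ← Module.End.mul_apply (_ ^ i), ← pow_succ, ← T1_pow_T2_pow]
  exact hF (i + 1) j

lemma IsRapid.T2 {F : LatFun} (hF : IsRapid p F) : IsRapid p (T2 p F) := hF.swapL.T1.swapL

lemma IsRapid.S1 {F : LatFun} (hp0 : 0 < p) (hF : IsRapid p F) : IsRapid p (S1 p F) :=
  fun i j => by
  rw [← S1_T2_pow, T1_pow_S1 hp0]
  exact (((hF i j).S1 hp0).smul _).add hp0 ((hF (i - 1) j).smul _)

lemma IsRapid.S2 {F : LatFun} (hp0 : 0 < p) (hF : IsRapid p F) : IsRapid p (S2 p F) :=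
  (hF.swapL.S1 hp0).swapL

lemma IsRapid.D1 {F : LatFun} (hp0 : 0 < p) (hF : IsRapid p F) : IsRapid p (D1 F) :=
  fun i j => by
  rw [← D1_T2_pow, T1_pow_D1 hp0]
  exact ((hF i j).D1 hp0).smul _

lemma IsRapid.L1 {F : LatFun} (hp0 : 0 < p) (hF : IsRapid p F) (b : ℝ) : IsRapid p (L1 b F) :=
  hF.sub hp0 ((hF.D1 hp0).smul _)

lemma IsRapid.L2 {F : LatFun} (hp0 : 0 < p) (hF : IsRapid p F) (b : ℝ) : IsRapid p (L2 b F) :=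
  (hF.swapL.L1 hp0 b).swapL

lemma IsRapid.B1 {F : LatFun} (hp0 : 0 < p) (hF : IsRapid p F) (b : ℝ) : IsRapid p (B1 p b F) :=
  hF.T1.L1 hp0 b

lemma IsRapid.B2 {F : LatFun} (hp0 : 0 < p) (hF : IsRapid p F) (b : ℝ) : IsRapid p (B2 p b F) :=
  hF.T2.L2 hp0 b

/-! ### Geometric weights on `ℤ` -/

lemma summable_pow_natAbs {r : ℝ} (hr0 : 0 < r) (hr1 : r < 1) :
    Summable fun k : ℤ => r ^ k.natAbs := by
  refine Summable.of_nat_of_neg ?_ ?_ <;>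
  simpa using summable_geometric_of_lt_one hr0.le hr1

lemma exists_zpow_le (hp0 : 0 < p) (hp1 : p < 1) {b : ℝ} (hb0 : 0 < b) (hb1 : b < 1) :
    ∃ (M : ℕ) (r : ℝ), 0 < r ∧ r < 1 ∧
      ∀ k : ℤ, b ^ k ≤ r ^ k.natAbs * max 1 ((p ^ k) ^ M) := by
  obtain ⟨M, hM⟩ := exists_pow_lt_of_lt_one hb0 hp1
  refine ⟨M, max b (p ^ M / b), lt_max_of_lt_left hb0, max_lt hb1 ((div_lt_one hb0).2 hM),
    fun k => ?_⟩
  obtain ⟨n, rfl | rfl⟩ := k.eq_nat_or_neg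
  · simp only [zpow_natCast, Int.natAbs_natCast]
    calc b ^ n ≤ max b (p ^ M / b) ^ n * 1 := by
          rw [mul_one]; exact pow_le_pow_left₀ hb0.le (le_max_left _ _) _
      _ ≤ _ := by gcongr; exact le_max_left _ _
  · simp only [Int.natAbs_neg, Int.natAbs_natCast, zpow_neg, zpow_natCast]
    calc (b ^ n)⁻¹ = (p ^ M / b) ^ n * ((p ^ n)⁻¹) ^ M := by
          rw [div_pow, inv_pow, ← pow_mul, ← pow_mul, mul_comm n M]
          field_simp
      _ ≤ _ := by
        gcongr
        · exact le_max_right _ _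
        · exact le_max_right _ _

lemma Decay.max {F : LatFun} (hF : Decay p F) (M N : ℕ) :
    ∃ C : ℝ, 0 < C ∧ ∀ k l : ℤ, max 1 ((p ^ k) ^ M) * max 1 ((p ^ l) ^ N) * ‖F k l‖ ≤ C := by
  obtain ⟨C1, h1⟩ := hF 0 0
  obtain ⟨C2, h2⟩ := hF M 0
  obtain ⟨C3, h3⟩ := hF 0 N
  obtain ⟨C4, h4⟩ := hF M N
  refine ⟨|C1| + |C2| + |C3| + |C4| + 1, by positivity, fun k l => ?_⟩
  have h1 := (h1 k l).trans (le_abs_self _)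
  have h2 := (h2 k l).trans (le_abs_self _)
  have h3 := (h3 k l).trans (le_abs_self _)
  have h4 := (h4 k l).trans (le_abs_self _)
  simp only [pow_zero, one_mul, mul_one] at h1 h2 h3
  have := abs_nonneg C1
  have := abs_nonneg C2
  have := abs_nonneg C3
  have := abs_nonneg C4
  rcases max_choice 1 ((p ^ k) ^ M) with hk | hk <;>
  rcases max_choice 1 ((p ^ l) ^ N) with hl | hl <;> rw [hk, hl] <;> linarith

/-- Rapid decay gives geometric summability against both weights. -/
lemma Decay.geometric {F : LatFun} (hp0 : 0 < p) (hp1 : p < 1) (hF : Decay p F) {b a : ℝ}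
    (hb0 : 0 < b) (hb1 : b < 1) (ha0 : 0 < a) (ha1 : a < 1) :
    ∃ C r r' : ℝ, 0 < C ∧ 0 < r ∧ r < 1 ∧ 0 < r' ∧ r' < 1 ∧
      ∀ k l : ℤ, b ^ k * a ^ l * ‖F k l‖ ≤ C * (r ^ k.natAbs * r' ^ l.natAbs) := by
  obtain ⟨M, r, hr0, hr1, hr⟩ := exists_zpow_le hp0 hp1 hb0 hb1
  obtain ⟨N, r', hr0', hr1', hr'⟩ := exists_zpow_le hp0 hp1 ha0 ha1
  obtain ⟨C, hC0, hC⟩ := hF.max M N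
  refine ⟨C, r, r', hC0, hr0, hr1, hr0', hr1', fun k l => ?_⟩
  calc b ^ k * a ^ l * ‖F k l‖
      ≤ (r ^ k.natAbs * Max.max 1 ((p ^ k) ^ M)) * (r' ^ l.natAbs * Max.max 1 ((p ^ l) ^ N))
          * ‖F k l‖ := by
        gcongr
        · exact hr k
        · exact hr' l
    _ = (r ^ k.natAbs * r' ^ l.natAbs) *
          (Max.max 1 ((p ^ k) ^ M) * Max.max 1 ((p ^ l) ^ N) * ‖F k l‖) := by ring
    _ ≤ (r ^ k.natAbs * r' ^ l.natAbs) * C := by gcongr; exact hC k l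
    _ = _ := mul_comm _ _

lemma Decay.geometric_left {F : LatFun} (hp0 : 0 < p) (hp1 : p < 1) (hF : Decay p F) {b : ℝ}
    (hb0 : 0 < b) (hb1 : b < 1) (N : ℕ) :
    ∃ C r : ℝ, 0 < C ∧ 0 < r ∧ r < 1 ∧
      ∀ k l : ℤ, b ^ k * ((p ^ l) ^ N * ‖F k l‖) ≤ C * r ^ k.natAbs := by
  obtain ⟨M, r, hr0, hr1, hr⟩ := exists_zpow_le hp0 hp1 hb0 hb1
  obtain ⟨C, hC0, hC⟩ := hF.max M N
  refine ⟨C, r, hC0, hr0, hr1, fun k l => ?_⟩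
  calc b ^ k * ((p ^ l) ^ N * ‖F k l‖)
      ≤ (r ^ k.natAbs * Max.max 1 ((p ^ k) ^ M)) * (Max.max 1 ((p ^ l) ^ N) * ‖F k l‖) := by
        gcongr
        · exact hr k
        · exact le_max_right _ _
    _ = r ^ k.natAbs * (Max.max 1 ((p ^ k) ^ M) * Max.max 1 ((p ^ l) ^ N) * ‖F k l‖) := by ring
    _ ≤ r ^ k.natAbs * C := by gcongr; exact hC k l
    _ = _ := mul_comm _ _

end Operators

section Hankel

variable {p : ℝ}

/-! ### Summation by parts and orthogonality -/

/-- The backward difference quotient of a sequence. -/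
def seqT (p : ℝ) (u : ℤ → ℂ) (k : ℤ) : ℂ := ((p ^ (-k) : ℝ) : ℂ) * (u (k - 1) - u k)

/-- The q-Bessel operator on sequences. -/
def seqB (p a : ℝ) (u : ℤ → ℂ) (k : ℤ) : ℂ := seqT p u k - a * seqT p u (k + 1)

lemma tsum_shift (f : ℤ → ℂ) : ∑' k, f (k + 1) = ∑' k, f k :=
  (Equiv.addRight (1 : ℤ)).tsum_eq f

lemma summable_shift {f : ℤ → ℂ} : (Summable fun k => f (k + 1)) ↔ Summable f :=
  (Equiv.addRight (1 : ℤ)).summable_iff (f := f)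

lemma tsum_seqB_mul (hp0 : 0 < p) {a : ℝ} (ha : 0 < a) {u v : ℤ → ℂ}
    (h1 : Summable fun k => ((a ^ k : ℝ) : ℂ) * seqT p u k * v k)
    (h2 : Summable fun k => ((a ^ k : ℝ) : ℂ) * seqT p u k * v (k - 1)) :
    ∑' k, ((a ^ k : ℝ) : ℂ) * seqB p a u k * v k
      = -∑' k, ((a ^ k * p ^ k : ℝ) : ℂ) * (seqT p u k * seqT p v k) := by
  have h3 : Summable fun k => ((a ^ (k + 1) : ℝ) : ℂ) * seqT p u (k + 1) * v k := by
    simpa using summable_shift.2 h2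
  have e1 : ∀ k, ((a ^ k : ℝ) : ℂ) * seqB p a u k * v k = ((a ^ k : ℝ) : ℂ) * seqT p u k * v k
      - ((a ^ (k + 1) : ℝ) : ℂ) * seqT p u (k + 1) * v k := by
    intro k
    rw [seqB, zpow_add_one₀ ha.ne']
    push_cast
    ring
  have e2 := tsum_shift fun k => ((a ^ k : ℝ) : ℂ) * seqT p u k * v (k - 1)
  simp only [add_sub_cancel_right] at e2
  simp_rw [e1]
  rw [h1.tsum_sub h3, e2, ← h1.tsum_sub h2, ← tsum_neg]
  refine tsum_congr fun k => ?_
  have h : (p : ℂ) ^ k ≠ 0 := zpow_ne_zero _ (by exact_mod_cast hp0.ne')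
  simp only [seqT, zpow_neg]
  push_cast
  field_simp
  ring

/-- The q-Bessel operator is symmetric. -/
lemma tsum_seqB_symm (hp0 : 0 < p) {a : ℝ} (ha : 0 < a) {u v : ℤ → ℂ}
    (h1 : Summable fun k => ((a ^ k : ℝ) : ℂ) * seqT p u k * v k)
    (h2 : Summable fun k => ((a ^ k : ℝ) : ℂ) * seqT p u k * v (k - 1))
    (h3 : Summable fun k => ((a ^ k : ℝ) : ℂ) * seqT p v k * u k)
    (h4 : Summable fun k => ((a ^ k : ℝ) : ℂ) * seqT p v k * u (k - 1)) :
    ∑' k, ((a ^ k : ℝ) : ℂ) * seqB p a u k * v k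
      = ∑' k, ((a ^ k : ℝ) : ℂ) * seqB p a v k * u k := by
  rw [tsum_seqB_mul hp0 ha h1 h2, tsum_seqB_mul hp0 ha h3 h4]
  simp_rw [mul_comm (seqT p u _)]

/-- The sequence `k ↦ besselLat p a (k + n)`. -/
def besselSeq (p a : ℝ) (n k : ℤ) : ℂ := (besselLat p a (k + n) : ℂ)

lemma seqT_besselSeq (hp0 : 0 < p) (hp1 : p < 1) (a : ℝ) (n k : ℤ) :
    seqT p (besselSeq p a n) k = -((p ^ n : ℝ) : ℂ) * besselSeq p (a * p) n k := by
  have h := besselLat_sub hp0 hp1 a (k + n)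
  rw [seqT, besselSeq, besselSeq, besselSeq, show k - 1 + n = k + n - 1 by ring]
  rw [← Complex.ofReal_sub, h, ← Complex.ofReal_neg, ← Complex.ofReal_mul, ← Complex.ofReal_mul,
    zpow_add₀ hp0.ne', zpow_neg]
  have : p ^ k ≠ 0 := zpow_ne_zero _ hp0.ne'
  field_simp

lemma besselSeq_contig (hp0 : 0 < p) (hp1 : p < 1) (a : ℝ) (n k : ℤ) :
    besselSeq p (a * p) n k - a * besselSeq p (a * p) n (k + 1) = besselSeq p a n k := by
  rw [besselSeq, besselSeq, besselSeq, ← besselLat_contig hp0 hp1 a (k + n),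
    show k + 1 + n = k + n + 1 by ring]
  push_cast
  ring

lemma seqB_besselSeq (hp0 : 0 < p) (hp1 : p < 1) (a : ℝ) (n k : ℤ) :
    seqB p a (besselSeq p a n) k = -((p ^ n : ℝ) : ℂ) * besselSeq p a n k := by
  rw [seqB, seqT_besselSeq hp0 hp1, seqT_besselSeq hp0 hp1, ← besselSeq_contig hp0 hp1 a]
  ring

lemma norm_besselSeq_le (hp0 : 0 < p) (hp1 : p < 1) (a : ℝ) :
    ∃ C, 0 < C ∧ ∀ n k : ℤ, ‖besselSeq p a n k‖ ≤ C := by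
  obtain ⟨C, hC0, hC⟩ := abs_besselLat_le hp0 hp1 a
  exact ⟨C, hC0, fun n k => by rw [besselSeq, Complex.norm_real]; exact hC _⟩

lemma besselSeq_geometric (hp0 : 0 < p) (hp1 : p < 1) (a : ℝ) {b : ℝ} (hb0 : 0 < b) (hb1 : b < 1)
    (n : ℤ) : ∃ C r : ℝ, 0 < C ∧ 0 < r ∧ r < 1 ∧
      ∀ k : ℤ, b ^ k * ‖besselSeq p a n k‖ ≤ C * r ^ k.natAbs := by
  obtain ⟨M, r, hr0, hr1, hr⟩ := exists_zpow_le hp0 hp1 hb0 hb1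
  obtain ⟨C, hC0, hC⟩ := abs_besselLat_le hp0 hp1 a
  obtain ⟨C', hC0', hC'⟩ := zpow_mul_abs_besselLat_le hp0 hp1 a M
  refine ⟨max C (((p ^ n) ^ M)⁻¹ * C'), r, lt_max_of_lt_left hC0, hr0, hr1, fun k => ?_⟩
  have h1 : max 1 ((p ^ k) ^ M) * ‖besselSeq p a n k‖ ≤ max C (((p ^ n) ^ M)⁻¹ * C') := by
    rw [besselSeq, Complex.norm_real, Real.norm_eq_abs]
    rcases max_choice 1 ((p ^ k) ^ M) with h | h <;> rw [h]
    · rw [one_mul]; exact (hC _).trans (le_max_left _ _)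
    · refine le_trans (le_of_eq ?_)
        ((mul_le_mul_of_nonneg_left (hC' (k + n)) (by positivity)).trans (le_max_right _ _))
      rw [zpow_add₀ hp0.ne', mul_pow]
      have : p ^ n ≠ 0 := zpow_ne_zero _ hp0.ne'
      field_simp
  calc b ^ k * ‖besselSeq p a n k‖
      ≤ r ^ k.natAbs * max 1 ((p ^ k) ^ M) * ‖besselSeq p a n k‖ := by
        gcongr
        exact hr k
    _ = r ^ k.natAbs * (max 1 ((p ^ k) ^ M) * ‖besselSeq p a n k‖) := by ring
    _ ≤ r ^ k.natAbs * max C (((p ^ n) ^ M)⁻¹ * C') := by gcongr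
    _ = _ := mul_comm _ _

/-- A sequence with geometric decay against `a ^ k` is summable against a bounded one. -/
lemma summable_of_geometric {a C C' r : ℝ} (ha : 0 < a) (hr0 : 0 < r) (hr1 : r < 1)
    {u v : ℤ → ℂ} (hu : ∀ k : ℤ, a ^ k * ‖u k‖ ≤ C * r ^ k.natAbs) (hv : ∀ k, ‖v k‖ ≤ C')
    : Summable fun k => ((a ^ k : ℝ) : ℂ) * u k * v k := by
  refine Summable.of_norm_bounded (((summable_pow_natAbs hr0 hr1).mul_left C).mul_right C')
    fun k => ?_
  rw [norm_mul, norm_mul, Complex.norm_of_nonneg (zpow_pos ha _).le]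
  exact mul_le_mul (hu k) (hv k) (norm_nonneg _) ((by positivity : (0:ℝ) ≤ _).trans (hu k))

lemma summable_of_geometric' {a C C' r : ℝ} (ha : 0 < a) (hr0 : 0 < r) (hr1 : r < 1)
    {u v : ℤ → ℂ} (hu : ∀ k : ℤ, a ^ k * ‖u k‖ ≤ C * r ^ k.natAbs) (hv : ∀ k, ‖v k‖ ≤ C')
    : Summable fun k => ((a ^ k : ℝ) : ℂ) * v k * u k :=
  (summable_of_geometric ha hr0 hr1 hu hv).congr fun k => by ring

lemma summable_of_geometric_shift {a C C' r : ℝ} (ha : 0 < a) (hr0 : 0 < r) (hr1 : r < 1)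
    {u v : ℤ → ℂ} (hu : ∀ k : ℤ, a ^ k * ‖u k‖ ≤ C * r ^ k.natAbs) (hv : ∀ k, ‖v k‖ ≤ C')
    : Summable fun k => ((a ^ k : ℝ) : ℂ) * v k * u (k - 1) := by
  have h := (summable_of_geometric' ha hr0 hr1 hu (v := fun k => v (k + 1))
    fun k => hv _).mul_left (a : ℂ)
  refine summable_shift.1 (h.congr fun k => ?_)
  rw [zpow_add_one₀ ha.ne', add_sub_cancel_right]
  push_cast
  ring

/-- The pairing of a decaying sequence with a q-Bessel sequence. -/
lemma tsum_seqB_mul_besselSeq (hp0 : 0 < p) (hp1 : p < 1) {a : ℝ} (ha : 0 < a) {C r C' r' : ℝ}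
    (hr0 : 0 < r) (hr1 : r < 1) (hr0' : 0 < r') (hr1' : r' < 1) {u : ℤ → ℂ}
    (hu : ∀ k : ℤ, a ^ k * ‖u k‖ ≤ C * r ^ k.natAbs)
    (hTu : ∀ k : ℤ, a ^ k * ‖seqT p u k‖ ≤ C' * r' ^ k.natAbs) (n : ℤ) :
    ∑' k, ((a ^ k : ℝ) : ℂ) * besselSeq p a n k * seqB p a u k
      = -((p ^ n : ℝ) : ℂ) * ∑' k, ((a ^ k : ℝ) : ℂ) * besselSeq p a n k * u k := by
  obtain ⟨c, hc0, hc⟩ := norm_besselSeq_le hp0 hp1 a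
  obtain ⟨c', hc0', hc'⟩ := norm_besselSeq_le hp0 hp1 (a * p)
  have hT : ∀ k, ‖seqT p (besselSeq p a n) k‖ ≤ p ^ n * c' := fun k => by
    rw [seqT_besselSeq hp0 hp1, norm_mul, norm_neg, Complex.norm_of_nonneg (zpow_pos hp0 _).le]
    gcongr
    exact hc' n k
  have h := tsum_seqB_symm hp0 ha (u := u) (v := besselSeq p a n)
    (summable_of_geometric ha hr0' hr1' hTu (hc n))
    (summable_of_geometric ha hr0' hr1' hTu fun k => hc n (k - 1))
    (summable_of_geometric' ha hr0 hr1 hu hT)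
    (summable_of_geometric_shift ha hr0 hr1 hu hT)
  rw [← tsum_mul_left]
  simp_rw [seqB_besselSeq hp0 hp1] at h
  calc _ = ∑' k, ((a ^ k : ℝ) : ℂ) * seqB p a u k * besselSeq p a n k :=
        tsum_congr fun k => by ring
    _ = _ := h
    _ = _ := tsum_congr fun k => by ring

lemma summable_besselSeq_mul (hp0 : 0 < p) (hp1 : p < 1) {a : ℝ} (ha0 : 0 < a) (ha1 : a < 1)
    (m n : ℤ) : Summable fun k => ((a ^ k : ℝ) : ℂ) * besselSeq p a m k * besselSeq p a n k := by
  obtain ⟨C, r, hC, hr0, hr1, h⟩ := besselSeq_geometric hp0 hp1 a ha0 ha1 m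
  obtain ⟨c, hc0, hc⟩ := norm_besselSeq_le hp0 hp1 a
  exact summable_of_geometric ha0 hr0 hr1 h (hc n)

lemma tsum_besselSeq_mul_of_ne (hp0 : 0 < p) (hp1 : p < 1) {a : ℝ} (ha0 : 0 < a) (ha1 : a < 1)
    {m n : ℤ} (hmn : m ≠ n) :
    ∑' k, ((a ^ k : ℝ) : ℂ) * besselSeq p a m k * besselSeq p a n k = 0 := by
  obtain ⟨C, r, hC, hr0, hr1, h⟩ := besselSeq_geometric hp0 hp1 a ha0 ha1 n
  obtain ⟨C', r', hC', hr0', hr1', h'⟩ := besselSeq_geometric hp0 hp1 (a * p) ha0 ha1 n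
  have hT : ∀ k : ℤ, a ^ k * ‖seqT p (besselSeq p a n) k‖ ≤ (p ^ n * C') * r' ^ k.natAbs :=
    fun k => by
    rw [seqT_besselSeq hp0 hp1, norm_mul, norm_neg, Complex.norm_of_nonneg (zpow_pos hp0 _).le]
    have := mul_le_mul_of_nonneg_left (h' k) (zpow_pos hp0 n).le
    linarith
  have key := tsum_seqB_mul_besselSeq hp0 hp1 ha0 hr0 hr1 hr0' hr1' h hT m
  simp_rw [seqB_besselSeq hp0 hp1] at key
  have e : ∀ k, ((a ^ k : ℝ) : ℂ) * besselSeq p a m k * (-((p ^ n : ℝ) : ℂ) * besselSeq p a n k)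
      = -((p ^ n : ℝ) : ℂ) * (((a ^ k : ℝ) : ℂ) * besselSeq p a m k * besselSeq p a n k) :=
    fun k => by ring
  simp_rw [e] at key
  rw [tsum_mul_left] at key
  have hne : ((p ^ m : ℝ) : ℂ) - ((p ^ n : ℝ) : ℂ) ≠ 0 := by
    rw [sub_ne_zero]
    intro h
    exact hmn (zpow_right_injective₀ hp0 hp1.ne (by exact_mod_cast h))
  refine (mul_eq_zero.1 ?_).resolve_left hne
  linear_combination key

/-- The squared norm of the q-Bessel sequence. -/
def besselNorm (p a : ℝ) : ℝ := ∑' k : ℤ, a ^ k * besselLat p a k ^ 2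

lemma besselNorm_pos (hp0 : 0 < p) (hp1 : p < 1) {a : ℝ} (ha0 : 0 < a) (ha1 : a < 1) :
    0 < besselNorm p a := by
  have h : Summable fun k : ℤ => a ^ k * besselLat p a k ^ 2 := by
    have := (summable_besselSeq_mul hp0 hp1 ha0 ha1 0 0)
    rw [← Complex.summable_ofReal]
    refine this.congr fun k => ?_
    simp only [besselSeq, add_zero]
    push_cast
    ring
  obtain ⟨N, hN⟩ := exists_besselLat_ne_zero hp0 hp1 a
  exact h.tsum_pos (fun k => mul_nonneg (zpow_pos ha0 _).le (sq_nonneg _)) N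
    (mul_pos (zpow_pos ha0 _) (by positivity))

lemma tsum_besselSeq_mul_self {a : ℝ} (ha0 : 0 < a) (m : ℤ) :
    ∑' k, ((a ^ k : ℝ) : ℂ) * besselSeq p a m k * besselSeq p a m k
      = ((a ^ (-m) * besselNorm p a : ℝ) : ℂ) := by
  rw [besselNorm, ← tsum_mul_left, Complex.ofReal_tsum,
    ← (Equiv.addRight m).tsum_eq fun k : ℤ => ((a ^ (-m) * (a ^ k * besselLat p a k ^ 2) : ℝ) : ℂ)]
  refine tsum_congr fun k => ?_
  have : (a : ℂ) ≠ 0 := by exact_mod_cast ha0.ne'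
  have : (a : ℂ) ^ m ≠ 0 := zpow_ne_zero _ this
  simp only [besselSeq, Equiv.coe_addRight]
  push_cast
  rw [zpow_neg, zpow_add₀ ‹_›]
  field_simp

/-! ### The Hankel transform in one variable -/

/-- The q-Hankel transform in the first variable, with parameter `b` and scale `p^K`. -/
def hankel1 (p : ℝ) (K : ℤ) (b : ℝ) (F : LatFun) : LatFun := fun k' l =>
  ∑' k : ℤ, ((b ^ k : ℝ) : ℂ) * besselSeq p b (k' + K) k * F k l

/-- The q-Hankel transform in the second variable. -/
def hankel2 (p : ℝ) (K : ℤ) (b : ℝ) (F : LatFun) : LatFun := swapL (hankel1 p K b (swapL F))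

variable {K : ℤ} {b : ℝ} {F G : LatFun}

lemma IsRapid.summable_mul (hp0 : 0 < p) (hp1 : p < 1) (hb0 : 0 < b) (hb1 : b < 1)
    (hF : IsRapid p F) {v : ℤ → ℂ} {C' : ℝ} (hv : ∀ k, ‖v k‖ ≤ C') (l : ℤ) :
    Summable fun k => ((b ^ k : ℝ) : ℂ) * v k * F k l := by
  obtain ⟨C, r, hC, hr0, hr1, h⟩ := hF.decay.geometric_left hp0 hp1 hb0 hb1 0
  exact summable_of_geometric' hb0 hr0 hr1 (fun k => by simpa using h k l) hv

lemma IsRapid.summable_hankel1 (hp0 : 0 < p) (hp1 : p < 1) (hb0 : 0 < b) (hb1 : b < 1)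
    (hF : IsRapid p F) (a : ℝ) (n l : ℤ) :
    Summable fun k => ((b ^ k : ℝ) : ℂ) * besselSeq p a n k * F k l := by
  obtain ⟨c, hc0, hc⟩ := norm_besselSeq_le hp0 hp1 a
  exact hF.summable_mul hp0 hp1 hb0 hb1 (hc n) l

lemma hankel1_smul (c : ℂ) : hankel1 p K b (c • F) = c • hankel1 p K b F := by
  ext k l
  simp only [hankel1, Pi.smul_apply, smul_eq_mul]
  rw [← tsum_mul_left]
  exact tsum_congr fun k => by ring

lemma hankel1_add (hp0 : 0 < p) (hp1 : p < 1) (hb0 : 0 < b) (hb1 : b < 1)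
    (hF : IsRapid p F) (hG : IsRapid p G) :
    hankel1 p K b (F + G) = hankel1 p K b F + hankel1 p K b G := by
  ext k l
  simp only [hankel1, Pi.add_apply]
  rw [← (hF.summable_hankel1 hp0 hp1 hb0 hb1 _ _ _).tsum_add
    (hG.summable_hankel1 hp0 hp1 hb0 hb1 _ _ _)]
  exact tsum_congr fun k => by ring

lemma S2_hankel1 : S2 p (hankel1 p K b F) = hankel1 p K b (S2 p F) := by
  ext k l
  simp only [hankel1, S2_apply]
  rw [← tsum_mul_left]
  exact tsum_congr fun k => by ring

lemma T2_hankel1 (hp0 : 0 < p) (hp1 : p < 1) (hb0 : 0 < b) (hb1 : b < 1) (hF : IsRapid p F) :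
    T2 p (hankel1 p K b F) = hankel1 p K b (T2 p F) := by
  ext k l
  simp only [hankel1, T2_apply]
  rw [← (hF.summable_hankel1 hp0 hp1 hb0 hb1 _ _ _).tsum_sub
    (hF.summable_hankel1 hp0 hp1 hb0 hb1 _ _ _), ← tsum_mul_left]
  exact tsum_congr fun k => by ring

lemma B2_hankel1 (hp0 : 0 < p) (hp1 : p < 1) (hb0 : 0 < b) (hb1 : b < 1) (hF : IsRapid p F)
    (a : ℝ) : B2 p a (hankel1 p K b F) = hankel1 p K b (B2 p a F) := by
  ext k l
  rw [B2_apply, T2_hankel1 hp0 hp1 hb0 hb1 hF]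
  simp only [hankel1, B2_apply]
  rw [← tsum_mul_left, ← (hF.T2.summable_hankel1 hp0 hp1 hb0 hb1 _ _ _).tsum_sub
    ((hF.T2.summable_hankel1 hp0 hp1 hb0 hb1 _ _ _).mul_left _)]
  exact tsum_congr fun k => by ring

lemma T1_hankel1 (hp0 : 0 < p) (hp1 : p < 1) (hb0 : 0 < b) (hb1 : b < 1) (hF : IsRapid p F) :
    T1 p (hankel1 p K b F) = (-((p ^ K : ℝ) : ℂ)) • hankel1 p K (b * p) F := by
  ext k l
  simp only [hankel1, T1_apply, Pi.smul_apply, smul_eq_mul]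
  rw [← (hF.summable_hankel1 hp0 hp1 hb0 hb1 _ _ _).tsum_sub
    (hF.summable_hankel1 hp0 hp1 hb0 hb1 _ _ _), ← tsum_mul_left, ← tsum_mul_left]
  refine tsum_congr fun n => ?_
  have h := seqT_besselSeq hp0 hp1 b (n + K) k
  rw [seqT, besselSeq, besselSeq, besselSeq, zpow_add₀ hp0.ne'] at h
  simp only [besselSeq]
  rw [show n + (k - 1 + K) = k - 1 + (n + K) by ring, show n + (k + K) = k + (n + K) by ring,
    mul_zpow]
  push_cast at h ⊢
  linear_combination ((b : ℂ) ^ n * F n l) * h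

lemma B1_hankel1 (hp0 : 0 < p) (hp1 : p < 1) (hb0 : 0 < b) (hb1 : b < 1) (hF : IsRapid p F) :
    B1 p b (hankel1 p K b F) = (-((p ^ K : ℝ) : ℂ)) • hankel1 p K b (S1 p F) := by
  ext k l
  have hbp0 : 0 < b * p := by positivity
  have hbp1 : b * p < 1 := mul_lt_one_of_nonneg_of_lt_one_left hb0.le hb1 hp1.le
  rw [B1_apply, T1_hankel1 hp0 hp1 hb0 hb1 hF]
  simp only [hankel1, S1_apply, Pi.smul_apply, smul_eq_mul]
  rw [mul_left_comm, ← mul_sub, ← tsum_mul_left,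
    ← (hF.summable_hankel1 hp0 hp1 hbp0 hbp1 _ _ _).tsum_sub
    ((hF.summable_hankel1 hp0 hp1 hbp0 hbp1 _ _ _).mul_left _)]
  congr 1
  refine tsum_congr fun n => ?_
  have h := besselSeq_contig hp0 hp1 b (n + K) k
  rw [besselSeq, besselSeq, besselSeq] at h
  simp only [besselSeq]
  rw [show n + (k + 1 + K) = k + 1 + (n + K) by ring, show n + (k + K) = k + (n + K) by ring,
    mul_zpow]
  push_cast
  linear_combination ((b : ℂ) ^ n * (p : ℂ) ^ n * F n l) * h

lemma S1_hankel1 (hp0 : 0 < p) (hp1 : p < 1) (hb0 : 0 < b) (hb1 : b < 1) (hF : IsRapid p F) :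
    S1 p (hankel1 p K b F) = (-((p ^ (-K) : ℝ) : ℂ)) • hankel1 p K b (B1 p b F) := by
  ext k l
  obtain ⟨C, r, hC, hr0, hr1, h⟩ := hF.decay.geometric_left hp0 hp1 hb0 hb1 0
  obtain ⟨C', r', hC', hr0', hr1', h'⟩ := hF.T1.decay.geometric_left hp0 hp1 hb0 hb1 0
  have e0 : ∀ n, seqT p (fun k => F k l) n = T1 p F n l := fun n => rfl
  have key := tsum_seqB_mul_besselSeq hp0 hp1 hb0 hr0 hr1 hr0' hr1' (u := fun k => F k l)
    (fun k => by simpa using h k l) (fun k => by rw [e0]; simpa using h' k l) (k + K)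
  rw [zpow_add₀ hp0.ne'] at key
  simp only [S1_apply, hankel1, Pi.smul_apply, smul_eq_mul]
  have e : ∀ n, seqB p b (fun k => F k l) n = B1 p b F n l := fun n => rfl
  simp_rw [e] at key
  rw [key, zpow_neg]
  have : (p : ℂ) ^ K ≠ 0 := zpow_ne_zero _ (by exact_mod_cast hp0.ne')
  push_cast
  field_simp

lemma decay_hankel1 (hp0 : 0 < p) (hp1 : p < 1) (hb0 : 0 < b) (hb1 : b < 1) (hF : IsRapid p F) :
    Decay p (hankel1 p K b F) := by
  intro M
  induction M generalizing F with
  | zero =>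
    intro N
    obtain ⟨C, r, hC, hr0, hr1, h⟩ := hF.decay.geometric_left hp0 hp1 hb0 hb1 N
    obtain ⟨c, hc0, hc⟩ := norm_besselSeq_le hp0 hp1 b
    refine ⟨∑' k : ℤ, c * (C * r ^ k.natAbs), fun k l => ?_⟩
    rw [pow_zero, one_mul, ← Complex.norm_of_nonneg (show 0 ≤ (p ^ l) ^ N by positivity),
      ← norm_mul, hankel1, ← tsum_mul_left]
    refine tsum_of_norm_bounded (((summable_pow_natAbs hr0 hr1).mul_left C).mul_left c).hasSum
      fun n => ?_
    rw [norm_mul, norm_mul, norm_mul, Complex.norm_of_nonneg (show 0 ≤ (p ^ l) ^ N by positivity),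
      Complex.norm_of_nonneg (zpow_pos hb0 _).le]
    calc (p ^ l) ^ N * (b ^ n * ‖besselSeq p b (k + K) n‖ * ‖F n l‖)
        = ‖besselSeq p b (k + K) n‖ * (b ^ n * ((p ^ l) ^ N * ‖F n l‖)) := by ring
      _ ≤ c * (C * r ^ n.natAbs) :=
        mul_le_mul (hc _ _) (h n l) (by positivity) hc0.le
  | succ M ih =>
    intro N
    obtain ⟨C, hC⟩ := ih (hF.B1 hp0 b) N
    refine ⟨p ^ (-K) * C, fun k l => ?_⟩
    have h := congrFun (congrFun (S1_hankel1 (K := K) hp0 hp1 hb0 hb1 hF) k) l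
    have h2 := congrArg norm h
    simp only [S1_apply, Pi.smul_apply, smul_eq_mul, norm_mul, norm_neg] at h2
    rw [Complex.norm_of_nonneg (zpow_pos hp0 _).le, Complex.norm_of_nonneg (zpow_pos hp0 _).le]
      at h2
    calc (p ^ k) ^ (M + 1) * (p ^ l) ^ N * ‖hankel1 p K b F k l‖
        = (p ^ k) ^ M * (p ^ l) ^ N * (p ^ k * ‖hankel1 p K b F k l‖) := by ring
      _ = p ^ (-K) * ((p ^ k) ^ M * (p ^ l) ^ N * ‖hankel1 p K b (B1 p b F) k l‖) := by
        rw [h2]; ring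
      _ ≤ _ := by gcongr; exact hC k l

lemma IsRapid.hankel1 (hp0 : 0 < p) (hp1 : p < 1) (hb0 : 0 < b) (hb1 : b < 1)
    (hF : IsRapid p F) : IsRapid p (hankel1 p K b F) := by
  have h2 : ∀ j, ∀ {F}, IsRapid p F →
      (QWeinstein.T2 p ^ j) (QWeinstein.hankel1 p K b F)
        = QWeinstein.hankel1 p K b ((QWeinstein.T2 p ^ j) F) := by
    intro j
    induction j with
    | zero => intro F _; simp
    | succ j ih =>
      intro F hF
      rw [pow_succ, Module.End.mul_apply, T2_hankel1 hp0 hp1 hb0 hb1 hF, ih hF.T2,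
        Module.End.mul_apply]
  have h1 : ∀ i, ∀ {F} {b : ℝ}, 0 < b → b < 1 → IsRapid p F →
      Decay p ((QWeinstein.T1 p ^ i) (QWeinstein.hankel1 p K b F)) := by
    intro i
    induction i with
    | zero => intro F b hb0 hb1 hF; exact decay_hankel1 hp0 hp1 hb0 hb1 hF
    | succ i ih =>
      intro F b hb0 hb1 hF
      rw [pow_succ, Module.End.mul_apply, T1_hankel1 hp0 hp1 hb0 hb1 hF, map_smul]
      exact (ih (by positivity) (mul_lt_one_of_nonneg_of_lt_one_left hb0.le hb1 hp1.le) hF).smul _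
  have hT2 : ∀ j, ∀ {F}, IsRapid p F → IsRapid p ((QWeinstein.T2 p ^ j) F) := by
    intro j
    induction j with
    | zero => exact fun h => h
    | succ j ih =>
      intro F hF
      rw [pow_succ, Module.End.mul_apply]
      exact ih hF.T2
  intro i j
  rw [h2 j hF]
  exact h1 i hb0 hb1 (hT2 j hF)

/-- The q-Hankel transform is an involution up to a factor. -/
lemma hankel1_hankel1 (hp0 : 0 < p) (hp1 : p < 1) (hb0 : 0 < b) (hb1 : b < 1)
    (hF : IsRapid p F) :
    hankel1 p K b (hankel1 p K b F) = ((b ^ (-K) * besselNorm p b : ℝ) : ℂ) • F := by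
  ext m l
  obtain ⟨C, r, hC, hr0, hr1, h⟩ := hF.decay.geometric_left hp0 hp1 hb0 hb1 0
  obtain ⟨C', r', hC', hr0', hr1', h'⟩ := besselSeq_geometric hp0 hp1 b hb0 hb1 (m + K)
  obtain ⟨c, hc0, hc⟩ := norm_besselSeq_le hp0 hp1 b
  have hs : Summable (Function.uncurry fun n k : ℤ =>
      ((b ^ n : ℝ) : ℂ) * besselSeq p b (m + K) n *
        (((b ^ k : ℝ) : ℂ) * besselSeq p b (n + K) k * F k l)) := by
    have h0 := ((summable_pow_natAbs hr0' hr1').mul_left C').mul_of_nonneg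
      (((summable_pow_natAbs hr0 hr1).mul_left C).mul_left c)
      (fun n => by positivity) (fun n => by positivity)
    refine Summable.of_norm_bounded h0 fun ⟨n, k⟩ => ?_
    simp only [Function.uncurry, norm_mul]
    rw [Complex.norm_of_nonneg (zpow_pos hb0 _).le, Complex.norm_of_nonneg (zpow_pos hb0 _).le]
    refine mul_le_mul (h' n) ?_ (by positivity) (by positivity)
    calc b ^ k * ‖besselSeq p b (n + K) k‖ * ‖F k l‖
        = ‖besselSeq p b (n + K) k‖ * (b ^ k * ‖F k l‖) := by ring
      _ ≤ _ := mul_le_mul (hc _ _) (by simpa using h k l) (by positivity) hc0.le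
  simp only [hankel1, ← tsum_mul_left]
  rw [← hs.tsum_comm]
  have e : ∀ k, ∑' n : ℤ, ((b ^ n : ℝ) : ℂ) * besselSeq p b (m + K) n *
        (((b ^ k : ℝ) : ℂ) * besselSeq p b (n + K) k * F k l)
      = if k = m then ((b ^ (-K) * besselNorm p b : ℝ) : ℂ) * F m l else 0 := by
    intro k
    have e1 : ∀ n, ((b ^ n : ℝ) : ℂ) * besselSeq p b (m + K) n *
        (((b ^ k : ℝ) : ℂ) * besselSeq p b (n + K) k * F k l) = (((b ^ k : ℝ) : ℂ) * F k l) *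
        (((b ^ n : ℝ) : ℂ) * besselSeq p b (m + K) n * besselSeq p b (k + K) n) := by
      intro n
      have : besselSeq p b (n + K) k = besselSeq p b (k + K) n := by
        rw [besselSeq, besselSeq]; congr 2; ring
      rw [this]
      ring
    simp_rw [e1]
    rw [tsum_mul_left]
    split_ifs with hk
    · subst hk
      rw [tsum_besselSeq_mul_self hb0, neg_add, zpow_add₀ hb0.ne', zpow_neg b k]
      have : (b : ℂ) ^ k ≠ 0 := zpow_ne_zero _ (by exact_mod_cast hb0.ne')
      push_cast
      field_simp
    · rw [tsum_besselSeq_mul_of_ne hp0 hp1 hb0 hb1 (fun h => hk (by linarith)), mul_zero]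
  simp_rw [e]
  rw [tsum_ite_eq]
  rfl

end Hankel

section Dictionary

variable {q : ℝ}

/-! ### Functions on `ℝ_q²` in terms of lattice functions -/

/-- The exponent `n` of a point `± q^n` of `ℝ_q`. -/
def idx (x : Rq q) : ℤ := Classical.choose x.2

lemma idx_spec (x : Rq q) : (x : ℝ) = q ^ idx x ∨ (x : ℝ) = -q ^ idx x := Classical.choose_spec x.2

lemma idx_eq_of_abs (hq0 : 0 < q) (hq1 : q < 1) {x : Rq q} {n : ℤ} (h : |(x : ℝ)| = q ^ n) :
    idx x = n := by
  have h2 : |(x : ℝ)| = q ^ idx x := by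
    rcases idx_spec x with h | h <;> rw [h]
    · exact abs_of_pos (zpow_pos hq0 _)
    · rw [abs_neg, abs_of_pos (zpow_pos hq0 _)]
  exact zpow_right_injective₀ hq0 hq1.ne (h2.symm.trans h)

lemma abs_eq_zpow_idx (hq0 : 0 < q) (x : Rq q) : |(x : ℝ)| = q ^ idx x := by
  rcases idx_spec x with h | h <;> rw [h]
  · exact abs_of_pos (zpow_pos hq0 _)
  · rw [abs_neg, abs_of_pos (zpow_pos hq0 _)]

lemma sq_eq_zpow_idx (hq0 : 0 < q) (x : Rq q) : (x : ℝ) ^ 2 = (q ^ 2) ^ idx x := by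
  rw [← sq_abs, abs_eq_zpow_idx hq0, ← zpow_natCast, ← zpow_natCast, ← zpow_mul, ← zpow_mul,
    mul_comm]

lemma coe_ne_zero (hq0 : 0 < q) (x : Rq q) : (x : ℝ) ≠ 0 := by
  rw [← abs_pos, abs_eq_zpow_idx hq0]
  exact zpow_pos hq0 _

@[simp] lemma coe_pos (n : ℤ) : ((pos q n : Rq q) : ℝ) = q ^ n := rfl

@[simp] lemma coe_neg (n : ℤ) : ((neg q n : Rq q) : ℝ) = -q ^ n := rfl

lemma idx_pos (hq0 : 0 < q) (hq1 : q < 1) (n : ℤ) : idx (pos q n) = n :=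
  idx_eq_of_abs hq0 hq1 (abs_of_pos (zpow_pos hq0 _))

lemma idx_neg (hq0 : 0 < q) (hq1 : q < 1) (n : ℤ) : idx (neg q n) = n :=
  idx_eq_of_abs hq0 hq1 (by rw [coe_neg, abs_neg, abs_of_pos (zpow_pos hq0 _)])

lemma idx_negRq (hq0 : 0 < q) (hq1 : q < 1) (x : Rq q) : idx (negRq x) = idx x :=
  idx_eq_of_abs hq0 hq1 (by rw [negRq, abs_neg, abs_eq_zpow_idx hq0])

lemma negRq_pos (n : ℤ) : negRq (pos q n) = neg q n := rfl

lemma eq_pos_or_neg (x : Rq q) : x = pos q (idx x) ∨ x = neg q (idx x) := by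
  rcases idx_spec x with h | h
  · exact Or.inl (Subtype.ext h)
  · exact Or.inr (Subtype.ext h)

lemma value_eq {f : Rq q → ℂ} {w : ℝ} (h : w ∈ Rq q) : value f w = f ⟨w, h⟩ := dif_pos h

/-- The constant `1 / (1 - q)`. -/
def qScale (q : ℝ) : ℂ := (((1 - q)⁻¹ : ℝ) : ℂ)

lemma qDeriv_even (hq0 : 0 < q) (hq1 : q < 1) (u : ℤ → ℂ) (z : Rq q) :
    qDeriv (fun x : Rq q => u (idx x)) z = (z : ℝ) * (qScale q * seqT (q ^ 2) u (idx z)) := by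
  have hz := coe_ne_zero hq0 z
  have hz1 := inv_mul_mem_Rq hq0.ne' z.2
  have hz2 := mul_mem_Rq hq0.ne' z.2
  have i1 : idx (⟨q⁻¹ * z, hz1⟩ : Rq q) = idx z - 1 := idx_eq_of_abs hq0 hq1 (by
    rw [abs_mul, abs_eq_zpow_idx hq0, abs_of_pos (inv_pos.2 hq0), zpow_sub_one₀ hq0.ne', mul_comm])
  have i2 : idx (⟨q * z, hz2⟩ : Rq q) = idx z + 1 := idx_eq_of_abs hq0 hq1 (by
    rw [abs_mul, abs_eq_zpow_idx hq0, abs_of_pos hq0, zpow_add_one₀ hq0.ne', mul_comm])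
  have i3 : idx (⟨-(q⁻¹ * z), neg_mem_Rq hz1⟩ : Rq q) = idx z - 1 :=
    (idx_negRq hq0 hq1 ⟨q⁻¹ * z, hz1⟩).trans i1
  have i4 : idx (⟨-(q * z), neg_mem_Rq hz2⟩ : Rq q) = idx z + 1 :=
    (idx_negRq hq0 hq1 ⟨q * z, hz2⟩).trans i2
  have i5 : idx (⟨-z, neg_mem_Rq z.2⟩ : Rq q) = idx z := idx_negRq hq0 hq1 z
  rw [qDeriv, value_eq hz1, value_eq hz2, value_eq (neg_mem_Rq hz1), value_eq (neg_mem_Rq hz2),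
    value_eq (neg_mem_Rq z.2), i1, i2, i3, i4, i5, seqT, qScale, zpow_neg,
    ← sq_eq_zpow_idx hq0]
  have h1 : (1 - q : ℂ) ≠ 0 := by exact_mod_cast (sub_pos.2 hq1).ne'
  have h2 : ((z : ℝ) : ℂ) ≠ 0 := by exact_mod_cast hz
  push_cast
  field_simp
  ring

lemma qDeriv_odd (hq0 : 0 < q) (hq1 : q < 1) (u : ℤ → ℂ) (z : Rq q) :
    qDeriv (fun x : Rq q => ((x : ℝ) : ℂ) * u (idx x)) z
      = qScale q * (u (idx z) - q * u (idx z + 1)) := by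
  have hz := coe_ne_zero hq0 z
  have hz1 := inv_mul_mem_Rq hq0.ne' z.2
  have hz2 := mul_mem_Rq hq0.ne' z.2
  have i1 : idx (⟨q⁻¹ * z, hz1⟩ : Rq q) = idx z - 1 := idx_eq_of_abs hq0 hq1 (by
    rw [abs_mul, abs_eq_zpow_idx hq0, abs_of_pos (inv_pos.2 hq0), zpow_sub_one₀ hq0.ne', mul_comm])
  have i2 : idx (⟨q * z, hz2⟩ : Rq q) = idx z + 1 := idx_eq_of_abs hq0 hq1 (by
    rw [abs_mul, abs_eq_zpow_idx hq0, abs_of_pos hq0, zpow_add_one₀ hq0.ne', mul_comm])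
  have i3 : idx (⟨-(q⁻¹ * z), neg_mem_Rq hz1⟩ : Rq q) = idx z - 1 :=
    (idx_negRq hq0 hq1 ⟨q⁻¹ * z, hz1⟩).trans i1
  have i4 : idx (⟨-(q * z), neg_mem_Rq hz2⟩ : Rq q) = idx z + 1 :=
    (idx_negRq hq0 hq1 ⟨q * z, hz2⟩).trans i2
  have i5 : idx (⟨-z, neg_mem_Rq z.2⟩ : Rq q) = idx z := idx_negRq hq0 hq1 z
  rw [qDeriv, value_eq hz1, value_eq hz2, value_eq (neg_mem_Rq hz1), value_eq (neg_mem_Rq hz2),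
    value_eq (neg_mem_Rq z.2), i1, i2, i3, i4, i5, qScale]
  have h1 : (1 - q : ℂ) ≠ 0 := by exact_mod_cast (sub_pos.2 hq1).ne'
  have h2 : ((z : ℝ) : ℂ) ≠ 0 := by exact_mod_cast hz
  have h3 : (q : ℂ) ≠ 0 := by exact_mod_cast hq0.ne'
  push_cast
  field_simp
  ring

/-- The function `x^e y^e' F(x², y²)` on `ℝ_q²`. -/
def lift (e e' : Bool) (F : LatFun) : Rq2 q → ℂ := fun x =>
  ((x.1 : ℝ) : ℂ) ^ e.toNat * ((x.2 : ℝ) : ℂ) ^ e'.toNat * F (idx x.1) (idx x.2)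

/-- The action of `∂_{x,q}` on the even (`false`) and odd (`true`) components. -/
def stepX (q : ℝ) (e : Bool) : Module.End ℂ LatFun :=
  qScale q • bif e then L1 q else T1 (q ^ 2)

/-- The action of `∂_{y,q}` on the even (`false`) and odd (`true`) components. -/
def stepY (q : ℝ) (e : Bool) : Module.End ℂ LatFun :=
  qScale q • bif e then L2 q else T2 (q ^ 2)

lemma partialX_lift (hq0 : 0 < q) (hq1 : q < 1) (e e' : Bool) (F : LatFun) :
    partialX (lift (q := q) e e' F) = lift (!e) e' (stepX q e F) := by
  ext ⟨x, y⟩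
  cases e
  · have h := qDeriv_even hq0 hq1 (fun k => ((y : ℝ) : ℂ) ^ e'.toNat * F k (idx y)) x
    simp only [partialX, lift, Bool.toNat_false, pow_zero, one_mul, h]
    simp only [seqT, stepX, cond_false, LinearMap.smul_apply, Pi.smul_apply, smul_eq_mul, T1_apply,
      Bool.not_false, Bool.toNat_true, pow_one]
    ring
  · have h := qDeriv_odd hq0 hq1 (fun k => ((y : ℝ) : ℂ) ^ e'.toNat * F k (idx y)) x
    simp only [partialX, lift, Bool.toNat_true, pow_one, mul_assoc, h]
    simp only [stepX, cond_true, LinearMap.smul_apply, Pi.smul_apply, smul_eq_mul, L1_apply,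
      Bool.not_true, Bool.toNat_false, pow_zero]
    ring

lemma partialY_lift (hq0 : 0 < q) (hq1 : q < 1) (e e' : Bool) (F : LatFun) :
    partialY (lift (q := q) e e' F) = lift e (!e') (stepY q e' F) := by
  ext ⟨x, y⟩
  cases e'
  · have h := qDeriv_even hq0 hq1 (fun k => ((x : ℝ) : ℂ) ^ e.toNat * F (idx x) k) y
    simp only [partialY, lift, Bool.toNat_false, pow_zero, mul_one, h]
    simp only [seqT, stepY, cond_false, LinearMap.smul_apply, Pi.smul_apply, smul_eq_mul, T2_apply,
      Bool.not_false, Bool.toNat_true, pow_one]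
    ring
  · have h := qDeriv_odd hq0 hq1 (fun k => ((x : ℝ) : ℂ) ^ e.toNat * F (idx x) k) y
    simp only [partialY, lift, Bool.toNat_true, pow_one, mul_assoc]
    rw [show (fun y : Rq q => ((x : ℝ) : ℂ) ^ e.toNat * (((y : ℝ) : ℂ) * F (idx x) (idx y))) = _
      from funext fun y => mul_left_comm _ _ _, h]
    simp only [stepY, cond_true, LinearMap.smul_apply, Pi.smul_apply, smul_eq_mul, L2_apply,
      Bool.not_true, Bool.toNat_false, pow_zero]
    ring

lemma value_add (f g : Rq q → ℂ) (w : ℝ) : value (f + g) w = value f w + value g w := by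
  unfold value
  split_ifs <;> simp

lemma qDeriv_add (f g : Rq q → ℂ) (z : Rq q) : qDeriv (f + g) z = qDeriv f z + qDeriv g z := by
  simp only [qDeriv, value_add]
  ring

lemma partialX_add (f g : Rq2 q → ℂ) : partialX (f + g) = partialX f + partialX g := by
  ext x
  exact qDeriv_add _ _ _

lemma partialY_add (f g : Rq2 q → ℂ) : partialY (f + g) = partialY f + partialY g := by
  ext x
  exact qDeriv_add _ _ _

lemma iterate_add_of_add {A : (Rq2 q → ℂ) → Rq2 q → ℂ} (hA : ∀ f g, A (f + g) = A f + A g)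
    (n : ℕ) (f g : Rq2 q → ℂ) : A^[n] (f + g) = A^[n] f + A^[n] g := by
  induction n generalizing f g with
  | zero => rfl
  | succ n ih => rw [Function.iterate_succ_apply, hA, ih]; rfl

lemma Dq_add (β : ℕ × ℕ) (f g : Rq2 q → ℂ) : Dq β (f + g) = Dq β f + Dq β g := by
  rw [Dq, iterate_add_of_add partialY_add, iterate_add_of_add partialX_add]
  rfl

/-- Alternating products of a pair of operators. -/
def altWord (A : Bool → Module.End ℂ LatFun) : Bool → ℕ → Module.End ℂ LatFun
  | _, 0 => 1
  | e, n + 1 => altWord A (!e) n * A e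

/-- The parity after `n` differentiations. -/
def altParity : Bool → ℕ → Bool
  | e, 0 => e
  | e, n + 1 => altParity (!e) n

lemma iterate_partialX_lift (hq0 : 0 < q) (hq1 : q < 1) (e e' : Bool) (n : ℕ) (F : LatFun) :
    partialX^[n] (lift (q := q) e e' F)
      = lift (altParity e n) e' (altWord (stepX q) e n F) := by
  induction n generalizing e F with
  | zero => rfl
  | succ n ih =>
    rw [Function.iterate_succ_apply, partialX_lift hq0 hq1, ih]
    rfl

lemma iterate_partialY_lift (hq0 : 0 < q) (hq1 : q < 1) (e e' : Bool) (n : ℕ) (F : LatFun) :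
    partialY^[n] (lift (q := q) e e' F)
      = lift e (altParity e' n) (altWord (stepY q) e' n F) := by
  induction n generalizing e' F with
  | zero => rfl
  | succ n ih =>
    rw [Function.iterate_succ_apply, partialY_lift hq0 hq1, ih]
    rfl

lemma Dq_lift (hq0 : 0 < q) (hq1 : q < 1) (e e' : Bool) (β : ℕ × ℕ) (F : LatFun) :
    Dq β (lift (q := q) e e' F) = lift (altParity e β.1) (altParity e' β.2)
      (altWord (stepX q) e β.1 (altWord (stepY q) e' β.2 F)) := by
  rw [Dq, iterate_partialY_lift hq0 hq1, iterate_partialX_lift hq0 hq1]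

lemma enorm2_pow (hq0 : 0 < q) (x : Rq2 q) (n : ℕ) :
    enorm2 x ^ (2 * n) = ((q ^ 2) ^ idx x.1 + (q ^ 2) ^ idx x.2) ^ n := by
  rw [enorm2, pow_mul, Real.sq_sqrt (by positivity), sq_eq_zpow_idx hq0, sq_eq_zpow_idx hq0]

/-- Multiplication by `‖x‖² = s + t`. -/
def R (p : ℝ) : Module.End ℂ LatFun := S1 p + S2 p

lemma R_apply (p : ℝ) (F : LatFun) (k l : ℤ) :
    R p F k l = ((p ^ k + p ^ l : ℝ) : ℂ) * F k l := by
  rw [R, LinearMap.add_apply, Pi.add_apply, Pi.add_apply, S1_apply, S2_apply]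
  push_cast
  ring

lemma R_pow_apply (p : ℝ) (n : ℕ) (F : LatFun) (k l : ℤ) :
    (R p ^ n) F k l = (((p ^ k + p ^ l) ^ n : ℝ) : ℂ) * F k l := by
  induction n with
  | zero => simp
  | succ n ih =>
    rw [pow_succ', Module.End.mul_apply, R_apply, ih]
    push_cast
    ring

lemma enorm2_pow_mul_lift (hq0 : 0 < q) (e e' : Bool) (n : ℕ) (F : LatFun) :
    (fun t => ((enorm2 t ^ (2 * n) : ℝ) : ℂ) * lift (q := q) e e' F t)
      = lift e e' ((R (q ^ 2) ^ n) F) := by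
  ext x
  rw [enorm2_pow hq0]
  simp only [lift, R_pow_apply]
  ring

/-- The function with even component `E` and odd component `O` in the first variable. -/
def assemble (E O : LatFun) : Rq2 q → ℂ := lift false false E + lift true false O

lemma assemble_apply (E O : LatFun) (x : Rq2 q) : assemble E O x
    = E (idx x.1) (idx x.2) + ((x.1 : ℝ) : ℂ) * O (idx x.1) (idx x.2) := by
  simp [assemble, lift]

/-- The component of `f` that is even in the first variable. -/
def evenPart (f : Rq2 q → ℂ) : LatFun := fun k l =>
  (f (pos q k, pos q l) + f (neg q k, pos q l)) / 2

/-- The component of `f` that is odd in the first variable, divided by `x`. -/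
def oddPart (f : Rq2 q → ℂ) : LatFun := fun k l =>
  (f (pos q k, pos q l) - f (neg q k, pos q l)) / (2 * (q ^ k : ℝ))

lemma assemble_parts (hq0 : 0 < q) {f : Rq2 q → ℂ} (hf : EvenLast f) :
    assemble (evenPart f) (oddPart f) = f := by
  ext ⟨x, y⟩
  have hy : f (x, y) = f (x, pos q (idx y)) := by
    rcases eq_pos_or_neg y with h | h
    · rw [← h]
    · rw [← hf x (pos q (idx y)), negRq_pos, ← h]
  have h0 : ((q : ℂ) ^ idx x) ≠ 0 := zpow_ne_zero _ (by exact_mod_cast hq0.ne')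
  rw [assemble_apply, hy, evenPart, oddPart]
  rcases eq_pos_or_neg x with h | h
  · rw [show ((x : ℝ) : ℂ) = (q : ℂ) ^ idx x by rw [congrArg Subtype.val h]; simp, ← h]
    push_cast
    field_simp
    ring
  · rw [show ((x : ℝ) : ℂ) = -(q : ℂ) ^ idx x by rw [congrArg Subtype.val h]; simp, ← h]
    push_cast
    field_simp
    ring

lemma evenPart_assemble (hq0 : 0 < q) (hq1 : q < 1) (E O : LatFun) :
    evenPart (assemble (q := q) E O) = E := by
  ext k l
  simp only [evenPart, assemble_apply, idx_pos hq0 hq1, idx_neg hq0 hq1, coe_pos, coe_neg]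
  push_cast
  ring

lemma oddPart_assemble (hq0 : 0 < q) (hq1 : q < 1) (E O : LatFun) :
    oddPart (assemble (q := q) E O) = O := by
  ext k l
  have h0 : ((q : ℂ) ^ k) ≠ 0 := zpow_ne_zero _ (by exact_mod_cast hq0.ne')
  simp only [oddPart, assemble_apply, idx_pos hq0 hq1, idx_neg hq0 hq1, coe_pos, coe_neg]
  push_cast
  field_simp
  ring

lemma evenLast_assemble (hq0 : 0 < q) (hq1 : q < 1) (E O : LatFun) :
    EvenLast (assemble (q := q) E O) := fun x y => by
  simp only [assemble_apply, idx_negRq hq0 hq1]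

lemma enorm2_pow_mul_assemble (hq0 : 0 < q) (n : ℕ) (E O : LatFun) :
    (fun t => ((enorm2 t ^ (2 * n) : ℝ) : ℂ) * assemble (q := q) E O t)
      = assemble ((R (q ^ 2) ^ n) E) ((R (q ^ 2) ^ n) O) := by
  rw [assemble, assemble, ← enorm2_pow_mul_lift hq0, ← enorm2_pow_mul_lift hq0]
  ext x
  simp only [Pi.add_apply]
  ring

/-! ### The q-Weinstein operator -/

/-- The q-Weinstein operator on components with parameters `b` and `a`. -/
def latWeinstein (q b a : ℝ) : Module.End ℂ LatFun :=
  qScale q ^ 2 • (B1 (q ^ 2) b + B2 (q ^ 2) a)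

/-- The parameter of the even (`false`) and odd (`true`) component. -/
def parityParam (q : ℝ) (e : Bool) : ℝ := bif e then q ^ 3 else q

lemma weinsteinOp_lift (hq0 : 0 < q) (hq1 : q < 1) (α : ℝ) (e : Bool) (F : LatFun) :
    weinsteinOp α (lift (q := q) e false F)
      = lift e false (latWeinstein q (parityParam q e) ((q ^ 2) ^ (α + 1)) F) := by
  have hW : (fun s : Rq2 q => ((|(s.2 : ℝ)| ^ (2 * α + 1) : ℝ) : ℂ)
      * partialY (lift (q := q) e false F) s)
      = lift e true (fun k l => (((q ^ l) ^ (2 * α + 1) : ℝ) : ℂ) * stepY q false F k l) := by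
    ext ⟨x, y⟩
    rw [partialY_lift hq0 hq1, abs_eq_zpow_idx hq0]
    simp only [lift, Bool.not_false]
    ring
  have hx : partialX (partialX (lift (q := q) e false F))
      = lift e false ((qScale q ^ 2 • B1 (q ^ 2) (parityParam q e)) F) := by
    rw [partialX_lift hq0 hq1, partialX_lift hq0 hq1, Bool.not_not]
    congr 1
    cases e
    · simp only [stepX, Bool.not_false, cond_true, cond_false, LinearMap.smul_apply, map_smul,
        parityParam, smul_smul, pow_two]
      rfl
    · simp only [stepX, Bool.not_true, cond_true, cond_false, LinearMap.smul_apply, map_smul,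
        parityParam, smul_smul]
      rw [T1_L1 (by positivity), ← pow_two, ← pow_succ']
      rfl
  ext ⟨x, y⟩
  rw [weinsteinOp, hx, hW, partialY_lift hq0 hq1]
  simp only [lift, Bool.not_true, Bool.toNat_false, pow_zero, mul_one, stepY, cond_true,
    cond_false, LinearMap.smul_apply, Pi.smul_apply, smul_eq_mul, L2_apply, latWeinstein,
    LinearMap.add_apply, Pi.add_apply, B2_apply, abs_eq_zpow_idx hq0]
  have hp : 0 < q ^ idx y := zpow_pos hq0 _
  have h1 : ((q ^ idx y) ^ (2 * α + 1) : ℝ) ≠ 0 := (Real.rpow_pos_of_pos hp _).ne'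
  have h2 : ((q ^ (idx y + 1)) ^ (2 * α + 1) : ℝ)
      = (q ^ idx y) ^ (2 * α + 1) * q ^ (2 * α + 1) := by
    rw [zpow_add_one₀ hq0.ne', Real.mul_rpow hp.le hq0.le]
  have h3 : ((q ^ 2) ^ (α + 1) : ℝ) = q * q ^ (2 * α + 1) := by
    rw [← Real.rpow_natCast, ← Real.rpow_mul hq0.le]
    nth_rewrite 2 [← Real.rpow_one q]
    rw [← Real.rpow_add hq0]
    congr 1
    push_cast
    ring
  have h1' : (((q ^ idx y) ^ (2 * α + 1) : ℝ) : ℂ) ≠ 0 := by exact_mod_cast h1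
  rw [h2, h3]
  simp only [Complex.ofReal_mul, Complex.ofReal_div, Complex.ofReal_one]
  field_simp

lemma weinsteinOp_add (α : ℝ) (f g : Rq2 q → ℂ) :
    weinsteinOp α (f + g) = weinsteinOp α f + weinsteinOp α g := by
  ext x
  have h : (fun s : Rq2 q => ((|(s.2 : ℝ)| ^ (2 * α + 1) : ℝ) : ℂ) * partialY (f + g) s)
      = (fun s => ((|(s.2 : ℝ)| ^ (2 * α + 1) : ℝ) : ℂ) * partialY f s)
        + fun s => ((|(s.2 : ℝ)| ^ (2 * α + 1) : ℝ) : ℂ) * partialY g s := by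
    ext s
    simp only [partialY_add, Pi.add_apply]
    ring
  simp only [weinsteinOp, partialX_add, Pi.add_apply]
  rw [h, partialY_add]
  simp only [Pi.add_apply]
  ring

lemma iterate_weinsteinOp_assemble (hq0 : 0 < q) (hq1 : q < 1) (α : ℝ) (n : ℕ) (E O : LatFun) :
    (weinsteinOp α)^[n] (assemble (q := q) E O)
      = assemble ((latWeinstein q q ((q ^ 2) ^ (α + 1)) ^ n) E)
        ((latWeinstein q (q ^ 3) ((q ^ 2) ^ (α + 1)) ^ n) O) := by
  induction n generalizing E O with
  | zero => rfl
  | succ n ih =>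
    rw [Function.iterate_succ_apply, assemble, weinsteinOp_add, weinsteinOp_lift hq0 hq1,
      weinsteinOp_lift hq0 hq1, pow_succ (latWeinstein _ _ _), pow_succ (latWeinstein _ _ _),
      Module.End.mul_apply, Module.End.mul_apply, ← ih]
    rfl

end Dictionary

section Sufficiency

/-! ### Rapidly decreasing components give q-Schwartz functions -/

variable {p q : ℝ}

lemma norm_sub_le_of_T1_le (hp0 : 0 < p) (hp1 : p < 1) {F : LatFun} {C : ℝ}
    (hC : ∀ k l, ‖T1 p F k l‖ ≤ C) (k k' l : ℤ) :
    ‖F k l - F k' l‖ ≤ C * p / (1 - p) * |p ^ k - p ^ k'| := by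
  have hC0 : 0 ≤ C := (norm_nonneg _).trans (hC 0 0)
  have h1p : 0 < 1 - p := sub_pos.2 hp1
  have step : ∀ k, ‖F k l - F (k + 1) l‖ ≤ C * p / (1 - p) * (p ^ k - p ^ (k + 1)) := by
    intro k
    have h := hC (k + 1) l
    rw [T1_apply, norm_mul, Complex.norm_of_nonneg (zpow_pos hp0 _).le, zpow_neg,
      add_sub_cancel_right, inv_mul_le_iff₀ (zpow_pos hp0 _)] at h
    refine h.trans (le_of_eq ?_)
    rw [zpow_add_one₀ hp0.ne']
    field_simp
  have main : ∀ n : ℕ, ∀ k, ‖F k l - F (k + n) l‖ ≤ C * p / (1 - p) * (p ^ k - p ^ (k + n)) := by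
    intro n k
    induction n with
    | zero => simp
    | succ n ih =>
      calc ‖F k l - F (k + (n + 1 : ℕ)) l‖
          = ‖(F k l - F (k + n) l) + (F (k + n) l - F (k + n + 1) l)‖ := by
            push_cast; rw [← add_assoc]; congr 1; ring
        _ ≤ _ := (norm_add_le _ _).trans (add_le_add ih (step _))
        _ = _ := by push_cast; rw [← add_assoc]; ring
  have hle : ∀ k k', k ≤ k' → ‖F k l - F k' l‖ ≤ C * p / (1 - p) * |p ^ k - p ^ k'| := by
    intro k k' h
    obtain ⟨n, rfl⟩ := Int.le.dest h
    exact (main n k).trans (mul_le_mul_of_nonneg_left (le_abs_self _) (by positivity))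
  rcases le_total k k' with h | h
  · exact hle k k' h
  · rw [norm_sub_rev, abs_sub_comm]
    exact hle k' k h

lemma Decay.bounded {F : LatFun} (hF : Decay p F) : ∃ C, ∀ k l, ‖F k l‖ ≤ C := by
  simpa using hF 0 0

/-- A rapidly decreasing lattice function is the restriction of a continuous function. -/
lemma IsRapid.exists_continuous (hp0 : 0 < p) (hp1 : p < 1) {F : LatFun} (hF : IsRapid p F) :
    ∃ g : ℝ × ℝ → ℂ, Continuous g ∧ ∀ k l, F k l = g (p ^ k, p ^ l) := by
  obtain ⟨C, hC⟩ := hF.T1.decay.bounded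
  obtain ⟨C', hC'⟩ := hF.T2.decay.bounded
  have h1 := norm_sub_le_of_T1_le hp0 hp1 hC
  have h2 := norm_sub_le_of_T1_le (F := QWeinstein.swapL F) hp0 hp1 (fun k l => hC' l k)
  have h1p : 0 < 1 - p := sub_pos.2 hp1
  have hC0 : 0 ≤ C := (norm_nonneg _).trans (hC 0 0)
  have hC0' : 0 ≤ C' := (norm_nonneg _).trans (hC' 0 0)
  set e : ℤ × ℤ → ℝ × ℝ := fun k => (p ^ k.1, p ^ k.2) with he
  have hinj : Function.Injective e := fun a b hab => by
    rw [he] at hab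
    simp only [Prod.mk.injEq] at hab
    exact Prod.ext (zpow_right_injective₀ hp0 hp1.ne hab.1)
      (zpow_right_injective₀ hp0 hp1.ne hab.2)
  set g := Function.extend e (Function.uncurry F) 0
  have hg : ∀ k, g (e k) = F k.1 k.2 := fun k => hinj.extend_apply _ _ k
  have hL : LipschitzOnWith (Real.toNNReal (C * p / (1 - p) + C' * p / (1 - p))) g
      (Set.range e) := by
    refine LipschitzOnWith.of_dist_le_mul ?_
    rintro _ ⟨a, rfl⟩ _ ⟨b, rfl⟩
    rw [hg, hg, Real.coe_toNNReal _ (by positivity), dist_eq_norm]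
    have d1 : |p ^ a.1 - p ^ b.1| ≤ dist (e a) (e b) := by
      rw [Prod.dist_eq, ← Real.dist_eq]; exact le_max_left _ _
    have d2 : |p ^ a.2 - p ^ b.2| ≤ dist (e a) (e b) := by
      rw [Prod.dist_eq, ← Real.dist_eq]; exact le_max_right _ _
    calc ‖F a.1 a.2 - F b.1 b.2‖
        = ‖(F a.1 a.2 - F b.1 a.2) + (F b.1 a.2 - F b.1 b.2)‖ := by congr 1; ring
      _ ≤ ‖F a.1 a.2 - F b.1 a.2‖ + ‖F b.1 a.2 - F b.1 b.2‖ := norm_add_le _ _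
      _ ≤ C * p / (1 - p) * dist (e a) (e b) + C' * p / (1 - p) * dist (e a) (e b) := by
        refine add_le_add ((h1 _ _ _).trans ?_) ((h2 a.2 b.2 b.1).trans ?_)
        · exact mul_le_mul_of_nonneg_left d1 (by positivity)
        · exact mul_le_mul_of_nonneg_left d2 (by positivity)
      _ = _ := by ring
  obtain ⟨G, hG, hGe⟩ := hL.extend_finite_dimension
  refine ⟨G, hG.continuous, fun k l => ?_⟩
  rw [← hg (k, l)]
  exact hGe ⟨(k, l), rfl⟩

lemma exists_tendsto_of_continuous {f : Rq2 q → ℂ}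
    (hf : ∃ g : ℝ × ℝ → ℂ, Continuous g ∧ ∀ x, f x = g (toPlane x)) (z : ℝ × ℝ) :
    ∃ l : ℂ, Tendsto f (comap toPlane (𝓝 z)) (𝓝 l) := by
  obtain ⟨g, hg, h⟩ := hf
  exact ⟨g z, (hg.continuousAt.tendsto.comp tendsto_comap).congr fun x => (h x).symm⟩

lemma lift_exists_continuous (hq0 : 0 < q) (hq1 : q < 1) {F : LatFun} (hF : IsRapid (q ^ 2) F)
    (e e' : Bool) :
    ∃ g : ℝ × ℝ → ℂ, Continuous g ∧ ∀ x, lift (q := q) e e' F x = g (toPlane x) := by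
  obtain ⟨g, hg, h⟩ := hF.exists_continuous (by positivity) (pow_lt_one₀ hq0.le hq1 two_ne_zero)
  refine ⟨fun z => ((z.1 : ℝ) : ℂ) ^ e.toNat * ((z.2 : ℝ) : ℂ) ^ e'.toNat * g (z.1 ^ 2, z.2 ^ 2),
    by fun_prop, fun x => ?_⟩
  rw [lift, h, ← sq_eq_zpow_idx hq0, ← sq_eq_zpow_idx hq0]
  rfl

lemma norm_coe_pow_le (hq0 : 0 < q) (x : Rq q) (e : Bool) :
    ‖((x : ℝ) : ℂ) ^ e.toNat‖ ≤ max 1 (((q ^ 2) ^ idx x) ^ 1) := by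
  rw [pow_one, ← sq_eq_zpow_idx hq0, norm_pow, Complex.norm_real, Real.norm_eq_abs, ← sq_abs]
  cases e
  · simp
  · simp only [Bool.toNat_true, pow_one]
    rcases le_total |(x : ℝ)| 1 with h | h
    · exact h.trans (le_max_left _ _)
    · exact (by nlinarith : |(x : ℝ)| ≤ |(x : ℝ)| ^ 2).trans (le_max_right _ _)

lemma lift_bounded (hq0 : 0 < q) {F : LatFun} (hF : Decay (q ^ 2) F) (e e' : Bool) :
    ∃ C, ∀ x, ‖lift (q := q) e e' F x‖ ≤ C := by
  obtain ⟨C, hC0, hC⟩ := hF.max 1 1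
  refine ⟨C, fun x => ?_⟩
  rw [lift, norm_mul, norm_mul]
  refine le_trans ?_ (hC (idx x.1) (idx x.2))
  gcongr
  · exact norm_coe_pow_le hq0 _ _
  · exact norm_coe_pow_le hq0 _ _

lemma IsRapid.stepX (hq0 : 0 < q) {F : LatFun} (hF : IsRapid (q ^ 2) F) (e : Bool) :
    IsRapid (q ^ 2) (stepX q e F) := by
  cases e
  · exact hF.T1.smul _
  · exact (hF.L1 (by positivity) q).smul _

lemma IsRapid.stepY (hq0 : 0 < q) {F : LatFun} (hF : IsRapid (q ^ 2) F) (e : Bool) :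
    IsRapid (q ^ 2) (stepY q e F) := by
  cases e
  · exact hF.T2.smul _
  · exact (hF.L2 (by positivity) q).smul _

lemma altWord_induction {P : LatFun → Prop} {A : Bool → Module.End ℂ LatFun}
    (hA : ∀ e F, P F → P (A e F)) (e : Bool) (n : ℕ) {F : LatFun} (hF : P F) :
    P (altWord A e n F) := by
  induction n generalizing e F with
  | zero => exact hF
  | succ n ih => exact ih _ (hA e F hF)

lemma pow_induction {P : LatFun → Prop} {A : Module.End ℂ LatFun}
    (hA : ∀ F, P F → P (A F)) (n : ℕ) {F : LatFun} (hF : P F) : P ((A ^ n) F) := by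
  induction n generalizing F with
  | zero => exact hF
  | succ n ih => rw [pow_succ, Module.End.mul_apply]; exact ih (hA F hF)

lemma IsRapid.altWord (hq0 : 0 < q) {F : LatFun} (hF : IsRapid (q ^ 2) F) (e e' : Bool)
    (n n' : ℕ) : IsRapid (q ^ 2) (altWord (QWeinstein.stepX q) e n
      (altWord (QWeinstein.stepY q) e' n' F)) :=
  altWord_induction (P := IsRapid (q ^ 2)) (fun e _ h => h.stepX hq0 e) e n
    (altWord_induction (P := IsRapid (q ^ 2)) (fun e _ h => h.stepY hq0 e) e' n' hF)

lemma IsRapid.R (hp0 : 0 < p) {F : LatFun} (hF : IsRapid p F) : IsRapid p (R p F) :=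
  (hF.S1 hp0).add hp0 (hF.S2 hp0)

lemma IsRapid.R_pow (hp0 : 0 < p) {F : LatFun} (hF : IsRapid p F) (n : ℕ) :
    IsRapid p ((QWeinstein.R p ^ n) F) :=
  pow_induction (P := IsRapid p) (fun _ h => h.R hp0) n hF

lemma Dq_assemble (hq0 : 0 < q) (hq1 : q < 1) (β : ℕ × ℕ) (E O : LatFun) :
    Dq β (assemble (q := q) E O) = lift (altParity false β.1) (altParity false β.2)
      (altWord (stepX q) false β.1 (altWord (stepY q) false β.2 E))
      + lift (altParity true β.1) (altParity false β.2)
      (altWord (stepX q) true β.1 (altWord (stepY q) false β.2 O)) := by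
  rw [assemble, Dq_add, Dq_lift hq0 hq1, Dq_lift hq0 hq1]

lemma qSmooth_assemble (hq0 : 0 < q) (hq1 : q < 1) {E O : LatFun} (hE : IsRapid (q ^ 2) E)
    (hO : IsRapid (q ^ 2) O) : QSmooth (assemble (q := q) E O) := by
  intro β z _
  rw [Dq_assemble hq0 hq1]
  obtain ⟨l1, h1⟩ := exists_tendsto_of_continuous (lift_exists_continuous hq0 hq1
    (hE.altWord hq0 false false β.1 β.2) (altParity false β.1) (altParity false β.2)) z
  obtain ⟨l2, h2⟩ := exists_tendsto_of_continuous (lift_exists_continuous hq0 hq1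
    (hO.altWord hq0 true false β.1 β.2) (altParity true β.1) (altParity false β.2)) z
  exact ⟨l1 + l2, h1.add h2⟩

lemma Dq_assemble_bounded (hq0 : 0 < q) (hq1 : q < 1) {E O : LatFun} (hE : IsRapid (q ^ 2) E)
    (hO : IsRapid (q ^ 2) O) (β : ℕ × ℕ) : ∃ C, ∀ x, ‖Dq β (assemble (q := q) E O) x‖ ≤ C := by
  rw [Dq_assemble hq0 hq1]
  obtain ⟨C1, h1⟩ := lift_bounded hq0 (hE.altWord hq0 false false β.1 β.2).decay
    (altParity false β.1) (altParity false β.2)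
  obtain ⟨C2, h2⟩ := lift_bounded hq0 (hO.altWord hq0 true false β.1 β.2).decay
    (altParity true β.1) (altParity false β.2)
  exact ⟨C1 + C2, fun x => (norm_add_le _ _).trans (add_le_add (h1 x) (h2 x))⟩

lemma assemble_mem_schwartzSpace (hq0 : 0 < q) (hq1 : q < 1) {E O : LatFun}
    (hE : IsRapid (q ^ 2) E) (hO : IsRapid (q ^ 2) O) : assemble E O ∈ schwartzSpace q := by
  refine ⟨qSmooth_assemble hq0 hq1 hE hO, evenLast_assemble hq0 hq1 E O, fun n => ?_⟩
  simp_rw [enorm2_pow_mul_assemble hq0]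
  choose C hC using Dq_assemble_bounded hq0 hq1 (hE.R_pow (by positivity) n)
    (hO.R_pow (by positivity) n)
  refine ⟨∑ β ∈ Finset.range (n + 1) ×ˢ Finset.range (n + 1), |C β|, fun x β hβ => ?_⟩
  refine ((hC β x).trans (le_abs_self _)).trans
    (Finset.single_le_sum (f := fun β => |C β|) (fun _ _ => abs_nonneg _) ?_)
  simp only [Finset.mem_product, Finset.mem_range]
  omega

end Sufficiency

section Necessity

variable {q : ℝ}

/-! ### Inverting `u(k) - b u(k+1)` -/

lemma norm_le_of_sub_mul_shift_le {b C : ℝ} (hb0 : 0 < b) (hb1 : b < 1) {u : ℤ → ℂ} {k0 : ℤ}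
    (h : ∀ k, k0 ≤ k → ‖u k - b * u (k + 1)‖ ≤ C)
    (hu : Tendsto (fun k : ℤ => ((b ^ k : ℝ) : ℂ) * u k) atTop (𝓝 0)) {k : ℤ} (hk : k0 ≤ k) :
    ‖u k‖ ≤ C / (1 - b) := by
  have h1b : 0 < 1 - b := sub_pos.2 hb1
  have hC : 0 ≤ C := (norm_nonneg _).trans (h k0 le_rfl)
  have step : ∀ n : ℕ, ‖u k‖ ≤ C / (1 - b) + b ^ n * ‖u (k + n)‖ := by
    have : ∀ n : ℕ, ‖u k‖ ≤ C / (1 - b) * (1 - b ^ n) + b ^ n * ‖u (k + n)‖ := by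
      intro n
      induction n with
      | zero => simp
      | succ n ih =>
        have h1 : ‖u (k + n)‖ ≤ C + b * ‖u (k + n + 1)‖ := by
          have h2 := h (k + n) (by omega)
          calc ‖u (k + n)‖ = ‖(u (k + n) - b * u (k + n + 1)) + b * u (k + n + 1)‖ := by
                congr 1; ring
            _ ≤ C + ‖(b : ℂ) * u (k + n + 1)‖ := (norm_add_le _ _).trans (by gcongr)
            _ = _ := by rw [norm_mul, Complex.norm_of_nonneg hb0.le]
        have h3 : b ^ n * ‖u (k + n)‖ ≤ b ^ n * (C + b * ‖u (k + n + 1)‖) := by gcongr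
        refine ih.trans ((add_le_add_right h3 _).trans (le_of_eq ?_))
        push_cast
        rw [← add_assoc]
        field_simp
        ring
    intro n
    refine (this n).trans (add_le_add_left ?_ _)
    exact mul_le_of_le_one_right (by positivity) (by linarith [pow_pos hb0 n])
  have hlim : Tendsto (fun n : ℕ => C / (1 - b) + b ^ n * ‖u (k + n)‖) atTop
      (𝓝 (C / (1 - b) + 0)) := by
    refine tendsto_const_nhds.add ?_
    have h1 : Tendsto (fun n : ℕ => k + (n : ℤ)) atTop atTop :=
      tendsto_atTop_add_const_left _ _ tendsto_natCast_atTop_atTop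
    have h2 := ((hu.comp h1).norm).const_mul (b ^ (-k))
    simp only [norm_zero, mul_zero] at h2
    refine h2.congr fun n => ?_
    simp only [Function.comp, norm_mul, Complex.norm_of_nonneg (zpow_pos hb0 _).le]
    rw [← mul_assoc, ← zpow_add₀ hb0.ne', neg_add_cancel_left, zpow_natCast]
  rw [add_zero] at hlim
  exact ge_of_tendsto' hlim step

lemma tendsto_zpow_atTop_zero {b : ℝ} (hb0 : 0 < b) (hb1 : b < 1) :
    Tendsto (fun k : ℤ => b ^ k) atTop (𝓝 0) := by
  have h1 : Tendsto (fun k : ℤ => k.toNat) atTop atTop :=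
    tendsto_atTop.2 fun n => (eventually_ge_atTop (n : ℤ)).mono fun k hk => by omega
  refine ((tendsto_pow_atTop_nhds_zero_of_lt_one hb0.le hb1).comp h1).congr' ?_
  filter_upwards [eventually_ge_atTop 0] with k hk
  simp only [Function.comp]
  rw [← zpow_natCast, Int.toNat_of_nonneg hk]

lemma tendsto_zpow_mul_of_bounded {b C : ℝ} (hb0 : 0 < b) (hb1 : b < 1) {u : ℤ → ℂ} {k0 : ℤ}
    (h : ∀ k, k0 ≤ k → ‖u k‖ ≤ C) :
    Tendsto (fun k : ℤ => ((b ^ k : ℝ) : ℂ) * u k) atTop (𝓝 0) := by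
  refine squeeze_zero_norm' (a := fun k : ℤ => b ^ k * C) ?_ ?_
  · filter_upwards [eventually_ge_atTop k0] with k hk
    rw [norm_mul, Complex.norm_of_nonneg (zpow_pos hb0 _).le]
    gcongr
    exact h k hk
  · simpa using (tendsto_zpow_atTop_zero hb0 hb1).mul_const C

/-! ### From alternating derivatives to difference quotients -/

/-- Bounds for the even, and vanishing for the odd, alternating `x`-derivatives along a line. -/
structure AltBound (q : ℝ) (e : Bool) (n : ℕ) (F : LatFun) (k0 l : ℤ) (C : ℝ) : Prop where
  bound : ∀ j ≤ n, altParity e j = false → ∀ k, k0 ≤ k → ‖altWord (stepX q) e j F k l‖ ≤ C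
  vanish : ∀ j ≤ n, altParity e j = true →
    Tendsto (fun k : ℤ => ((q ^ k : ℝ) : ℂ) * altWord (stepX q) e j F k l) atTop (𝓝 0)

lemma AltBound.mono {e : Bool} {n m : ℕ} {F : LatFun} {k0 l : ℤ} {C : ℝ}
    (h : AltBound q e n F k0 l C) (hm : m ≤ n) : AltBound q e m F k0 l C :=
  ⟨fun j hj => h.bound j (hj.trans hm), fun j hj => h.vanish j (hj.trans hm)⟩

lemma AltBound.step {e : Bool} {n : ℕ} {F : LatFun} {k0 l : ℤ} {C : ℝ}
    (h : AltBound q e (n + 1) F k0 l C) : AltBound q (!e) n (stepX q e F) k0 l C :=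
  ⟨fun j hj hp => h.bound (j + 1) (by omega) hp, fun j hj hp => h.vanish (j + 1) (by omega) hp⟩

lemma norm_qScale (hq1 : q < 1) : ‖qScale q‖ = (1 - q)⁻¹ := by
  rw [qScale, Complex.norm_of_nonneg (inv_nonneg.2 (sub_pos.2 hq1).le)]

lemma norm_le_of_norm_qScale_mul_le (hq0 : 0 < q) (hq1 : q < 1) {z : ℂ} {C : ℝ}
    (h : ‖qScale q * z‖ ≤ C) : ‖z‖ ≤ C := by
  refine le_trans ?_ h
  rw [norm_mul, norm_qScale hq1]
  exact le_mul_of_one_le_left (norm_nonneg _) ((one_le_inv₀ (sub_pos.2 hq1)).2 (by linarith))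

lemma exists_T1_pow_bound (hq0 : 0 < q) (hq1 : q < 1) (i : ℕ) :
    (∃ A : ℝ, 0 < A ∧ ∀ F k0 l C, AltBound q false (2 * i) F k0 l C →
      ∀ k, k0 ≤ k → ‖(T1 (q ^ 2) ^ i) F k l‖ ≤ A * C) ∧
    (∃ A : ℝ, 0 < A ∧ ∀ F k0 l C, AltBound q true (2 * i + 1) F k0 l C →
      ∀ k, k0 ≤ k → ‖(T1 (q ^ 2) ^ i) F k l‖ ≤ A * C) := by
  have hp0 : 0 < q ^ 2 := by positivity
  have hp1 : q ^ 2 < 1 := pow_lt_one₀ hq0.le hq1 two_ne_zero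
  have odd_of_even : ∀ i, (∃ A : ℝ, 0 < A ∧ ∀ F k0 l C, AltBound q false (2 * i) F k0 l C →
      ∀ k, k0 ≤ k → ‖(T1 (q ^ 2) ^ i) F k l‖ ≤ A * C) →
      (∀ F k0 l C, AltBound q true (2 * i + 1) F k0 l C →
        Tendsto (fun k : ℤ => (((q * (q ^ 2) ^ i) ^ k : ℝ) : ℂ) * (T1 (q ^ 2) ^ i) F k l)
          atTop (𝓝 0)) →
      (∃ A : ℝ, 0 < A ∧ ∀ F k0 l C, AltBound q true (2 * i + 1) F k0 l C →
      ∀ k, k0 ≤ k → ‖(T1 (q ^ 2) ^ i) F k l‖ ≤ A * C) := by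
    rintro i ⟨A, hA, h⟩ hlim
    have hb1 : q * (q ^ 2) ^ i < 1 := mul_pow_lt_one hp0 hp1 hq0.le hq1 i
    refine ⟨A / (1 - q * (q ^ 2) ^ i), div_pos hA (sub_pos.2 hb1), fun F k0 l C hF k hk => ?_⟩
    rw [div_mul_eq_mul_div]
    refine norm_le_of_sub_mul_shift_le (u := fun k => (T1 (q ^ 2) ^ i) F k l) (by positivity) hb1
      (fun k hk => ?_) (hlim F k0 l C hF) hk
    have h1 := h _ k0 l C hF.step k hk
    simp only [stepX, cond_true, LinearMap.smul_apply, map_smul, Pi.smul_apply, smul_eq_mul,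
      T1_pow_L1 hp0, L1_apply] at h1
    exact norm_le_of_norm_qScale_mul_le hq0 hq1 h1
  induction i with
  | zero =>
    have h0 : ∃ A : ℝ, 0 < A ∧ ∀ F k0 l C, AltBound q false (2 * 0) F k0 l C →
        ∀ k, k0 ≤ k → ‖(T1 (q ^ 2) ^ 0) F k l‖ ≤ A * C :=
      ⟨1, one_pos, fun F k0 l C hF k hk => by simpa [altWord] using hF.bound 0 le_rfl rfl k hk⟩
    refine ⟨h0, odd_of_even 0 h0 fun F k0 l C hF => ?_⟩
    simpa [altWord] using hF.vanish 0 (by omega) rfl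
  | succ i ih =>
    obtain ⟨_, A, hA, h⟩ := ih
    have h0 : ∃ A : ℝ, 0 < A ∧ ∀ F k0 l C, AltBound q false (2 * (i + 1)) F k0 l C →
        ∀ k, k0 ≤ k → ‖(T1 (q ^ 2) ^ (i + 1)) F k l‖ ≤ A * C := by
      refine ⟨A, hA, fun F k0 l C hF k hk => ?_⟩
      have h1 := h _ k0 l C (hF.step (n := 2 * i + 1)) k hk
      simp only [stepX, cond_false, LinearMap.smul_apply, map_smul, Pi.smul_apply,
        smul_eq_mul] at h1
      rw [pow_succ, Module.End.mul_apply]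
      exact norm_le_of_norm_qScale_mul_le hq0 hq1 h1
    refine ⟨h0, odd_of_even (i + 1) h0 fun F k0 l C hF => ?_⟩
    have hbd := h F k0 l C (hF.mono (by omega))
    have hb1 : q * (q ^ 2) ^ i < 1 := mul_pow_lt_one hp0 hp1 hq0.le hq1 i
    have := tendsto_zpow_mul_of_bounded (b := q * (q ^ 2) ^ i) (k0 := k0 + 1) (C := A * C + A * C)
      (by positivity) hb1
      (u := fun k => (T1 (q ^ 2) ^ i) F (k - 1) l - (T1 (q ^ 2) ^ i) F k l) fun k hk =>
        (norm_sub_le _ _).trans (add_le_add (hbd _ (by omega)) (hbd _ (by omega)))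
    refine this.congr fun k => ?_
    rw [pow_succ' (T1 _), Module.End.mul_apply, T1_apply, ← mul_assoc, ← Complex.ofReal_mul]
    congr 2
    rw [pow_succ (q ^ 2) i, ← mul_assoc, mul_zpow _ (q ^ 2), zpow_neg]
    have : (q ^ 2) ^ k ≠ 0 := (zpow_pos hp0 k).ne'
    field_simp

/-! ### Local boundedness near an axis -/

/-- All difference quotients in `s` are bounded near `s = 0`, for each fixed `t`. -/
def LocBdd (p : ℝ) (F : LatFun) : Prop :=
  ∀ (i : ℕ) (l : ℤ), ∃ (C : ℝ) (k0 : ℤ), ∀ k, k0 ≤ k → ‖(T1 p ^ i) F k l‖ ≤ C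

variable {p : ℝ} {F G : LatFun}

lemma LocBdd.add (hF : LocBdd p F) (hG : LocBdd p G) : LocBdd p (F + G) := by
  intro i l
  obtain ⟨C, k0, h⟩ := hF i l
  obtain ⟨C', k0', h'⟩ := hG i l
  refine ⟨C + C', max k0 k0', fun k hk => ?_⟩
  rw [map_add]
  exact (norm_add_le _ _).trans (add_le_add (h k (by omega)) (h' k (by omega)))

lemma LocBdd.smul (hF : LocBdd p F) (c : ℂ) : LocBdd p (c • F) := by
  intro i l
  obtain ⟨C, k0, h⟩ := hF i l
  refine ⟨‖c‖ * C, k0, fun k hk => ?_⟩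
  rw [map_smul, Pi.smul_apply, Pi.smul_apply, norm_smul]
  gcongr
  exact h k hk

lemma LocBdd.T1 (hF : LocBdd p F) : LocBdd p (T1 p F) := by
  intro i l
  rw [← Module.End.mul_apply, ← pow_succ]
  exact hF (i + 1) l

lemma LocBdd.S1 (hp0 : 0 < p) (hp1 : p < 1) (hF : LocBdd p F) : LocBdd p (S1 p F) := by
  intro i l
  obtain ⟨C, k0, h⟩ := hF i l
  obtain ⟨C', k0', h'⟩ := hF (i - 1) l
  refine ⟨p⁻¹ ^ i * C + |p⁻¹ ^ i - 1| * C', max 0 (max k0 k0'), fun k hk => ?_⟩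
  rw [T1_pow_S1 hp0]
  simp only [Pi.add_apply, Pi.smul_apply, smul_eq_mul, S1_apply]
  refine (norm_add_le _ _).trans (add_le_add ?_ ?_)
  · rw [norm_mul, norm_mul, Complex.norm_of_nonneg (by positivity),
      Complex.norm_of_nonneg (zpow_pos hp0 _).le]
    have h1 := h k (by omega)
    have h2 : p ^ k ≤ 1 := by
      simpa using (zpow_le_zpow_iff_right_of_lt_one₀ hp0 hp1).2 (show 0 ≤ k by omega)
    have h3 : p ^ k * ‖(QWeinstein.T1 p ^ i) F k l‖ ≤ C :=
      (mul_le_of_le_one_left (norm_nonneg _) h2).trans h1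
    gcongr
  · rw [norm_mul, Complex.norm_real, Real.norm_eq_abs]
    gcongr
    exact h' k (by omega)

lemma LocBdd.D1 (hp0 : 0 < p) (hF : LocBdd p F) : LocBdd p (D1 F) := by
  intro i l
  obtain ⟨C, k0, h⟩ := hF i l
  refine ⟨p ^ i * C, k0, fun k hk => ?_⟩
  rw [T1_pow_D1 hp0, Pi.smul_apply, Pi.smul_apply, norm_smul, Complex.norm_of_nonneg (by positivity),
    D1_apply]
  gcongr
  exact h (k + 1) (by omega)

lemma LocBdd.S2 (hF : LocBdd p F) : LocBdd p (S2 p F) := by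
  intro i l
  obtain ⟨C, k0, h⟩ := hF i l
  refine ⟨‖((p ^ l : ℝ) : ℂ)‖ * C, k0, fun k hk => ?_⟩
  rw [← S2_T1_pow, S2_apply, norm_mul]
  gcongr
  exact h k hk

lemma LocBdd.D2 (hF : LocBdd p F) : LocBdd p (D2 F) := by
  intro i l
  obtain ⟨C, k0, h⟩ := hF i (l + 1)
  refine ⟨C, k0, fun k hk => ?_⟩
  have : (QWeinstein.T1 p ^ i) (QWeinstein.D2 F) = QWeinstein.D2 ((QWeinstein.T1 p ^ i) F) :=
    (LinearMap.congr_fun (commute_D2_T1.pow_right i).eq F).symm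
  rw [this]
  exact h k hk

lemma LocBdd.T2 (hF : LocBdd p F) : LocBdd p (T2 p F) := by
  intro i l
  obtain ⟨C, k0, h⟩ := hF i l
  obtain ⟨C', k0', h'⟩ := hF i (l - 1)
  refine ⟨‖((p ^ (-l) : ℝ) : ℂ)‖ * (C' + C), max k0 k0', fun k hk => ?_⟩
  have := T1_pow_T2_pow (p := p) i 1 F
  rw [pow_one] at this
  rw [this, T2_apply, norm_mul]
  gcongr
  exact (norm_sub_le _ _).trans (add_le_add (h' k (by omega)) (h k (by omega)))

lemma LocBdd.sub (hF : LocBdd p F) (hG : LocBdd p G) : LocBdd p (F - G) := by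
  rw [show F - G = F + (-1 : ℂ) • G by simp [sub_eq_add_neg]]
  exact hF.add (hG.smul _)

lemma LocBdd.stepX (hq0 : 0 < q) (hF : LocBdd (q ^ 2) F) (e : Bool) :
    LocBdd (q ^ 2) (stepX q e F) := by
  cases e
  · exact hF.T1.smul _
  · exact (hF.sub ((hF.D1 (by positivity)).smul _)).smul _

lemma LocBdd.stepY (hF : LocBdd (q ^ 2) F) (e : Bool) : LocBdd (q ^ 2) (stepY q e F) := by
  cases e
  · exact hF.T2.smul _
  · exact (hF.sub (hF.D2.smul _)).smul _

lemma LocBdd.altWord (hq0 : 0 < q) (hF : LocBdd (q ^ 2) F) (e e' : Bool) (n n' : ℕ) :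
    LocBdd (q ^ 2) (altWord (QWeinstein.stepX q) e n (altWord (QWeinstein.stepY q) e' n' F)) :=
  altWord_induction (P := LocBdd (q ^ 2)) (fun e _ h => h.stepX hq0 e) e n
    (altWord_induction (P := LocBdd (q ^ 2)) (fun e _ h => h.stepY e) e' n' hF)

lemma LocBdd.R_pow (hp0 : 0 < p) (hp1 : p < 1) (hF : LocBdd p F) (n : ℕ) :
    LocBdd p ((R p ^ n) F) :=
  pow_induction (P := LocBdd p) (fun _ h => (h.S1 hp0 hp1).add h.S2) n hF

lemma LocBdd.tendsto (hq0 : 0 < q) (hq1 : q < 1) (hF : LocBdd p F) (l : ℤ) :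
    Tendsto (fun k : ℤ => ((q ^ k : ℝ) : ℂ) * F k l) atTop (𝓝 0) := by
  obtain ⟨C, k0, h⟩ := hF 0 l
  exact tendsto_zpow_mul_of_bounded hq0 hq1 h

/-! ### Two variables -/

lemma altWord_stepX_swapL (e : Bool) (n : ℕ) (F : LatFun) :
    altWord (stepX q) e n (swapL F) = swapL (altWord (stepY q) e n F) := by
  induction n generalizing e F with
  | zero => rfl
  | succ n ih =>
    have : stepX q e (swapL F) = swapL (stepY q e F) := by cases e <;> rfl
    simp only [altWord, Module.End.mul_apply, this, ih]

lemma commute_T1_altWord_stepY (e : Bool) (n : ℕ) :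
    Commute (T1 (q ^ 2)) (altWord (stepY q) e n) := by
  induction n generalizing e with
  | zero => exact Commute.one_right _
  | succ n ih =>
    refine (ih _).mul_right ?_
    cases e
    · exact (commute_T1_T2).smul_right _
    · exact ((Commute.one_right _).sub_right
        ((commute_D2_T1 (p := q ^ 2)).symm.smul_right _)).smul_right _

lemma T1_pow_altWord_stepY (e : Bool) (n i : ℕ) (F : LatFun) :
    (T1 (q ^ 2) ^ i) (altWord (stepY q) e n F) = altWord (stepY q) e n ((T1 (q ^ 2) ^ i) F) :=
  LinearMap.congr_fun ((commute_T1_altWord_stepY e n).pow_left i).eq F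

/-- Bounds for alternating derivatives in both variables give bounds for difference quotients. -/
lemma exists_T1_pow_T2_pow_bound (hq0 : 0 < q) (hq1 : q < 1) (e : Bool) (i j : ℕ) :
    ∃ A : ℝ, 0 < A ∧ ∀ F k0 l0 C,
      (∀ n m, altParity e n = true →
        ∀ l, Tendsto (fun k : ℤ => ((q ^ k : ℝ) : ℂ) *
          altWord (stepX q) e n (altWord (stepY q) false m F) k l) atTop (𝓝 0)) →
      (∀ m, altParity false m = true → ∀ k,
        Tendsto (fun l : ℤ => ((q ^ l : ℝ) : ℂ) * altWord (stepY q) false m F k l) atTop (𝓝 0)) →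
      (∀ n m, n ≤ 2 * i + 1 → m ≤ 2 * j → altParity e n = false → altParity false m = false →
        ∀ k l, k0 ≤ k → l0 ≤ l →
          ‖altWord (stepX q) e n (altWord (stepY q) false m F) k l‖ ≤ C) →
      ∀ k l, k0 ≤ k → l0 ≤ l → ‖(T1 (q ^ 2) ^ i) ((T2 (q ^ 2) ^ j) F) k l‖ ≤ A * C := by
  obtain ⟨A1, hA1, h1⟩ : ∃ A : ℝ, 0 < A ∧ ∀ F k0 l C, AltBound q e (2 * i + 1) F k0 l C →
      ∀ k, k0 ≤ k → ‖(T1 (q ^ 2) ^ i) F k l‖ ≤ A * C := by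
    obtain ⟨⟨A, hA, h⟩, h'⟩ := exists_T1_pow_bound hq0 hq1 i
    cases e
    · exact ⟨A, hA, fun F k0 l C hF => h F k0 l C (hF.mono (by omega))⟩
    · exact h'
  obtain ⟨⟨A2, hA2, h2⟩, _⟩ := exists_T1_pow_bound hq0 hq1 j
  refine ⟨A2 * A1, by positivity, fun F k0 l0 C hX hY hB k l hk hl => ?_⟩
  have hY' : ∀ i m, altParity false m = true → ∀ k,
      Tendsto (fun l : ℤ => ((q ^ l : ℝ) : ℂ) *
        (T1 (q ^ 2) ^ i) (altWord (stepY q) false m F) k l) atTop (𝓝 0) := by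
    intro i m hm
    induction i with
    | zero => exact hY m hm
    | succ i ih =>
      intro k
      have := ((ih (k - 1)).sub (ih k)).const_mul ((((q ^ 2) ^ (-k) : ℝ)) : ℂ)
      rw [sub_zero, mul_zero] at this
      refine this.congr fun l => ?_
      rw [pow_succ' (T1 _), Module.End.mul_apply, T1_apply]
      ring
  have key := h2 (swapL ((T1 (q ^ 2) ^ i) F)) l0 k (A1 * C) ⟨?_, ?_⟩ l hl
  · rw [T1_pow_swapL, swapL_apply, ← T1_pow_T2_pow, ← mul_assoc] at key
    exact key
  · intro m hm hpar l hl
    rw [altWord_stepX_swapL, swapL_apply, ← T1_pow_altWord_stepY]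
    exact h1 _ k0 l C ⟨fun n hn hpn k hk => hB n m hn hm hpn hpar k l hk hl,
      fun n _ hpn => hX n m hpn l⟩ k hk
  · intro m hm hpar
    simp_rw [altWord_stepX_swapL, swapL_apply, ← T1_pow_altWord_stepY]
    exact hY' i m hpar k

end Necessity

section Components

variable {q : ℝ}

/-! ### The components of a q-smooth function -/

/-- The reflection in the first variable. -/
def reflX (x : Rq2 q) : Rq2 q := (negRq x.1, x.2)

lemma altParity_not (e : Bool) (n : ℕ) : altParity (!e) n = !altParity e n := by
  induction n generalizing e with
  | zero => rfl
  | succ n ih => exact ih _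

lemma lift_reflX (hq0 : 0 < q) (hq1 : q < 1) (e e' : Bool) (F : LatFun) (x : Rq2 q) :
    lift e e' F (reflX x) = (bif e then -1 else 1) * lift e e' F x := by
  simp only [lift, reflX, idx_negRq hq0 hq1]
  cases e <;> simp [negRq]

lemma lift_reflY (hq0 : 0 < q) (hq1 : q < 1) (e e' : Bool) (F : LatFun) (x y : Rq q) :
    lift e e' F (x, negRq y) = (bif e' then -1 else 1) * lift e e' F (x, y) := by
  simp only [lift, idx_negRq hq0 hq1]
  cases e' <;> simp [negRq]

lemma Dq_component (hq0 : 0 < q) (hq1 : q < 1) (e : Bool) (E O : LatFun) (β : ℕ × ℕ) (x : Rq2 q) :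
    Dq β (lift e false (bif e then O else E)) x = (Dq β (assemble E O) x
      + (bif altParity e β.1 then -1 else 1) * Dq β (assemble E O) (reflX x)) / 2 := by
  have h := altParity_not false β.1
  rw [Bool.not_false] at h
  rw [Dq_assemble hq0 hq1, Pi.add_apply, Pi.add_apply, lift_reflX hq0 hq1, lift_reflX hq0 hq1,
    Dq_lift hq0 hq1, h]
  cases e <;> cases h' : altParity false β.1 <;> simp [h, h'] <;> ring

lemma tendsto_reflX (z : ℝ × ℝ) :
    Tendsto (reflX (q := q)) (comap toPlane (𝓝 z)) (comap toPlane (𝓝 (-z.1, z.2))) := by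
  rw [tendsto_comap_iff]
  have : Continuous fun w : ℝ × ℝ => (-w.1, w.2) := by fun_prop
  exact (this.tendsto z).comp tendsto_comap

lemma QSmooth.component (hq0 : 0 < q) (hq1 : q < 1) {E O : LatFun}
    (h : QSmooth (assemble (q := q) E O)) (e : Bool) :
    QSmooth (lift (q := q) e false (bif e then O else E)) := by
  intro β z hz
  obtain ⟨l1, h1⟩ := h β z hz
  obtain ⟨l2, h2⟩ := h β (-z.1, z.2) (by simpa using hz)
  refine ⟨(l1 + (bif altParity e β.1 then -1 else 1) * l2) / 2, ?_⟩
  refine ((h1.add ((h2.comp (tendsto_reflX z)).const_mul _)).div_const 2).congr fun x => ?_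
  rw [Dq_component hq0 hq1]
  rfl

lemma Dq_component_bounded (hq0 : 0 < q) (hq1 : q < 1) {E O : LatFun} {β : ℕ × ℕ} {C : ℝ}
    (h : ∀ x, ‖Dq β (assemble (q := q) E O) x‖ ≤ C) (e : Bool) (x : Rq2 q) :
    ‖Dq β (lift e false (bif e then O else E)) x‖ ≤ C := by
  rw [Dq_component hq0 hq1, norm_div, Complex.norm_ofNat, div_le_iff₀ two_pos]
  refine (norm_add_le _ _).trans ?_
  rw [norm_mul, show ‖(bif altParity e β.1 then -1 else 1 : ℂ)‖ = 1 by
    cases altParity e β.1 <;> simp, one_mul]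
  linarith [h x, h (reflX x)]

lemma tendsto_toPlane_iff {ι : Type*} {f : Filter ι} {u : ι → Rq2 q} {z : ℝ × ℝ}
    (h1 : Tendsto (fun i => ((u i).1 : ℝ)) f (𝓝 z.1))
    (h2 : Tendsto (fun i => ((u i).2 : ℝ)) f (𝓝 z.2)) :
    Tendsto u f (comap toPlane (𝓝 z)) := by
  rw [tendsto_comap_iff]
  exact h1.prodMk_nhds h2

variable {e : Bool} {F : LatFun}

/-- The lattice function behind `D^β` of a single component. -/
def altDeriv (q : ℝ) (e : Bool) (n m : ℕ) (F : LatFun) : LatFun :=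
  altWord (stepX q) e n (altWord (stepY q) false m F)

lemma lift_pos_pos (hq0 : 0 < q) (hq1 : q < 1) (e e' : Bool) (F : LatFun) (k l : ℤ) :
    lift e e' F (pos q k, pos q l)
      = ((q ^ k : ℝ) : ℂ) ^ e.toNat * ((q ^ l : ℝ) : ℂ) ^ e'.toNat * F k l := by
  simp [lift, idx_pos hq0 hq1]

lemma QSmooth.vanish_left (hq0 : 0 < q) (hq1 : q < 1) (h : QSmooth (lift (q := q) e false F))
    {n : ℕ} (m : ℕ) (hn : altParity e n = true) (l : ℤ) :
    Tendsto (fun k : ℤ => ((q ^ k : ℝ) : ℂ) * altDeriv q e n m F k l) atTop (𝓝 0) := by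
  obtain ⟨L, hL⟩ := h (n, m) (0, q ^ l) (Or.inl rfl)
  rw [Dq_lift hq0 hq1, hn] at hL
  have h0 := tendsto_zpow_atTop_zero hq0 hq1
  have h1 := hL.comp (tendsto_toPlane_iff (u := fun k : ℤ => (pos q k, pos q l)) h0
    tendsto_const_nhds)
  have h2 := hL.comp (tendsto_toPlane_iff (u := fun k : ℤ => (neg q k, pos q l))
    (by simpa using h0.neg) tendsto_const_nhds)
  have h3 := h1.sub h2
  rw [sub_self] at h3
  have hne : (2 * ((q ^ l : ℝ) : ℂ) ^ (altParity false m).toNat) ≠ 0 :=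
    mul_ne_zero two_ne_zero (pow_ne_zero _ (by exact_mod_cast (zpow_pos hq0 l).ne'))
  have h4 := h3.const_mul (2 * ((q ^ l : ℝ) : ℂ) ^ (altParity false m).toNat)⁻¹
  rw [mul_zero] at h4
  refine h4.congr fun k => ?_
  have h5 := lift_reflX hq0 hq1 true (altParity false m) (altDeriv q e n m F) (pos q k, pos q l)
  simp only [reflX, negRq_pos] at h5
  have h6 := lift_pos_pos hq0 hq1 true (altParity false m) (altDeriv q e n m F) k l
  simp only [altDeriv] at h5 h6 ⊢
  simp only [Function.comp, h5, h6]
  rw [inv_mul_eq_iff_eq_mul₀ hne]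
  simp
  ring

lemma QSmooth.vanish_right (hq0 : 0 < q) (hq1 : q < 1) (h : QSmooth (lift (q := q) e false F))
    {m : ℕ} (hm : altParity false m = true) (k : ℤ) :
    Tendsto (fun l : ℤ => ((q ^ l : ℝ) : ℂ) * altDeriv q e 0 m F k l) atTop (𝓝 0) := by
  obtain ⟨L, hL⟩ := h (0, m) (q ^ k, 0) (Or.inr rfl)
  rw [Dq_lift hq0 hq1, hm] at hL
  have h0 := tendsto_zpow_atTop_zero hq0 hq1
  have h1 := hL.comp (tendsto_toPlane_iff (u := fun l : ℤ => (pos q k, pos q l))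
    tendsto_const_nhds h0)
  have h2 := hL.comp (tendsto_toPlane_iff (u := fun l : ℤ => (pos q k, neg q l))
    tendsto_const_nhds (by simpa using h0.neg))
  have h3 := h1.sub h2
  rw [sub_self] at h3
  have hne : (2 * ((q ^ k : ℝ) : ℂ) ^ (altParity e 0).toNat) ≠ 0 :=
    mul_ne_zero two_ne_zero (pow_ne_zero _ (by exact_mod_cast (zpow_pos hq0 k).ne'))
  have h4 := h3.const_mul (2 * ((q ^ k : ℝ) : ℂ) ^ (altParity e 0).toNat)⁻¹
  rw [mul_zero] at h4
  refine h4.congr fun l => ?_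
  have h5 := lift_reflY hq0 hq1 (altParity e 0) true (altDeriv q e 0 m F) (pos q k) (pos q l)
  simp only [negRq_pos] at h5
  have h6 := lift_pos_pos hq0 hq1 (altParity e 0) true (altDeriv q e 0 m F) k l
  simp only [altDeriv] at h5 h6 ⊢
  simp only [Function.comp, h5, h6]
  rw [inv_mul_eq_iff_eq_mul₀ hne]
  simp
  ring

lemma eventually_norm_le_of_tendsto {ι : Type*} {f : Filter ι} {u : ι → ℂ} {L : ℂ}
    (h : Tendsto u f (𝓝 L)) : ∀ᶠ i in f, ‖u i‖ ≤ ‖L‖ + 1 :=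
  (h.norm.eventually_lt_const (lt_add_one _)).mono fun _ => le_of_lt

lemma QSmooth.bounded_origin (hq0 : 0 < q) (hq1 : q < 1) (h : QSmooth (lift (q := q) e false F))
    {n m : ℕ} (hn : altParity e n = false) (hm : altParity false m = false) :
    ∃ (C : ℝ) (k0 : ℤ), ∀ k l, k0 ≤ k → k0 ≤ l → ‖altDeriv q e n m F k l‖ ≤ C := by
  obtain ⟨L, hL⟩ := h (n, m) (0, 0) (Or.inl rfl)
  rw [Dq_lift hq0 hq1, hn, hm] at hL
  have h0 := tendsto_zpow_atTop_zero hq0 hq1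
  have h1 := hL.comp (tendsto_toPlane_iff (f := (atTop : Filter ℤ) ×ˢ (atTop : Filter ℤ))
    (u := fun k : ℤ × ℤ => (pos q k.1, pos q k.2))
    (h0.comp tendsto_fst) (h0.comp tendsto_snd))
  have h2 := eventually_norm_le_of_tendsto h1
  rw [prod_atTop_atTop_eq, eventually_atTop] at h2
  obtain ⟨⟨a, b⟩, hab⟩ := h2
  refine ⟨‖L‖ + 1, max a b, fun k l hk hl => ?_⟩
  have h3 := hab (k, l) ⟨(le_max_left _ _).trans hk, (le_max_right _ _).trans hl⟩
  simpa [lift_pos_pos hq0 hq1, altDeriv] using h3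

lemma QSmooth.bounded_left (hq0 : 0 < q) (hq1 : q < 1) (h : QSmooth (lift (q := q) e false F))
    {n : ℕ} (hn : altParity e n = false) (l : ℤ) :
    ∃ (C : ℝ) (k0 : ℤ), ∀ k, k0 ≤ k → ‖altWord (stepX q) e n F k l‖ ≤ C := by
  obtain ⟨L, hL⟩ := h (n, 0) (0, q ^ l) (Or.inl rfl)
  rw [Dq_lift hq0 hq1, hn] at hL
  have h1 := hL.comp (tendsto_toPlane_iff (u := fun k : ℤ => (pos q k, pos q l))
    (tendsto_zpow_atTop_zero hq0 hq1) tendsto_const_nhds)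
  have h2 := eventually_norm_le_of_tendsto h1
  rw [eventually_atTop] at h2
  obtain ⟨a, ha⟩ := h2
  refine ⟨‖L‖ + 1, a, fun k hk => ?_⟩
  simpa [lift_pos_pos hq0 hq1, altParity, altWord] using ha k hk

lemma QSmooth.bounded_right (hq0 : 0 < q) (hq1 : q < 1) (h : QSmooth (lift (q := q) e false F))
    {m : ℕ} (hm : altParity false m = false) (k : ℤ) :
    ∃ (C : ℝ) (l0 : ℤ), ∀ l, l0 ≤ l → ‖altWord (stepY q) false m F k l‖ ≤ C := by
  obtain ⟨L, hL⟩ := h (0, m) (q ^ k, 0) (Or.inr rfl)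
  rw [Dq_lift hq0 hq1, hm] at hL
  have h1 := hL.comp (tendsto_toPlane_iff (u := fun l : ℤ => (pos q k, pos q l))
    tendsto_const_nhds (tendsto_zpow_atTop_zero hq0 hq1))
  have h2 := eventually_norm_le_of_tendsto (h1.const_mul (((q ^ k : ℝ) : ℂ) ^ e.toNat)⁻¹)
  rw [eventually_atTop] at h2
  obtain ⟨a, ha⟩ := h2
  refine ⟨_, a, fun l hl => le_trans (le_of_eq ?_) (ha l hl)⟩
  have hne : ((q ^ k : ℝ) : ℂ) ^ e.toNat ≠ 0 :=
    pow_ne_zero _ (by exact_mod_cast (zpow_pos hq0 k).ne')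
  simp only [Function.comp, lift_pos_pos hq0 hq1, altParity, altWord, Bool.toNat_false, pow_zero,
    mul_one, Module.End.one_apply]
  rw [inv_mul_cancel_left₀ hne]

/-- Finitely many local bounds can be made uniform. -/
lemma exists_uniform_bound {ι : Type*} (s : Finset ι) {Q : ι → ℤ → ℝ → Prop}
    (hQ : ∀ i k k' C C', k ≤ k' → C ≤ C' → Q i k C → Q i k' C')
    (h : ∀ i ∈ s, ∃ (C : ℝ) (k0 : ℤ), Q i k0 C) : ∃ (C : ℝ) (k0 : ℤ), ∀ i ∈ s, Q i k0 C := by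
  classical
  induction s using Finset.induction_on with
  | empty => exact ⟨0, 0, by simp⟩
  | insert a s _ ih =>
    obtain ⟨C, k0, h1⟩ := ih fun i hi => h i (Finset.mem_insert_of_mem hi)
    obtain ⟨C', k0', h2⟩ := h a (Finset.mem_insert_self _ _)
    refine ⟨max C C', max k0 k0', fun i hi => ?_⟩
    rcases Finset.mem_insert.1 hi with rfl | hi
    · exact hQ _ _ _ _ _ (le_max_right _ _) (le_max_right _ _) h2
    · exact hQ _ _ _ _ _ (le_max_left _ _) (le_max_left _ _) (h1 i hi)

lemma locBdd_of_bounded (hq0 : 0 < q) (hq1 : q < 1)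
    (hv : ∀ n, altParity e n = true → ∀ l,
      Tendsto (fun k : ℤ => ((q ^ k : ℝ) : ℂ) * altWord (stepX q) e n F k l) atTop (𝓝 0))
    (hb : ∀ n, altParity e n = false → ∀ l,
      ∃ (C : ℝ) (k0 : ℤ), ∀ k, k0 ≤ k → ‖altWord (stepX q) e n F k l‖ ≤ C) :
    LocBdd (q ^ 2) F := by
  intro i l
  obtain ⟨C, k0, h⟩ := exists_uniform_bound (Finset.range (2 * i + 2))
    (Q := fun n k0 C => altParity e n = false → ∀ k, k0 ≤ k → ‖altWord (stepX q) e n F k l‖ ≤ C)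
    (fun n k k' C C' hk hC h hp j hj => (h hp j (hk.trans hj)).trans hC) fun n _ => by
      by_cases hp : altParity e n = false
      · obtain ⟨C, k0, h⟩ := hb n hp l
        exact ⟨C, k0, fun _ => h⟩
      · exact ⟨0, 0, fun h => absurd h hp⟩
  have hA : AltBound q e (2 * i + 1) F k0 l C :=
    ⟨fun j hj hp => h j (Finset.mem_range.2 (by omega)) hp, fun j _ hp => hv j hp l⟩
  obtain ⟨⟨A, _, h1⟩, A', _, h2⟩ := exists_T1_pow_bound hq0 hq1 i
  cases e
  · exact ⟨A * C, k0, h1 F k0 l C (hA.mono (by omega))⟩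
  · exact ⟨A' * C, k0, h2 F k0 l C hA⟩

lemma QSmooth.locBdd (hq0 : 0 < q) (hq1 : q < 1) (h : QSmooth (lift (q := q) e false F)) :
    LocBdd (q ^ 2) F :=
  locBdd_of_bounded hq0 hq1 (fun _ hn l => h.vanish_left hq0 hq1 0 hn l)
    fun _ hn l => h.bounded_left hq0 hq1 hn l

lemma QSmooth.locBdd_swapL (hq0 : 0 < q) (hq1 : q < 1) (h : QSmooth (lift (q := q) e false F)) :
    LocBdd (q ^ 2) (swapL F) := by
  refine locBdd_of_bounded (e := false) hq0 hq1 (fun _ hn l => ?_) fun _ hn l => ?_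
  · simp_rw [altWord_stepX_swapL]
    exact h.vanish_right hq0 hq1 hn l
  · simp_rw [altWord_stepX_swapL]
    exact h.bounded_right hq0 hq1 hn l

lemma QSmooth.bounded_near_origin (hq0 : 0 < q) (hq1 : q < 1)
    (h : QSmooth (lift (q := q) e false F)) (i j : ℕ) :
    ∃ (C : ℝ) (k0 : ℤ), ∀ k l, k0 ≤ k → k0 ≤ l →
      ‖(T1 (q ^ 2) ^ i) ((T2 (q ^ 2) ^ j) F) k l‖ ≤ C := by
  obtain ⟨A, _, hA⟩ := exists_T1_pow_T2_pow_bound hq0 hq1 e i j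
  obtain ⟨C, k0, hC⟩ := exists_uniform_bound
    (Finset.range (2 * i + 2) ×ˢ Finset.range (2 * j + 1))
    (Q := fun n k0 C => altParity e n.1 = false → altParity false n.2 = false →
      ∀ k l, k0 ≤ k → k0 ≤ l → ‖altDeriv q e n.1 n.2 F k l‖ ≤ C)
    (fun n k k' C C' hk hC h h1 h2 a b ha hb =>
      (h h1 h2 a b (hk.trans ha) (hk.trans hb)).trans hC) fun n _ => by
      by_cases h1 : altParity e n.1 = false
      · by_cases h2 : altParity false n.2 = false
        · obtain ⟨C, k0, h⟩ := h.bounded_origin hq0 hq1 h1 h2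
          exact ⟨C, k0, fun _ _ => h⟩
        · exact ⟨0, 0, fun _ h => absurd h h2⟩
      · exact ⟨0, 0, fun h => absurd h h1⟩
  refine ⟨A * C, k0, hA F k0 k0 C (fun n m hn l => h.vanish_left hq0 hq1 m hn l)
    (fun m hm k => h.vanish_right hq0 hq1 hm k) fun n m hn hm h1 h2 => ?_⟩
  exact hC (n, m) (by simp; omega) h1 h2

/-! ### Compactly supported functions -/

/-- `F` vanishes for large `s` or large `t`. -/
def LatSupp (k1 : ℤ) (F : LatFun) : Prop := ∀ k l, k < k1 ∨ l < k1 → F k l = 0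

variable {p : ℝ} {k1 : ℤ}

lemma LatSupp.T1 (hF : LatSupp k1 F) : LatSupp k1 (T1 p F) := fun k l h => by
  rw [T1_apply, hF (k - 1) l (by omega), hF k l h, sub_zero, mul_zero]

lemma LatSupp.T2 (hF : LatSupp k1 F) : LatSupp k1 (T2 p F) := fun k l h => by
  rw [T2_apply, hF k (l - 1) (by omega), hF k l h, sub_zero, mul_zero]

lemma LatSupp.T1_pow_T2_pow (hF : LatSupp k1 F) (i j : ℕ) :
    LatSupp k1 ((QWeinstein.T1 p ^ i) ((QWeinstein.T2 p ^ j) F)) :=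
  pow_induction (P := LatSupp k1) (fun _ h => h.T1) i
    (pow_induction (P := LatSupp k1) (fun _ h => h.T2) j hF)

lemma exists_norm_le_of_eventually {u : ℤ → ℂ} (h0 : ∀ k, k < k1 → u k = 0) {C : ℝ} {k0 : ℤ}
    (h : ∀ k, k0 ≤ k → ‖u k‖ ≤ C) : ∃ C', ∀ k, ‖u k‖ ≤ C' := by
  refine ⟨|C| + ∑ k ∈ Finset.Ico k1 k0, ‖u k‖, fun k => ?_⟩
  have hs : 0 ≤ ∑ k ∈ Finset.Ico k1 k0, ‖u k‖ := Finset.sum_nonneg fun _ _ => norm_nonneg _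
  rcases lt_or_ge k k1 with hk | hk
  · rw [h0 k hk, norm_zero]; positivity
  rcases lt_or_ge k k0 with hk' | hk'
  · exact (Finset.single_le_sum (f := fun k => ‖u k‖) (fun _ _ => norm_nonneg _)
      (Finset.mem_Ico.2 ⟨hk, hk'⟩)).trans (le_add_of_nonneg_left (abs_nonneg _))
  · exact ((h k hk').trans (le_abs_self _)).trans (le_add_of_nonneg_right hs)

lemma LatSupp.bounded (hF : LatSupp k1 F)
    (h0 : ∃ (C : ℝ) (k0 : ℤ), ∀ k l, k0 ≤ k → k0 ≤ l → ‖F k l‖ ≤ C)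
    (h1 : ∀ l, ∃ (C : ℝ) (k0 : ℤ), ∀ k, k0 ≤ k → ‖F k l‖ ≤ C)
    (h2 : ∀ k, ∃ (C : ℝ) (l0 : ℤ), ∀ l, l0 ≤ l → ‖F k l‖ ≤ C) :
    ∃ C, ∀ k l, ‖F k l‖ ≤ C := by
  have h1' : ∀ l, ∃ C, ∀ k, ‖F k l‖ ≤ C := fun l => by
    obtain ⟨C, k0, h⟩ := h1 l
    exact exists_norm_le_of_eventually (fun k hk => hF k l (Or.inl hk)) h
  have h2' : ∀ k, ∃ C, ∀ l, ‖F k l‖ ≤ C := fun k => by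
    obtain ⟨C, k0, h⟩ := h2 k
    exact exists_norm_le_of_eventually (fun l hl => hF k l (Or.inr hl)) h
  choose C1 h1 using h1'
  choose C2 h2 using h2'
  obtain ⟨C, k0, h⟩ := h0
  have hs1 : 0 ≤ ∑ l ∈ Finset.Ico k1 k0, |C1 l| := Finset.sum_nonneg fun _ _ => abs_nonneg _
  have hs2 : 0 ≤ ∑ l ∈ Finset.Ico k1 k0, |C2 l| := Finset.sum_nonneg fun _ _ => abs_nonneg _
  refine ⟨|C| + ∑ l ∈ Finset.Ico k1 k0, |C1 l| + ∑ k ∈ Finset.Ico k1 k0, |C2 k|, fun k l => ?_⟩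
  have hC := abs_nonneg C
  by_cases hz : k < k1 ∨ l < k1
  · rw [hF k l hz, norm_zero]; positivity
  push Not at hz
  rcases lt_or_ge k k0 with hk | hk
  · have := Finset.single_le_sum (f := fun k => |C2 k|) (fun _ _ => abs_nonneg _)
      (Finset.mem_Ico.2 ⟨hz.1, hk⟩)
    linarith [h2 k l, le_abs_self (C2 k)]
  rcases lt_or_ge l k0 with hl | hl
  · have := Finset.single_le_sum (f := fun l => |C1 l|) (fun _ _ => abs_nonneg _)
      (Finset.mem_Ico.2 ⟨hz.2, hl⟩)
    linarith [h1 l k, le_abs_self (C1 l)]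
  · linarith [h k l hk hl, le_abs_self C]

lemma LatSupp.decay (hp0 : 0 < p) (hp1 : p < 1) (hF : LatSupp k1 F) (h : ∃ C, ∀ k l, ‖F k l‖ ≤ C) :
    Decay p F := by
  intro M N
  obtain ⟨C, hC⟩ := h
  have hC0 : 0 ≤ C := (norm_nonneg _).trans (hC 0 0)
  refine ⟨(p ^ k1) ^ M * (p ^ k1) ^ N * C, fun k l => ?_⟩
  by_cases hz : k < k1 ∨ l < k1
  · rw [hF k l hz, norm_zero, mul_zero]
    positivity
  push Not at hz
  have h1 := (zpow_le_zpow_iff_right_of_lt_one₀ hp0 hp1).2 hz.1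
  have h2 := (zpow_le_zpow_iff_right_of_lt_one₀ hp0 hp1).2 hz.2
  gcongr
  exact hC k l

lemma LocBdd.T2_pow (hF : LocBdd p F) (j : ℕ) : LocBdd p ((QWeinstein.T2 p ^ j) F) :=
  pow_induction (P := LocBdd p) (fun _ h => h.T2) j hF

lemma QSmooth.isRapid_of_latSupp (hq0 : 0 < q) (hq1 : q < 1)
    (h : QSmooth (lift (q := q) e false F)) (hF : LatSupp k1 F) : IsRapid (q ^ 2) F := by
  intro i j
  refine (hF.T1_pow_T2_pow i j).decay (by positivity) (pow_lt_one₀ hq0.le hq1 two_ne_zero)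
    ((hF.T1_pow_T2_pow i j).bounded (h.bounded_near_origin hq0 hq1 i j) ?_ ?_)
  · exact (h.locBdd hq0 hq1).T2_pow j i
  · intro k
    obtain ⟨C, k0, h⟩ := (h.locBdd_swapL hq0 hq1).T2_pow i j k
    refine ⟨C, k0, fun l hl => ?_⟩
    have := h l hl
    rw [T2_pow_swapL, T1_pow_swapL, swapL_apply, ← T1_pow_T2_pow] at this
    exact this

lemma exists_zpow_gt (hq0 : 0 < q) (hq1 : q < 1) (a : ℝ) : ∃ k1 : ℤ, ∀ k, k < k1 → a < q ^ k := by
  obtain ⟨n, hn⟩ := pow_unbounded_of_one_lt a ((one_lt_inv₀ hq0).2 hq1)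
  refine ⟨-n, fun k hk => hn.trans_le ?_⟩
  rw [inv_pow, ← zpow_natCast, ← zpow_neg]
  exact (zpow_le_zpow_iff_right_of_lt_one₀ hq0 hq1).2 hk.le

lemma zpow_idx_le_enorm2 (hq0 : 0 < q) (x : Rq2 q) :
    q ^ idx x.1 ≤ enorm2 x ∧ q ^ idx x.2 ≤ enorm2 x := by
  rw [← abs_eq_zpow_idx hq0, ← abs_eq_zpow_idx hq0, enorm2]
  exact ⟨Real.abs_le_sqrt (by nlinarith [sq_nonneg (x.2 : ℝ)]),
    Real.abs_le_sqrt (by nlinarith [sq_nonneg (x.1 : ℝ)])⟩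

/-- The components of a test function. -/
lemma testSpace_components (hq0 : 0 < q) (hq1 : q < 1) {f : Rq2 q → ℂ} (hf : f ∈ testSpace q) :
    ∃ (E O : LatFun) (k1 : ℤ), f = assemble E O ∧ IsRapid (q ^ 2) E ∧ IsRapid (q ^ 2) O ∧
      LatSupp k1 E ∧ LatSupp k1 O := by
  obtain ⟨hs, he, a, ha, hsupp⟩ := hf
  obtain ⟨k1, hk1⟩ := exists_zpow_gt hq0 hq1 a
  have h0 : ∀ x : Rq2 q, idx x.1 < k1 ∨ idx x.2 < k1 → f x = 0 := by
    rintro x (h | h)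
    · exact hsupp x ((hk1 _ h).trans_le (zpow_idx_le_enorm2 hq0 x).1)
    · exact hsupp x ((hk1 _ h).trans_le (zpow_idx_le_enorm2 hq0 x).2)
  have hfe := (assemble_parts hq0 he).symm
  have h1 : ∀ k l, k < k1 ∨ l < k1 → f (pos q k, pos q l) = 0 := fun k l h =>
    h0 _ (by simpa [idx_pos hq0 hq1] using h)
  have h2 : ∀ k l, k < k1 ∨ l < k1 → f (neg q k, pos q l) = 0 := fun k l h =>
    h0 _ (by simpa [idx_pos hq0 hq1, idx_neg hq0 hq1] using h)
  have hE : LatSupp k1 (evenPart f) := fun k l h => by simp [evenPart, h1 k l h, h2 k l h]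
  have hO : LatSupp k1 (oddPart f) := fun k l h => by simp [oddPart, h1 k l h, h2 k l h]
  rw [hfe] at hs
  exact ⟨_, _, k1, hfe, (hs.component hq0 hq1 false).isRapid_of_latSupp hq0 hq1 hE,
    (hs.component hq0 hq1 true).isRapid_of_latSupp hq0 hq1 hO, hE, hO⟩

/-! ### q-Schwartz functions -/

lemma R_swapL (F : LatFun) : R p (swapL F) = swapL (R p F) := by
  ext k l
  simp only [R_apply, swapL_apply]
  rw [add_comm]

lemma R_pow_swapL (n : ℕ) (F : LatFun) : (R p ^ n) (swapL F) = swapL ((R p ^ n) F) := by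
  induction n with
  | zero => rfl
  | succ n ih => rw [pow_succ', Module.End.mul_apply, ih, R_swapL, Module.End.mul_apply]

lemma add_zpow_mul_norm_le (hp0 : 0 < p) (hp1 : p < 1) (i j : ℕ) (G : LatFun) (k l : ℤ) :
    (p ^ k + p ^ l) * ‖(T1 p ^ i) ((T2 p ^ j) G) k l‖
      ≤ ‖(T1 p ^ i) ((T2 p ^ j) (R p G)) k l‖
        + (p⁻¹ ^ i - 1) * ‖(T1 p ^ (i - 1)) ((T2 p ^ j) G) k l‖
        + (p⁻¹ ^ j - 1) * ‖(T1 p ^ i) ((T2 p ^ (j - 1)) G) k l‖ := by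
  have hinv : ∀ i : ℕ, 1 ≤ p⁻¹ ^ i := fun i => one_le_pow₀ ((one_le_inv₀ hp0).2 hp1.le)
  have h1 : (T1 p ^ i) ((T2 p ^ j) (S1 p G)) = ((p⁻¹ ^ i : ℝ) : ℂ) •
      S1 p ((T1 p ^ i) ((T2 p ^ j) G))
      + ((p⁻¹ ^ i - 1 : ℝ) : ℂ) • (T1 p ^ (i - 1)) ((T2 p ^ j) G) := by
    rw [← S1_T2_pow, T1_pow_S1 hp0]
  have h2 : (T1 p ^ i) ((T2 p ^ j) (S2 p G)) = ((p⁻¹ ^ j : ℝ) : ℂ) •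
      S2 p ((T1 p ^ i) ((T2 p ^ j) G))
      + ((p⁻¹ ^ j - 1 : ℝ) : ℂ) • (T1 p ^ i) ((T2 p ^ (j - 1)) G) := by
    rw [T2_pow_S2 hp0, map_add, map_smul, map_smul, S2_T1_pow]
  set X := (T1 p ^ i) ((T2 p ^ j) G) k l
  set Y := (T1 p ^ i) ((T2 p ^ j) (R p G)) k l with hY
  set Z := (T1 p ^ (i - 1)) ((T2 p ^ j) G) k l
  set W := (T1 p ^ i) ((T2 p ^ (j - 1)) G) k l
  have h3 : ((p⁻¹ ^ i * p ^ k + p⁻¹ ^ j * p ^ l : ℝ) : ℂ) * X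
      = Y - ((p⁻¹ ^ i - 1 : ℝ) : ℂ) * Z - ((p⁻¹ ^ j - 1 : ℝ) : ℂ) * W := by
    rw [hY, R, LinearMap.add_apply, map_add, map_add, h1, h2]
    simp only [Pi.add_apply, Pi.smul_apply, smul_eq_mul, S1_apply, S2_apply]
    push_cast
    ring
  have hk := zpow_pos hp0 k
  have hl := zpow_pos hp0 l
  have h4 : p ^ k + p ^ l ≤ p⁻¹ ^ i * p ^ k + p⁻¹ ^ j * p ^ l :=
    add_le_add (le_mul_of_one_le_left hk.le (hinv i)) (le_mul_of_one_le_left hl.le (hinv j))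
  calc (p ^ k + p ^ l) * ‖X‖ ≤ (p⁻¹ ^ i * p ^ k + p⁻¹ ^ j * p ^ l) * ‖X‖ := by gcongr
    _ = ‖Y - ((p⁻¹ ^ i - 1 : ℝ) : ℂ) * Z - ((p⁻¹ ^ j - 1 : ℝ) : ℂ) * W‖ := by
      rw [← h3, norm_mul, Complex.norm_of_nonneg (by positivity)]
    _ ≤ ‖Y‖ + ‖((p⁻¹ ^ i - 1 : ℝ) : ℂ) * Z‖ + ‖((p⁻¹ ^ j - 1 : ℝ) : ℂ) * W‖ :=
      (norm_sub_le _ _).trans (add_le_add_left (norm_sub_le _ _) _)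
    _ = _ := by
      rw [norm_mul, norm_mul, Complex.norm_of_nonneg (sub_nonneg.2 (hinv i)),
        Complex.norm_of_nonneg (sub_nonneg.2 (hinv j))]

lemma exists_weighted_bound (hp0 : 0 < p) (hp1 : p < 1)
    (h : ∀ i j n, 2 * (i + j) + 1 ≤ n →
      ∃ C, ∀ k l, ‖(T1 p ^ i) ((T2 p ^ j) ((R p ^ n) F)) k l‖ ≤ C) (s : ℕ) :
    ∀ i j, i + j = s → ∀ m n, 2 * (i + j) + 1 ≤ m + n →
      ∃ C, ∀ k l, (p ^ k + p ^ l) ^ m * ‖(T1 p ^ i) ((T2 p ^ j) ((R p ^ n) F)) k l‖ ≤ C := by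
  have hinv : ∀ i : ℕ, 0 ≤ p⁻¹ ^ i - 1 := fun i =>
    sub_nonneg.2 (one_le_pow₀ ((one_le_inv₀ hp0).2 hp1.le))
  induction s with
  | zero =>
    intro i j hij m
    obtain ⟨rfl, rfl⟩ : i = 0 ∧ j = 0 := by omega
    induction m with
    | zero => intro n hn; simpa using h 0 0 n (by omega)
    | succ m ihm =>
      intro n hn
      obtain ⟨C, hC⟩ := ihm (n + 1) (by omega)
      refine ⟨C, fun k l => ?_⟩
      have h1 := add_zpow_mul_norm_le hp0 hp1 0 0 ((R p ^ n) F) k l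
      rw [← Module.End.mul_apply (R p), ← pow_succ'] at h1
      simp only [pow_zero, sub_self, zero_mul, add_zero] at h1
      have hk := zpow_pos hp0 k
      have hl := zpow_pos hp0 l
      rw [pow_succ (p ^ k + p ^ l), mul_assoc]
      exact (mul_le_mul_of_nonneg_left h1 (by positivity)).trans (hC k l)
  | succ s ih =>
    intro i j hij m
    induction m with
    | zero => intro n hn; simpa using h i j n (by omega)
    | succ m ihm =>
      intro n hn
      obtain ⟨C, hC⟩ := ihm (n + 1) (by omega)
      obtain ⟨C1, hC1⟩ : ∃ C, ∀ k l, (p ^ k + p ^ l) ^ m *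
          ((p⁻¹ ^ i - 1) * ‖(T1 p ^ (i - 1)) ((T2 p ^ j) ((R p ^ n) F)) k l‖) ≤ C := by
        rcases Nat.eq_zero_or_pos i with rfl | hi
        · exact ⟨0, fun k l => by simp⟩
        · obtain ⟨C, hC⟩ := ih (i - 1) j (by omega) m n (by omega)
          refine ⟨(p⁻¹ ^ i - 1) * C, fun k l => ?_⟩
          rw [mul_left_comm]
          exact mul_le_mul_of_nonneg_left (hC k l) (hinv i)
      obtain ⟨C2, hC2⟩ : ∃ C, ∀ k l, (p ^ k + p ^ l) ^ m *
          ((p⁻¹ ^ j - 1) * ‖(T1 p ^ i) ((T2 p ^ (j - 1)) ((R p ^ n) F)) k l‖) ≤ C := by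
        rcases Nat.eq_zero_or_pos j with rfl | hj
        · exact ⟨0, fun k l => by simp⟩
        · obtain ⟨C, hC⟩ := ih i (j - 1) (by omega) m n (by omega)
          refine ⟨(p⁻¹ ^ j - 1) * C, fun k l => ?_⟩
          rw [mul_left_comm]
          exact mul_le_mul_of_nonneg_left (hC k l) (hinv j)
      refine ⟨C + C1 + C2, fun k l => ?_⟩
      have h1 := add_zpow_mul_norm_le hp0 hp1 i j ((R p ^ n) F) k l
      rw [← Module.End.mul_apply (R p), ← pow_succ'] at h1
      have hk := zpow_pos hp0 k
      have hl := zpow_pos hp0 l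
      rw [pow_succ (p ^ k + p ^ l), mul_assoc]
      refine (mul_le_mul_of_nonneg_left h1 (by positivity)).trans ?_
      rw [mul_add, mul_add]
      exact add_le_add (add_le_add (hC k l) (hC1 k l)) (hC2 k l)

lemma QSmooth.isRapid_of_bounded (hq0 : 0 < q) (hq1 : q < 1)
    (h : QSmooth (lift (q := q) e false F))
    (hb : ∀ n, ∃ C, ∀ x : Rq2 q, ∀ β : ℕ × ℕ, β.1 + β.2 ≤ n →
      ‖Dq β (lift e false ((R (q ^ 2) ^ n) F)) x‖ ≤ C) : IsRapid (q ^ 2) F := by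
  have hp0 : 0 < q ^ 2 := by positivity
  have hp1 : q ^ 2 < 1 := pow_lt_one₀ hq0.le hq1 two_ne_zero
  have key : ∀ i j n, 2 * (i + j) + 1 ≤ n →
      ∃ C, ∀ k l, ‖(T1 (q ^ 2) ^ i) ((T2 (q ^ 2) ^ j) ((R (q ^ 2) ^ n) F)) k l‖ ≤ C := by
    intro i j n hn
    obtain ⟨A, _, hA⟩ := exists_T1_pow_T2_pow_bound hq0 hq1 e i j
    obtain ⟨C, hC⟩ := hb n
    refine ⟨A * C, fun k l => hA _ k l C (fun n' m _ l => ?_) (fun m _ k => ?_) ?_ k l le_rfl le_rfl⟩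
    · exact (((h.locBdd hq0 hq1).R_pow hp0 hp1 n).altWord hq0 e false n' m).tendsto hq0 hq1 l
    · have := (((h.locBdd_swapL hq0 hq1).R_pow hp0 hp1 n).altWord hq0 false false m 0).tendsto
        hq0 hq1 k
      simp only [altWord, Module.End.one_apply] at this
      rw [R_pow_swapL, altWord_stepX_swapL] at this
      exact this
    · intro n' m hn' hm h1 h2 k l _ _
      have := hC (pos q k, pos q l) (n', m) (by simp only; omega)
      rw [Dq_lift hq0 hq1, h1, h2, lift_pos_pos hq0 hq1] at this
      simpa using this
  have key2 := exists_weighted_bound hp0 hp1 key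
  intro i j M N
  obtain ⟨C1, k0, h1⟩ := h.bounded_near_origin hq0 hq1 i j
  obtain ⟨C2, h2⟩ := key2 (i + j) i j rfl (2 * (i + j) + 1) 0 le_rfl
  obtain ⟨C3, h3⟩ := key2 (i + j) i j rfl (M + N + (2 * (i + j) + 1)) 0 (by omega)
  simp only [pow_zero, Module.End.one_apply] at h2 h3
  set p := q ^ 2
  set G := (T1 p ^ i) ((T2 p ^ j) F)
  have hd : 0 < (p ^ k0) ^ (2 * (i + j) + 1) := by positivity
  have hbd : ∀ k l, ‖G k l‖ ≤ |C1| + |C2| / (p ^ k0) ^ (2 * (i + j) + 1) := by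
    intro k l
    have hk := zpow_pos hp0 k
    have hl := zpow_pos hp0 l
    by_cases hkl : k0 ≤ k ∧ k0 ≤ l
    · have : 0 ≤ |C2| / (p ^ k0) ^ (2 * (i + j) + 1) := by positivity
      linarith [h1 k l hkl.1 hkl.2, le_abs_self C1]
    · have hge : p ^ k0 ≤ p ^ k + p ^ l := by
        rw [not_and_or, not_le, not_le] at hkl
        rcases hkl with hkl | hkl
        · linarith [(zpow_le_zpow_iff_right_of_lt_one₀ hp0 hp1).2 hkl.le]
        · linarith [(zpow_le_zpow_iff_right_of_lt_one₀ hp0 hp1).2 hkl.le]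
      have h4 : ‖G k l‖ ≤ |C2| / (p ^ k0) ^ (2 * (i + j) + 1) := by
        rw [le_div_iff₀ hd, mul_comm]
        refine le_trans ?_ ((h2 k l).trans (le_abs_self _))
        gcongr
      linarith [abs_nonneg C1]
  refine ⟨|C1| + |C2| / (p ^ k0) ^ (2 * (i + j) + 1) + |C3|, fun k l => ?_⟩
  have hk := zpow_pos hp0 k
  have hl := zpow_pos hp0 l
  have h5 : (p ^ k) ^ M * (p ^ l) ^ N ≤ (p ^ k + p ^ l) ^ (M + N) := by
    rw [pow_add]
    gcongr <;> linarith
  have h6 : (p ^ k + p ^ l) ^ (M + N)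
      ≤ 1 + (p ^ k + p ^ l) ^ (M + N + (2 * (i + j) + 1)) := by
    rcases le_total (p ^ k + p ^ l) 1 with hx | hx
    · have := pow_le_one₀ (n := M + N) (by positivity) hx
      have : 0 ≤ (p ^ k + p ^ l) ^ (M + N + (2 * (i + j) + 1)) := by positivity
      linarith
    · have := pow_le_pow_right₀ hx (show M + N ≤ M + N + (2 * (i + j) + 1) by omega)
      linarith
  calc (p ^ k) ^ M * (p ^ l) ^ N * ‖G k l‖
      ≤ (1 + (p ^ k + p ^ l) ^ (M + N + (2 * (i + j) + 1))) * ‖G k l‖ := by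
        gcongr
        exact h5.trans h6
    _ = ‖G k l‖ + (p ^ k + p ^ l) ^ (M + N + (2 * (i + j) + 1)) * ‖G k l‖ := by ring
    _ ≤ _ := add_le_add (hbd k l) ((h3 k l).trans (le_abs_self _))

/-- The components of a q-Schwartz function. -/
lemma schwartzSpace_components (hq0 : 0 < q) (hq1 : q < 1) {f : Rq2 q → ℂ}
    (hf : f ∈ schwartzSpace q) :
    ∃ E O : LatFun, f = assemble E O ∧ IsRapid (q ^ 2) E ∧ IsRapid (q ^ 2) O := by
  obtain ⟨hs, he, hb⟩ := hf
  have hfe := (assemble_parts hq0 he).symm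
  rw [hfe] at hs hb
  simp_rw [enorm2_pow_mul_assemble hq0] at hb
  have key : ∀ e : Bool, IsRapid (q ^ 2) (bif e then oddPart f else evenPart f) := by
    intro e
    refine (hs.component hq0 hq1 e).isRapid_of_bounded hq0 hq1 fun n => ?_
    obtain ⟨C, hC⟩ := hb n
    refine ⟨C, fun x β hβ => ?_⟩
    have := Dq_component_bounded hq0 hq1 (fun x => hC x β hβ) e x
    cases e <;> exact this
  exact ⟨_, _, hfe, key false, key true⟩

end Components

section Transform

/-! ### The q-Bessel function at lattice points -/

lemma qGamma_pos {b x : ℝ} (hb0 : 0 < b) (hb1 : b < 1) (hx : 0 < x) : 0 < qGamma b x := by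
  have h1 : 0 < 1 - b := sub_pos.2 hb1
  have h2 := qPochInf_pos hb0 hb1 hb0.le hb1
  have h3 := qPochInf_pos hb0 hb1 (Real.rpow_pos_of_pos hb0 x).le
    (Real.rpow_lt_one hb0.le hb1 hx)
  have h4 := Real.rpow_pos_of_pos h1 (1 - x)
  unfold qGamma
  positivity

lemma qGamma_add_natCast {b x : ℝ} (hb0 : 0 < b) (hb1 : b < 1) (hx : 0 < x) (n : ℕ) :
    qGamma b (x + n) = qGamma b x * qPoch (b ^ x) b n / (1 - b) ^ n := by
  have h1 : 0 < 1 - b := sub_pos.2 hb1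
  have hx1 := Real.rpow_lt_one hb0.le hb1 hx
  have hx0 := (Real.rpow_pos_of_pos hb0 x).le
  have h3 := qPochInf_eq_qPoch_mul hb0 hb1 (b ^ x) n
  have h4 := (qPoch_pos hb0 hb1 hx0 hx1 n).ne'
  have h5 := (qPochInf_pos hb0 hb1 (mul_nonneg hx0 (pow_nonneg hb0.le n))
    (mul_pow_lt_one hb0 hb1 hx0 hx1 n)).ne'
  have h6 : (1 - b) ^ (1 - (x + n)) = (1 - b) ^ (1 - x) / (1 - b) ^ n := by
    rw [← Real.rpow_natCast, ← Real.rpow_sub h1]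
    congr 1
    ring
  rw [qGamma, qGamma, h3, h6, Real.rpow_add hb0, Real.rpow_natCast]
  field_simp

lemma qGamma_one {b : ℝ} (hb0 : 0 < b) (hb1 : b < 1) : qGamma b 1 = 1 := by
  have h2 := (qPochInf_pos hb0 hb1 hb0.le hb1).ne'
  simp [qGamma, h2]

variable {q : ℝ} {K : ℤ}

lemma sq_pow_choose_two (q : ℝ) (n : ℕ) : (q ^ 2) ^ n.choose 2 * (q ^ 2) ^ n = q ^ (n * (n + 1)) := by
  induction n with
  | zero => simp
  | succ n ih =>
    rw [Nat.choose_succ_succ' n 1, Nat.choose_one_right, pow_add, pow_succ (q ^ 2) n,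
      show (n + 1) * (n + 1 + 1) = n * (n + 1) + (2 * n + 2) by ring, pow_add, ← ih]
    ring

lemma qBessel_eq (hq0 : 0 < q) (hq1 : q < 1) (hK : 1 - q = q ^ K) {α : ℝ} (hα : -1 < α) {z : ℂ}
    {N : ℤ} (hz : z ^ 2 = (((q ^ 2) ^ N : ℝ) : ℂ)) :
    qBessel q α z = ((besselLat (q ^ 2) ((q ^ 2) ^ (α + 1)) (N + K)
      / qPochInf ((q ^ 2) ^ (α + 1)) (q ^ 2) : ℝ) : ℂ) := by
  have hp0 : 0 < q ^ 2 := by positivity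
  have hp1 : q ^ 2 < 1 := pow_lt_one₀ hq0.le hq1 two_ne_zero
  have hx : 0 < α + 1 := by linarith
  have ha0 := (Real.rpow_pos_of_pos hp0 (α + 1)).le
  have ha1 := Real.rpow_lt_one hp0.le hp1 hx
  rw [besselLat_eq_tsum hp0 hp1 ha0 ha1, mul_div_cancel_left₀ _ (qPochInf_pos hp0 hp1 ha0 ha1).ne',
    qBessel, Complex.ofReal_tsum]
  refine tsum_congr fun n => ?_
  rw [pow_mul z, hz, ← Complex.ofReal_pow, ← Complex.ofReal_mul]
  congr 1
  have hG := (qGamma_pos hp0 hp1 hx).ne'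
  have h1 := qGamma_add_natCast hp0 hp1 hx n
  have h2 := qGamma_add_natCast hp0 hp1 one_pos n
  rw [qGamma_one hp0 hp1, Real.rpow_one, one_mul] at h2
  rw [show α + (n : ℝ) + 1 = α + 1 + n by ring, show (n : ℝ) + 1 = 1 + n by ring, h1, h2,
    ← sq_pow_choose_two, eulerCoeff]
  have h3 := (qPoch_pos hp0 hp1 ha0 ha1 n).ne'
  have h4 := (qPoch_pos hp0 hp1 hp0.le hp1 n).ne'
  have h5 : (1 + q) ≠ 0 := by positivity
  have h6 : (1 - q) ≠ 0 := (sub_pos.2 hq1).ne'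
  have h7 : 1 - q ^ 2 = (1 - q) * (1 + q) := by ring
  have h8 : (q ^ 2) ^ K = (1 - q) ^ 2 := by
    rw [hK, ← zpow_natCast, ← zpow_natCast, ← zpow_mul, ← zpow_mul, mul_comm]
  rw [h7, zpow_add₀ hp0.ne', zpow_add₀ hp0.ne', h8, zpow_one]
  generalize 1 - q = u at h6 ⊢
  generalize 1 + q = v at h5 ⊢
  field_simp
  ring

/-! ### The transform in terms of components -/

/-- The q-Hankel transform in both variables. -/
def hankel (p : ℝ) (K : ℤ) (b a : ℝ) (F : LatFun) : LatFun := hankel2 p K a (hankel1 p K b F)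

lemma mul_sq_eq (hq0 : 0 < q) (x y : Rq q) :
    (((x : ℝ) : ℂ) * ((y : ℝ) : ℂ)) ^ 2 = (((q ^ 2) ^ (idx x + idx y) : ℝ) : ℂ) := by
  have hp0 : q ^ 2 ≠ 0 := by positivity
  rw [zpow_add₀ hp0, ← sq_eq_zpow_idx hq0, ← sq_eq_zpow_idx hq0]
  push_cast
  ring

lemma rpow_half_param (hq0 : 0 < q) :
    (q ^ 2) ^ (-(1 / 2 : ℝ) + 1) = q ∧ (q ^ 2) ^ ((1 / 2 : ℝ) + 1) = q ^ 3 := by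
  constructor
  · rw [← Real.rpow_natCast, ← Real.rpow_mul hq0.le]
    norm_num
  · rw [← Real.rpow_natCast, ← Real.rpow_natCast, ← Real.rpow_mul hq0.le]
    norm_num

/-- The kernel at lattice points. -/
lemma kernel_eq (hq0 : 0 < q) (hq1 : q < 1) (hK : 1 - q = q ^ K) {α : ℝ} (hα : -1 < α)
    (lam x : Rq2 q) : kernel q α (toPlane lam) (toPlane x)
      = (besselSeq (q ^ 2) q (idx lam.1 + K) (idx x.1) / (qPochInf q (q ^ 2) : ℝ)
          - Complex.I * ((lam.1 : ℝ) : ℂ) * ((x.1 : ℝ) : ℂ)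
            * (besselSeq (q ^ 2) (q ^ 3) (idx lam.1 + K) (idx x.1)
              / (qPochInf (q ^ 3) (q ^ 2) : ℝ)))
        * (besselSeq (q ^ 2) ((q ^ 2) ^ (α + 1)) (idx lam.2 + K) (idx x.2)
          / (qPochInf ((q ^ 2) ^ (α + 1)) (q ^ 2) : ℝ)) := by
  have hI : Complex.I ^ 2 = -1 := Complex.I_sq
  have hz : -Complex.I * (-Complex.I * ((lam.1 : ℝ) : ℂ) * ((x.1 : ℝ) : ℂ))
      = -(((lam.1 : ℝ) : ℂ) * ((x.1 : ℝ) : ℂ)) := by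
    linear_combination (((lam.1 : ℝ) : ℂ) * ((x.1 : ℝ) : ℂ)) * hI
  have h1 : (-(((lam.1 : ℝ) : ℂ) * ((x.1 : ℝ) : ℂ))) ^ 2
      = (((q ^ 2) ^ (idx lam.1 + idx x.1) : ℝ) : ℂ) := by rw [neg_sq, mul_sq_eq hq0]
  rw [kernel, qExp, toPlane, toPlane]
  simp only
  rw [hz, qCos, qSin, qBessel_eq hq0 hq1 hK hα (mul_sq_eq hq0 lam.2 x.2),
    qBessel_eq hq0 hq1 hK (by norm_num) h1, qBessel_eq hq0 hq1 hK (by norm_num) h1,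
    (rpow_half_param hq0).1, (rpow_half_param hq0).2]
  simp only [besselSeq]
  rw [show idx lam.1 + idx x.1 + K = idx x.1 + (idx lam.1 + K) by ring,
    show idx lam.2 + idx x.2 + K = idx x.2 + (idx lam.2 + K) by ring]
  push_cast
  ring

lemma jacksonLine_assemble_kernel (hq0 : 0 < q) (hq1 : q < 1) (hK : 1 - q = q ^ K) {α : ℝ}
    (hα : -1 < α) {E O : LatFun} (hE : IsRapid (q ^ 2) E) (hO : IsRapid (q ^ 2) O)
    (lam : Rq2 q) (l : ℤ) (w : ℂ) :
    jacksonLine (fun x : Rq q => assemble E O (x, pos q l)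
        * kernel q α (toPlane lam) (toPlane (x, pos q l)) * w)
      = 2 * (1 - q : ℝ) * w * (besselSeq (q ^ 2) ((q ^ 2) ^ (α + 1)) (idx lam.2 + K) l
          / (qPochInf ((q ^ 2) ^ (α + 1)) (q ^ 2) : ℝ))
        * (hankel1 (q ^ 2) K q E (idx lam.1) l / (qPochInf q (q ^ 2) : ℝ)
          - Complex.I * ((lam.1 : ℝ) : ℂ)
            * (hankel1 (q ^ 2) K (q ^ 3) O (idx lam.1) l / (qPochInf (q ^ 3) (q ^ 2) : ℝ))) := by
  have hp0 : 0 < q ^ 2 := by positivity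
  have hp1 : q ^ 2 < 1 := pow_lt_one₀ hq0.le hq1 two_ne_zero
  have h30 : 0 < q ^ 3 := by positivity
  have h31 : q ^ 3 < 1 := pow_lt_one₀ hq0.le hq1 three_ne_zero
  have s1 := hE.summable_hankel1 hp0 hp1 hq0 hq1 q (idx lam.1 + K) l
  have s2 := hE.summable_hankel1 hp0 hp1 hp0 hp1 (q ^ 3) (idx lam.1 + K) l
  have s3 := hO.summable_hankel1 hp0 hp1 hp0 hp1 q (idx lam.1 + K) l
  have s4 := hO.summable_hankel1 hp0 hp1 h30 h31 (q ^ 3) (idx lam.1 + K) l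
  have zz : ∀ (k : ℤ) (n : ℕ), (q ^ n) ^ k = (q ^ k) ^ n := fun k n => by
    rw [← zpow_natCast, ← zpow_natCast, ← zpow_mul, ← zpow_mul, mul_comm]
  simp only [zz] at s2 s3 s4
  rw [jacksonLine, ← mul_add]
  simp only [kernel_eq hq0 hq1 hK hα, assemble_apply, idx_pos hq0 hq1, idx_neg hq0 hq1, coe_pos,
    coe_neg, hankel1, zz]
  set c0 : ℂ := ((qPochInf q (q ^ 2) : ℝ) : ℂ)
  set c1 : ℂ := ((qPochInf (q ^ 3) (q ^ 2) : ℝ) : ℂ)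
  set D : ℂ := besselSeq (q ^ 2) ((q ^ 2) ^ (α + 1)) (idx lam.2 + K) l
          / (qPochInf ((q ^ 2) ^ (α + 1)) (q ^ 2) : ℝ)
  set A : ℤ → ℂ := besselSeq (q ^ 2) q (idx lam.1 + K)
  set B : ℤ → ℂ := besselSeq (q ^ 2) (q ^ 3) (idx lam.1 + K)
  set μ : ℂ := Complex.I * ((lam.1 : ℝ) : ℂ)
  have t1 := ((((s1.mul_left c0⁻¹).sub (s2.mul_left (μ * c1⁻¹))).add (s3.mul_left c0⁻¹)).sub
    (s4.mul_left (μ * c1⁻¹))).mul_left (D * w)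
  have t2 := ((((s1.mul_left c0⁻¹).add (s2.mul_left (μ * c1⁻¹))).sub (s3.mul_left c0⁻¹)).sub
    (s4.mul_left (μ * c1⁻¹))).mul_left (D * w)
  rw [← Summable.tsum_add (t1.congr fun k => ?_) (t2.congr fun k => ?_)]
  · have e : ∀ k : ℤ, ((q ^ k : ℝ) : ℂ) * ((E k l + ((q ^ k : ℝ) : ℂ) * O k l)
          * ((A k / c0 - μ * ((q ^ k : ℝ) : ℂ) * (B k / c1)) * D) * w)
        + ((q ^ k : ℝ) : ℂ) * ((E k l + ((-q ^ k : ℝ) : ℂ) * O k l)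
          * ((A k / c0 - μ * ((-q ^ k : ℝ) : ℂ) * (B k / c1)) * D) * w)
        = (2 * w * D / c0) * (((q ^ k : ℝ) : ℂ) * A k * E k l)
          - (2 * w * D * μ / c1) * ((((q ^ k) ^ 3 : ℝ) : ℂ) * B k * O k l) := by
      intro k
      push_cast
      ring
    simp_rw [e]
    rw [(s1.mul_left _).tsum_sub (s4.mul_left _), tsum_mul_left, tsum_mul_left]
    push_cast
    ring
  · push_cast
    ring
  · push_cast
    ring

/-- The two constants of the transform on the even (`false`) and odd (`true`) component. -/
def transformConst (q α : ℝ) (e : Bool) : ℂ :=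
  (bif e then -Complex.I else 1) * ((2 * (1 - q) ^ 2 * constK q α
    / (qPochInf ((q ^ 2) ^ (α + 1)) (q ^ 2) * qPochInf (parityParam q e) (q ^ 2)) : ℝ) : ℂ)

lemma parityParam_pos (hq0 : 0 < q) (e : Bool) : 0 < parityParam q e := by
  cases e <;> simp [parityParam] <;> positivity

lemma parityParam_lt_one (hq0 : 0 < q) (hq1 : q < 1) (e : Bool) : parityParam q e < 1 := by
  cases e
  · exact hq1
  · exact pow_lt_one₀ hq0.le hq1 three_ne_zero

lemma transformConst_ne_zero (hq0 : 0 < q) (hq1 : q < 1) {α : ℝ} (hα : -1 < α) (e : Bool) :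
    transformConst q α e ≠ 0 := by
  have hp0 : 0 < q ^ 2 := by positivity
  have hp1 : q ^ 2 < 1 := pow_lt_one₀ hq0.le hq1 two_ne_zero
  have hx : 0 < α + 1 := by linarith
  have h1 := qPochInf_pos hp0 hp1 (Real.rpow_pos_of_pos hp0 (α + 1)).le
    (Real.rpow_lt_one hp0.le hp1 hx)
  have h2 := qPochInf_pos hp0 hp1 (parityParam_pos hq0 e).le (parityParam_lt_one hq0 hq1 e)
  have h3 := qGamma_pos hp0 hp1 hx
  have h4 := qGamma_pos hp0 hp1 (show (0 : ℝ) < 1 / 2 by norm_num)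
  have h5 : 0 < 1 - q := sub_pos.2 hq1
  have h6 : 0 < constK q α := by
    have := Real.rpow_pos_of_pos (show 0 < 1 + q by positivity) (1 / 2 - α)
    unfold constK
    positivity
  refine mul_ne_zero (by cases e <;> simp) ?_
  exact_mod_cast (by positivity : 0 < 2 * (1 - q) ^ 2 * constK q α
    / (qPochInf ((q ^ 2) ^ (α + 1)) (q ^ 2) * qPochInf (parityParam q e) (q ^ 2))).ne'

lemma zpow_mul_zpow_rpow (hq0 : 0 < q) {α : ℝ} (hα : -1 < α) (l : ℤ) :
    q ^ l * (q ^ l) ^ (2 * α + 1) = ((q ^ 2) ^ (α + 1)) ^ l := by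
  rw [← Real.rpow_one_add' (zpow_pos hq0 l).le (by linarith), ← Real.rpow_intCast,
    ← Real.rpow_intCast, ← Real.rpow_natCast, ← Real.rpow_mul hq0.le, ← Real.rpow_mul hq0.le,
    ← Real.rpow_mul hq0.le]
  congr 1
  push_cast
  ring

lemma weinsteinTransform_assemble (hq0 : 0 < q) (hq1 : q < 1) (hK : 1 - q = q ^ K) {α : ℝ}
    (hα : -1 < α) {E O : LatFun} (hE : IsRapid (q ^ 2) E) (hO : IsRapid (q ^ 2) O) :
    weinsteinTransform α (assemble (q := q) E O)
      = assemble (transformConst q α false • hankel (q ^ 2) K q ((q ^ 2) ^ (α + 1)) E)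
        (transformConst q α true • hankel (q ^ 2) K (q ^ 3) ((q ^ 2) ^ (α + 1)) O) := by
  have hp0 : 0 < q ^ 2 := by positivity
  have hp1 : q ^ 2 < 1 := pow_lt_one₀ hq0.le hq1 two_ne_zero
  have hx : 0 < α + 1 := by linarith
  have h30 : 0 < q ^ 3 := by positivity
  have h31 : q ^ 3 < 1 := pow_lt_one₀ hq0.le hq1 three_ne_zero
  have ha0 := Real.rpow_pos_of_pos hp0 (α + 1)
  have ha1 := Real.rpow_lt_one hp0.le hp1 hx
  ext lam
  rw [weinsteinTransform, jacksonPos]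
  simp only [jacksonLine_assemble_kernel hq0 hq1 hK hα hE hO, coe_pos]
  have hw := fun l : ℤ => zpow_mul_zpow_rpow hq0 (α := α) (by linarith) l
  have s1 := ((hE.hankel1 (K := K) hp0 hp1 hq0 hq1).swapL).summable_hankel1 hp0 hp1 ha0 ha1
    ((q ^ 2) ^ (α + 1)) (idx lam.2 + K) (idx lam.1)
  have s2 := ((hO.hankel1 (K := K) hp0 hp1 h30 h31).swapL).summable_hankel1 hp0 hp1 ha0 ha1
    ((q ^ 2) ^ (α + 1)) (idx lam.2 + K) (idx lam.1)
  simp only [swapL_apply] at s1 s2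
  rw [assemble_apply]
  simp only [Pi.smul_apply, smul_eq_mul, hankel, hankel2, swapL_apply]
  set H1 := hankel1 (q ^ 2) K q E
  set H2 := hankel1 (q ^ 2) K (q ^ 3) O
  simp only [hankel1, swapL_apply]
  have e : ∀ l : ℤ, ((q ^ l : ℝ) : ℂ) * (2 * ((1 - q : ℝ) : ℂ)
        * (((q ^ l) ^ (2 * α + 1) : ℝ) : ℂ)
        * (besselSeq (q ^ 2) ((q ^ 2) ^ (α + 1)) (idx lam.2 + K) l
          / (qPochInf ((q ^ 2) ^ (α + 1)) (q ^ 2) : ℝ))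
        * (H1 (idx lam.1) l / (qPochInf q (q ^ 2) : ℝ)
          - Complex.I * ((lam.1 : ℝ) : ℂ)
            * (H2 (idx lam.1) l / (qPochInf (q ^ 3) (q ^ 2) : ℝ))))
      = (2 * ((1 - q : ℝ) : ℂ) / (qPochInf ((q ^ 2) ^ (α + 1)) (q ^ 2) : ℝ)
          / (qPochInf q (q ^ 2) : ℝ))
        * (((((q ^ 2) ^ (α + 1)) ^ l : ℝ) : ℂ)
          * besselSeq (q ^ 2) ((q ^ 2) ^ (α + 1)) (idx lam.2 + K) l * H1 (idx lam.1) l)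
        - (2 * ((1 - q : ℝ) : ℂ) / (qPochInf ((q ^ 2) ^ (α + 1)) (q ^ 2) : ℝ)
          * Complex.I * ((lam.1 : ℝ) : ℂ) / (qPochInf (q ^ 3) (q ^ 2) : ℝ))
        * (((((q ^ 2) ^ (α + 1)) ^ l : ℝ) : ℂ)
          * besselSeq (q ^ 2) ((q ^ 2) ^ (α + 1)) (idx lam.2 + K) l * H2 (idx lam.1) l) := by
    intro l
    rw [← hw, Complex.ofReal_mul]
    ring
  simp_rw [e]
  rw [(s1.mul_left _).tsum_sub (s2.mul_left _), tsum_mul_left, tsum_mul_left]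
  simp only [transformConst, parityParam, cond_true, cond_false]
  push_cast
  ring

end Transform

section PaleyWiener

variable {p q : ℝ} {K : ℤ} {b a : ℝ} {F G : LatFun}

/-! ### The two-variable Hankel transform and the q-Weinstein operator -/

/-- The inverse of `hankel`, up to a factor. -/
def hankelInv (p : ℝ) (K : ℤ) (b a : ℝ) (F : LatFun) : LatFun :=
  hankel1 p K b (hankel2 p K a F)

lemma hankelInv_eq (F : LatFun) :
    hankelInv p K b a F = swapL (hankel p K a b (swapL F)) := rfl

lemma IsRapid.hankel2 (hp0 : 0 < p) (hp1 : p < 1) (ha0 : 0 < a) (ha1 : a < 1)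
    (hF : IsRapid p F) : IsRapid p (hankel2 p K a F) :=
  (hF.swapL.hankel1 hp0 hp1 ha0 ha1).swapL

lemma IsRapid.hankel (hp0 : 0 < p) (hp1 : p < 1) (hb0 : 0 < b) (hb1 : b < 1) (ha0 : 0 < a)
    (ha1 : a < 1) (hF : IsRapid p F) : IsRapid p (hankel p K b a F) :=
  (hF.hankel1 hp0 hp1 hb0 hb1).hankel2 hp0 hp1 ha0 ha1

lemma hankel2_smul (c : ℂ) : hankel2 p K a (c • F) = c • hankel2 p K a F := by
  rw [hankel2, map_smul, hankel1_smul, map_smul]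
  rfl

lemma hankel_smul (c : ℂ) : hankel p K b a (c • F) = c • hankel p K b a F := by
  rw [hankel, hankel1_smul, hankel2_smul]
  rfl

lemma hankel_add (hp0 : 0 < p) (hp1 : p < 1) (hb0 : 0 < b) (hb1 : b < 1) (ha0 : 0 < a)
    (ha1 : a < 1) (hF : IsRapid p F) (hG : IsRapid p G) :
    hankel p K b a (F + G) = hankel p K b a F + hankel p K b a G := by
  rw [hankel, hankel1_add hp0 hp1 hb0 hb1 hF hG, hankel2, map_add,
    hankel1_add hp0 hp1 ha0 ha1 (hF.hankel1 hp0 hp1 hb0 hb1).swapL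
      (hG.hankel1 hp0 hp1 hb0 hb1).swapL, map_add]
  rfl

/-- The factor in the inversion formula. -/
def hankelConst (p : ℝ) (K : ℤ) (b a : ℝ) : ℂ :=
  ((b ^ (-K) * besselNorm p b : ℝ) : ℂ) * ((a ^ (-K) * besselNorm p a : ℝ) : ℂ)

lemma hankelConst_ne_zero (hp0 : 0 < p) (hp1 : p < 1) (hb0 : 0 < b) (hb1 : b < 1) (ha0 : 0 < a)
    (ha1 : a < 1) : hankelConst p K b a ≠ 0 := by
  have h1 := besselNorm_pos hp0 hp1 hb0 hb1
  have h2 := besselNorm_pos hp0 hp1 ha0 ha1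
  refine mul_ne_zero ?_ ?_
  · exact_mod_cast (mul_pos (zpow_pos hb0 _) h1).ne'
  · exact_mod_cast (mul_pos (zpow_pos ha0 _) h2).ne'

lemma hankel2_hankel2 (hp0 : 0 < p) (hp1 : p < 1) (ha0 : 0 < a) (ha1 : a < 1)
    (hF : IsRapid p F) :
    hankel2 p K a (hankel2 p K a F) = ((a ^ (-K) * besselNorm p a : ℝ) : ℂ) • F := by
  rw [hankel2, hankel2, swapL_swapL, hankel1_hankel1 hp0 hp1 ha0 ha1 hF.swapL, map_smul,
    swapL_swapL]

lemma hankelInv_hankel (hp0 : 0 < p) (hp1 : p < 1) (hb0 : 0 < b) (hb1 : b < 1) (ha0 : 0 < a)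
    (ha1 : a < 1) (hF : IsRapid p F) :
    hankelInv p K b a (hankel p K b a F) = hankelConst p K b a • F := by
  rw [hankelInv, hankel, hankel2_hankel2 hp0 hp1 ha0 ha1 (hF.hankel1 hp0 hp1 hb0 hb1),
    hankel1_smul, hankel1_hankel1 hp0 hp1 hb0 hb1 hF, smul_smul, hankelConst, mul_comm]

lemma hankel_hankelInv (hp0 : 0 < p) (hp1 : p < 1) (hb0 : 0 < b) (hb1 : b < 1) (ha0 : 0 < a)
    (ha1 : a < 1) (hF : IsRapid p F) :
    hankel p K b a (hankelInv p K b a F) = hankelConst p K b a • F := by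
  rw [hankelInv, hankel, hankel1_hankel1 hp0 hp1 hb0 hb1 (hF.hankel2 hp0 hp1 ha0 ha1),
    hankel2_smul, hankel2_hankel2 hp0 hp1 ha0 ha1 hF, smul_smul, hankelConst]

lemma qScale_sq (hK : 1 - q = q ^ K) :
    qScale q ^ 2 = (((q ^ 2) ^ (-K) : ℝ) : ℂ) := by
  rw [qScale, ← Complex.ofReal_pow, hK, zpow_neg, inv_pow, ← zpow_natCast, ← zpow_natCast,
    ← zpow_mul, ← zpow_mul, mul_comm]

lemma latWeinstein_hankel (hq0 : 0 < q) (hq1 : q < 1) (hK : 1 - q = q ^ K) (hb0 : 0 < b)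
    (hb1 : b < 1) (ha0 : 0 < a) (ha1 : a < 1) (hF : IsRapid (q ^ 2) F) :
    latWeinstein q b a (hankel (q ^ 2) K b a F)
      = (-1 : ℂ) • hankel (q ^ 2) K b a (R (q ^ 2) F) := by
  have hp0 : 0 < q ^ 2 := by positivity
  have hp1 : q ^ 2 < 1 := pow_lt_one₀ hq0.le hq1 two_ne_zero
  have h1 := hF.hankel1 (K := K) hp0 hp1 hb0 hb1
  have e1 : B1 (q ^ 2) b (hankel (q ^ 2) K b a F)
      = (-(((q ^ 2) ^ K : ℝ) : ℂ)) • hankel (q ^ 2) K b a (S1 (q ^ 2) F) := by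
    have : B1 (q ^ 2) b (hankel (q ^ 2) K b a F)
        = hankel2 (q ^ 2) K a (B1 (q ^ 2) b (hankel1 (q ^ 2) K b F)) :=
      congrArg swapL (B2_hankel1 (K := K) hp0 hp1 ha0 ha1 h1.swapL b)
    rw [this, B1_hankel1 hp0 hp1 hb0 hb1 hF, hankel2_smul]
    rfl
  have e2 : B2 (q ^ 2) a (hankel (q ^ 2) K b a F)
      = (-(((q ^ 2) ^ K : ℝ) : ℂ)) • hankel (q ^ 2) K b a (S2 (q ^ 2) F) := by
    have : B2 (q ^ 2) a (hankel (q ^ 2) K b a F) = (-(((q ^ 2) ^ K : ℝ) : ℂ)) •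
        hankel2 (q ^ 2) K a (S2 (q ^ 2) (hankel1 (q ^ 2) K b F)) :=
      congrArg swapL (B1_hankel1 (K := K) hp0 hp1 ha0 ha1 h1.swapL)
    rw [this, S2_hankel1]
    rfl
  rw [latWeinstein, LinearMap.smul_apply, LinearMap.add_apply, e1, e2, R, LinearMap.add_apply,
    hankel_add hp0 hp1 hb0 hb1 ha0 ha1 (hF.S1 hp0) (hF.S2 hp0), ← smul_add, smul_smul,
    qScale_sq hK, zpow_neg]
  have : (((q ^ 2) ^ K : ℝ) : ℂ) ≠ 0 := by exact_mod_cast (zpow_pos hp0 K).ne'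
  rw [Complex.ofReal_inv, mul_neg, inv_mul_cancel₀ this]

lemma R_hankel (hq0 : 0 < q) (hq1 : q < 1) (hK : 1 - q = q ^ K) (hb0 : 0 < b)
    (hb1 : b < 1) (ha0 : 0 < a) (ha1 : a < 1) (hF : IsRapid (q ^ 2) F) :
    R (q ^ 2) (hankel (q ^ 2) K b a F)
      = (-1 : ℂ) • hankel (q ^ 2) K b a (latWeinstein q b a F) := by
  have hp0 : 0 < q ^ 2 := by positivity
  have hp1 : q ^ 2 < 1 := pow_lt_one₀ hq0.le hq1 two_ne_zero
  have h1 := hF.hankel1 (K := K) hp0 hp1 hb0 hb1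
  have e1 : S1 (q ^ 2) (hankel (q ^ 2) K b a F)
      = (-(((q ^ 2) ^ (-K) : ℝ) : ℂ)) • hankel (q ^ 2) K b a (B1 (q ^ 2) b F) := by
    have : S1 (q ^ 2) (hankel (q ^ 2) K b a F)
        = hankel2 (q ^ 2) K a (S1 (q ^ 2) (hankel1 (q ^ 2) K b F)) :=
      congrArg swapL (S2_hankel1 (K := K) (b := a) (F := swapL (hankel1 (q ^ 2) K b F)))
    rw [this, S1_hankel1 hp0 hp1 hb0 hb1 hF, hankel2_smul]
    rfl
  have e2 : S2 (q ^ 2) (hankel (q ^ 2) K b a F)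
      = (-(((q ^ 2) ^ (-K) : ℝ) : ℂ)) • hankel (q ^ 2) K b a (B2 (q ^ 2) a F) := by
    have : S2 (q ^ 2) (hankel (q ^ 2) K b a F) = (-(((q ^ 2) ^ (-K) : ℝ) : ℂ)) •
        hankel2 (q ^ 2) K a (B2 (q ^ 2) a (hankel1 (q ^ 2) K b F)) :=
      congrArg swapL (S1_hankel1 (K := K) hp0 hp1 ha0 ha1 h1.swapL)
    rw [this, B2_hankel1 hp0 hp1 hb0 hb1 hF]
    rfl
  rw [R, LinearMap.add_apply, e1, e2, latWeinstein, LinearMap.smul_apply, LinearMap.add_apply,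
    hankel_smul, hankel_add hp0 hp1 hb0 hb1 ha0 ha1 (hF.B1 hp0 b) (hF.B2 hp0 a), ← smul_add,
    smul_smul, qScale_sq hK, neg_one_mul]

lemma IsRapid.latWeinstein (hq0 : 0 < q) (hF : IsRapid (q ^ 2) F) (b a : ℝ) :
    IsRapid (q ^ 2) (latWeinstein q b a F) :=
  ((hF.B1 (by positivity) b).add (by positivity) (hF.B2 (by positivity) a)).smul _

lemma IsRapid.latWeinstein_pow (hq0 : 0 < q) (hF : IsRapid (q ^ 2) F) (b a : ℝ) (n : ℕ) :
    IsRapid (q ^ 2) ((QWeinstein.latWeinstein q b a ^ n) F) :=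
  pow_induction (P := IsRapid (q ^ 2)) (fun _ h => h.latWeinstein hq0 b a) n hF

lemma latWeinstein_pow_hankel (hq0 : 0 < q) (hq1 : q < 1) (hK : 1 - q = q ^ K) (hb0 : 0 < b)
    (hb1 : b < 1) (ha0 : 0 < a) (ha1 : a < 1) (hF : IsRapid (q ^ 2) F) (n : ℕ) :
    (latWeinstein q b a ^ n) (hankel (q ^ 2) K b a F)
      = ((-1) ^ n : ℂ) • hankel (q ^ 2) K b a ((R (q ^ 2) ^ n) F) := by
  induction n with
  | zero => simp
  | succ n ih =>
    rw [pow_succ' (latWeinstein q b a), Module.End.mul_apply, ih, map_smul,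
      latWeinstein_hankel hq0 hq1 hK hb0 hb1 ha0 ha1 (hF.R_pow (by positivity) n), smul_smul,
      ← pow_succ, pow_succ' (R _), Module.End.mul_apply]

lemma R_pow_hankel (hq0 : 0 < q) (hq1 : q < 1) (hK : 1 - q = q ^ K) (hb0 : 0 < b)
    (hb1 : b < 1) (ha0 : 0 < a) (ha1 : a < 1) (hF : IsRapid (q ^ 2) F) (n : ℕ) :
    (R (q ^ 2) ^ n) (hankel (q ^ 2) K b a F)
      = ((-1) ^ n : ℂ) • hankel (q ^ 2) K b a ((latWeinstein q b a ^ n) F) := by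
  induction n with
  | zero => simp
  | succ n ih =>
    rw [pow_succ' (R _), Module.End.mul_apply, ih, map_smul,
      R_hankel hq0 hq1 hK hb0 hb1 ha0 ha1 (hF.latWeinstein_pow hq0 b a n), smul_smul,
      ← pow_succ, pow_succ' (latWeinstein q b a), Module.End.mul_apply]

lemma one_add_R_pow_hankel (hq0 : 0 < q) (hq1 : q < 1) (hK : 1 - q = q ^ K) (hb0 : 0 < b)
    (hb1 : b < 1) (ha0 : 0 < a) (ha1 : a < 1) (hF : IsRapid (q ^ 2) F) (n : ℕ) (k l : ℤ) :
    (((1 + ((q ^ 2) ^ k + (q ^ 2) ^ l)) ^ n : ℝ) : ℂ) * hankel (q ^ 2) K b a F k l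
      = hankel (q ^ 2) K b a (((1 - latWeinstein q b a) ^ n) F) k l := by
  have hp0 : 0 < q ^ 2 := by positivity
  have hp1 : q ^ 2 < 1 := pow_lt_one₀ hq0.le hq1 two_ne_zero
  induction n generalizing F with
  | zero => simp
  | succ n ih =>
    have h2 : IsRapid (q ^ 2) ((1 - latWeinstein q b a) F) := by
      rw [LinearMap.sub_apply, Module.End.one_apply]
      exact hF.sub hp0 (hF.latWeinstein hq0 b a)
    have h3 : (1 - latWeinstein q b a) F = F + (-1 : ℂ) • latWeinstein q b a F := by
      rw [LinearMap.sub_apply, Module.End.one_apply, neg_one_smul, sub_eq_add_neg]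
    have h4 : hankel (q ^ 2) K b a ((1 - latWeinstein q b a) F) k l
        = ((1 + ((q ^ 2) ^ k + (q ^ 2) ^ l) : ℝ) : ℂ) * hankel (q ^ 2) K b a F k l := by
      rw [h3, hankel_add hp0 hp1 hb0 hb1 ha0 ha1 hF ((hF.latWeinstein hq0 b a).smul _),
        hankel_smul, ← R_hankel hq0 hq1 hK hb0 hb1 ha0 ha1 hF, Pi.add_apply, Pi.add_apply, R_apply]
      push_cast
      ring
    rw [pow_succ (1 - latWeinstein q b a), Module.End.mul_apply, ← ih h2, h4]
    push_cast
    ring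

/-! ### Bounds for transforms of compactly supported functions -/

/-- All difference quotients of order at most `M` in each variable are bounded by `C`. -/
def QuotBound (p : ℝ) (M : ℕ) (C : ℝ) (F : LatFun) : Prop :=
  ∀ i ≤ M, ∀ j ≤ M, ∀ k l, ‖(T1 p ^ i) ((T2 p ^ j) F) k l‖ ≤ C

lemma IsRapid.quotBound (hF : IsRapid p F) (M : ℕ) : ∃ C, 0 ≤ C ∧ QuotBound p M C F := by
  have h : ∀ i j, ∃ C, ∀ k l, ‖(QWeinstein.T1 p ^ i) ((QWeinstein.T2 p ^ j) F) k l‖ ≤ C :=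
    fun i j => (hF i j).bounded
  choose C hC using h
  refine ⟨∑ i ∈ Finset.range (M + 1) ×ˢ Finset.range (M + 1), |C i.1 i.2|,
    Finset.sum_nonneg fun _ _ => abs_nonneg _, fun i hi j hj k l => ?_⟩
  refine ((hC i j k l).trans (le_abs_self _)).trans
    (Finset.single_le_sum (f := fun i : ℕ × ℕ => |C i.1 i.2|) (fun _ _ => abs_nonneg _)
      (a := (i, j)) ?_)
  simp
  omega

lemma QuotBound.R (hp0 : 0 < p) (hp1 : p < 1) {M : ℕ} {C : ℝ} {k1 : ℤ} (hs : LatSupp k1 F)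
    (hF : QuotBound p M C F) :
    QuotBound p M (2 * (p⁻¹ ^ M * p ^ k1 + p⁻¹ ^ M) * C) (R p F) := by
  intro i hi j hj k l
  have hC0 : 0 ≤ C := (norm_nonneg _).trans (hF 0 (by omega) 0 (by omega) 0 0)
  have h1 : (T1 p ^ i) ((T2 p ^ j) (S1 p F)) = ((p⁻¹ ^ i : ℝ) : ℂ) •
      S1 p ((T1 p ^ i) ((T2 p ^ j) F))
      + ((p⁻¹ ^ i - 1 : ℝ) : ℂ) • (T1 p ^ (i - 1)) ((T2 p ^ j) F) := by
    rw [← S1_T2_pow, T1_pow_S1 hp0]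
  have h2 : (T1 p ^ i) ((T2 p ^ j) (S2 p F)) = ((p⁻¹ ^ j : ℝ) : ℂ) •
      S2 p ((T1 p ^ i) ((T2 p ^ j) F))
      + ((p⁻¹ ^ j - 1 : ℝ) : ℂ) • (T1 p ^ i) ((T2 p ^ (j - 1)) F) := by
    rw [T2_pow_S2 hp0, map_add, map_smul, map_smul, S2_T1_pow]
  have hone : 1 ≤ p⁻¹ := (one_le_inv₀ hp0).2 hp1.le
  have hsup := hs.T1_pow_T2_pow (p := p) i j
  have hinv : ∀ i ≤ M, p⁻¹ ^ i ≤ p⁻¹ ^ M := fun i hi => pow_le_pow_right₀ hone hi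
  have hinv0 : ∀ i : ℕ, 0 ≤ p⁻¹ ^ i - 1 := fun i => sub_nonneg.2 (one_le_pow₀ hone)
  have key : ∀ n ≤ M, ∀ r, (k1 ≤ r ∨ (T1 p ^ i) ((T2 p ^ j) F) k l = 0) →
      ‖((p⁻¹ ^ n : ℝ) : ℂ) * (((p ^ r : ℝ) : ℂ) * (T1 p ^ i) ((T2 p ^ j) F) k l)‖
        ≤ p⁻¹ ^ M * p ^ k1 * C := by
    intro n hn r hr
    rcases hr with hr | hr
    · rw [norm_mul, norm_mul, Complex.norm_of_nonneg (by positivity),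
        Complex.norm_of_nonneg (zpow_pos hp0 _).le, ← mul_assoc]
      have := (zpow_le_zpow_iff_right_of_lt_one₀ hp0 hp1).2 hr
      exact mul_le_mul (mul_le_mul (hinv n hn) this (zpow_pos hp0 _).le (by positivity))
        (hF i hi j hj k l) (norm_nonneg _) (by positivity)
    · rw [hr]; simp; positivity
  have key2 : ∀ n ≤ M, ∀ z : ℂ, ‖z‖ ≤ C → ‖((p⁻¹ ^ n - 1 : ℝ) : ℂ) * z‖ ≤ p⁻¹ ^ M * C := by
    intro n hn z hz
    rw [norm_mul, Complex.norm_of_nonneg (hinv0 n)]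
    exact mul_le_mul (by linarith [hinv n hn]) hz (norm_nonneg _) (by positivity)
  rw [QWeinstein.R, LinearMap.add_apply, map_add, map_add, h1, h2]
  simp only [Pi.add_apply, Pi.smul_apply, smul_eq_mul, S1_apply, S2_apply]
  have b1 := key i hi k (by
    rcases lt_or_ge k k1 with h | h
    · exact Or.inr (hsup k l (Or.inl h))
    · exact Or.inl h)
  have b2 := key j hj l (by
    rcases lt_or_ge l k1 with h | h
    · exact Or.inr (hsup k l (Or.inr h))
    · exact Or.inl h)
  have b3 := key2 i hi _ (hF (i - 1) (by omega) j hj k l)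
  have b4 := key2 j hj _ (hF i hi (j - 1) (by omega) k l)
  refine (norm_add_le _ _).trans ((add_le_add ((norm_add_le _ _).trans (add_le_add b1 b3))
    ((norm_add_le _ _).trans (add_le_add b2 b4))).trans (le_of_eq ?_))
  ring

lemma norm_L1_le {c C : ℝ} (hc0 : 0 ≤ c) (hc1 : c ≤ 1) (h : ∀ k l, ‖F k l‖ ≤ C) (k l : ℤ) :
    ‖L1 c F k l‖ ≤ 2 * C := by
  rw [L1_apply, two_mul]
  refine (norm_sub_le _ _).trans (add_le_add (h _ _) ?_)
  rw [norm_mul, Complex.norm_of_nonneg hc0]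
  exact (mul_le_of_le_one_left (norm_nonneg _) hc1).trans (h _ _)

lemma QuotBound.swapL {M : ℕ} {C : ℝ} (hF : QuotBound p M C F) : QuotBound p M C (swapL F) := by
  intro i hi j hj k l
  rw [T2_pow_swapL, T1_pow_swapL, swapL_apply, ← T1_pow_T2_pow]
  exact hF j hj i hi l k

lemma QuotBound.B1 (hp0 : 0 < p) (hp1 : p < 1) (hb0 : 0 < b) (hb1 : b < 1) {M : ℕ} {C : ℝ}
    (hF : QuotBound p (M + 1) C F) : QuotBound p M (2 * C) (B1 p b F) := by
  intro i hi j hj k l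
  rw [T1_pow_T2_pow, QWeinstein.B1, Module.End.mul_apply, T1_pow_L1 hp0,
    ← Module.End.mul_apply (_ ^ i), ← pow_succ]
  have h : (T2 p ^ j) (L1 (b * p ^ i) ((T1 p ^ (i + 1)) F))
      = L1 (b * p ^ i) ((T1 p ^ (i + 1)) ((T2 p ^ j) F)) := by
    rw [T1_pow_T2_pow, L1, LinearMap.sub_apply, LinearMap.smul_apply, map_sub, map_smul,
      ← D1_T2_pow]
    rfl
  rw [h]
  have hpi : p ^ i ≤ 1 := pow_le_one₀ hp0.le hp1.le
  exact norm_L1_le (by positivity) (mul_le_one₀ hb1.le (by positivity) hpi)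
    (hF (i + 1) (by omega) j (by omega)) k l

lemma QuotBound.B2 (hp0 : 0 < p) (hp1 : p < 1) (ha0 : 0 < a) (ha1 : a < 1) {M : ℕ} {C : ℝ}
    (hF : QuotBound p (M + 1) C F) : QuotBound p M (2 * C) (B2 p a F) :=
  (hF.swapL.B1 hp0 hp1 ha0 ha1).swapL

lemma QuotBound.one_sub_latWeinstein (hq0 : 0 < q) (hq1 : q < 1) (hb0 : 0 < b) (hb1 : b < 1)
    (ha0 : 0 < a) (ha1 : a < 1) {M : ℕ} {C : ℝ} (hF : QuotBound (q ^ 2) (M + 1) C F) :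
    QuotBound (q ^ 2) M ((1 + 4 * ‖qScale q ^ 2‖) * C) ((1 - latWeinstein q b a) F) := by
  have hp0 : 0 < q ^ 2 := by positivity
  have hp1 : q ^ 2 < 1 := pow_lt_one₀ hq0.le hq1 two_ne_zero
  intro i hi j hj k l
  have h1 := hF.B1 hp0 hp1 hb0 hb1 i hi j hj k l
  have h2 := hF.B2 hp0 hp1 ha0 ha1 i hi j hj k l
  have h0 := hF i (by omega) j (by omega) k l
  rw [latWeinstein, LinearMap.sub_apply, Module.End.one_apply, LinearMap.smul_apply,
    LinearMap.add_apply, map_sub, map_sub, map_smul, map_smul, map_add, map_add]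
  simp only [Pi.sub_apply, Pi.smul_apply, Pi.add_apply, smul_eq_mul]
  refine (norm_sub_le _ _).trans ?_
  rw [norm_mul]
  have h3 := mul_le_mul_of_nonneg_left ((norm_add_le _ _).trans (add_le_add h1 h2))
    (norm_nonneg (qScale q ^ 2))
  linarith

lemma QuotBound.one_sub_latWeinstein_pow (hq0 : 0 < q) (hq1 : q < 1) (hb0 : 0 < b) (hb1 : b < 1)
    (ha0 : 0 < a) (ha1 : a < 1) (M : ℕ) {C : ℝ} (hF : QuotBound (q ^ 2) M C F) (k l : ℤ) :
    ‖((1 - latWeinstein q b a) ^ M) F k l‖ ≤ (1 + 4 * ‖qScale q ^ 2‖) ^ M * C := by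
  induction M generalizing F C with
  | zero => simpa using hF 0 le_rfl 0 le_rfl k l
  | succ M ih =>
    rw [pow_succ (1 - latWeinstein q b a), Module.End.mul_apply, pow_succ, mul_assoc]
    exact ih (hF.one_sub_latWeinstein hq0 hq1 hb0 hb1 ha0 ha1)

lemma LatSupp.mono {k1 k2 : ℤ} (hF : LatSupp k1 F) (h : k2 ≤ k1) : LatSupp k2 F :=
  fun k l hkl => hF k l (by omega)

lemma LatSupp.R {k1 : ℤ} (hF : LatSupp k1 F) : LatSupp k1 (R p F) := fun k l h => by
  rw [R_apply, hF k l h, mul_zero]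

lemma LatSupp.R_pow {k1 : ℤ} (hF : LatSupp k1 F) (n : ℕ) :
    LatSupp k1 ((QWeinstein.R p ^ n) F) :=
  pow_induction (P := LatSupp k1) (fun _ h => h.R) n hF

lemma LatSupp.one_sub_latWeinstein {k1 : ℤ} (hF : LatSupp k1 F) :
    LatSupp (k1 - 1) ((1 - latWeinstein q b a) F) := fun k l h => by
  have h1 := hF.T1 (p := q ^ 2)
  have h2 := hF.T2 (p := q ^ 2)
  rw [latWeinstein, LinearMap.sub_apply, Module.End.one_apply, LinearMap.smul_apply,
    LinearMap.add_apply, Pi.sub_apply, Pi.sub_apply, Pi.smul_apply, Pi.smul_apply, Pi.add_apply,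
    Pi.add_apply, B1_apply, B2_apply, h1 k l (by omega), h1 (k + 1) l (by omega),
    h2 k l (by omega), h2 k (l + 1) (by omega), hF k l (by omega)]
  simp

lemma LatSupp.one_sub_latWeinstein_pow {k1 : ℤ} (hF : LatSupp k1 F) (M : ℕ) :
    LatSupp (k1 - M) (((1 - latWeinstein q b a) ^ M) F) := by
  induction M generalizing F k1 with
  | zero => simpa using hF
  | succ M ih =>
    rw [pow_succ (1 - latWeinstein q b a), Module.End.mul_apply]
    exact (ih hF.one_sub_latWeinstein).mono (by push_cast; omega)

lemma QuotBound.R_pow (hp0 : 0 < p) (hp1 : p < 1) {M : ℕ} {C : ℝ} {k1 : ℤ} (hs : LatSupp k1 F)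
    (hF : QuotBound p M C F) (n : ℕ) :
    QuotBound p M ((2 * (p⁻¹ ^ M * p ^ k1 + p⁻¹ ^ M)) ^ n * C) ((QWeinstein.R p ^ n) F) := by
  induction n with
  | zero => simpa using hF
  | succ n ih =>
    rw [pow_succ' (QWeinstein.R p), Module.End.mul_apply, pow_succ', mul_assoc]
    exact ih.R hp0 hp1 (hs.R_pow n)

lemma exists_hankel1_bound (hp0 : 0 < p) (hp1 : p < 1) (hb0 : 0 < b) (hb1 : b < 1) (K k1 : ℤ) :
    ∃ c : ℝ, 0 ≤ c ∧ ∀ (W : LatFun) (C : ℝ), (∀ k l, k < k1 → W k l = 0) →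
      (∀ k l, ‖W k l‖ ≤ C) → ∀ k l, ‖hankel1 p K b W k l‖ ≤ c * C := by
  obtain ⟨c, hc0, hc⟩ := norm_besselSeq_le hp0 hp1 b
  have hs : Summable fun n : ℕ => b ^ (k1 + n) := by
    refine ((summable_geometric_of_lt_one hb0.le hb1).mul_left (b ^ k1)).congr fun n => ?_
    rw [zpow_add₀ hb0.ne', zpow_natCast]
  have hinj : Function.Injective fun n : ℕ => k1 + n := fun n m h => by simpa using h
  refine ⟨c * ∑' n : ℕ, b ^ (k1 + n), ?_, fun W C hW hC k l => ?_⟩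
  · exact mul_nonneg hc0.le (tsum_nonneg fun n => (zpow_pos hb0 _).le)
  have hsupp : Function.support (fun j : ℤ => ((b ^ j : ℝ) : ℂ) * besselSeq p b (k + K) j * W j l)
      ⊆ Set.range fun n : ℕ => k1 + n := fun j hj => by
    by_contra h
    refine hj ?_
    have : j < k1 := by
      by_contra h'
      exact h ⟨(j - k1).toNat, by simp; omega⟩
    simp [hW j l this]
  rw [hankel1, ← hinj.tsum_eq hsupp]
  rw [mul_right_comm]
  refine tsum_of_norm_bounded (hs.hasSum.mul_left (c * C)) fun n => ?_
  rw [norm_mul, norm_mul, Complex.norm_of_nonneg (zpow_pos hb0 _).le]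
  have h0 : 0 < b ^ (k1 + (n : ℤ)) := zpow_pos hb0 _
  calc _ ≤ b ^ (k1 + (n : ℤ)) * c * C := by
        gcongr
        · exact hc _ _
        · exact hC _ _
    _ = _ := by ring

lemma exists_hankel_bound (hp0 : 0 < p) (hp1 : p < 1) (hb0 : 0 < b) (hb1 : b < 1) (ha0 : 0 < a)
    (ha1 : a < 1) (K k1 : ℤ) :
    ∃ c : ℝ, 0 ≤ c ∧ ∀ (W : LatFun) (C : ℝ), LatSupp k1 W →
      (∀ k l, ‖W k l‖ ≤ C) → ∀ k l, ‖hankel p K b a W k l‖ ≤ c * C := by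
  obtain ⟨c1, h1, hc1⟩ := exists_hankel1_bound hp0 hp1 hb0 hb1 K k1
  obtain ⟨c2, h2, hc2⟩ := exists_hankel1_bound hp0 hp1 ha0 ha1 K k1
  refine ⟨c2 * c1, mul_nonneg h2 h1, fun W C hW hC k l => ?_⟩
  rw [mul_assoc]
  refine hc2 (swapL (hankel1 p K b W)) _ (fun k' l' hk => ?_)
    (fun k' l' => hc1 W C (fun k l h => hW k l (Or.inl h)) hC l' k') l k
  rw [swapL_apply, hankel1]
  simp [hW _ _ (Or.inr hk)]

/-- Transforms of compactly supported rapidly decreasing functions satisfy the Paley–Wiener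
bound. -/
lemma exists_latWeinstein_pow_hankel_bound (hq0 : 0 < q) (hq1 : q < 1) (hK : 1 - q = q ^ K)
    (hb0 : 0 < b) (hb1 : b < 1) (ha0 : 0 < a) (ha1 : a < 1) (hF : IsRapid (q ^ 2) F) {k1 : ℤ}
    (hs : LatSupp k1 F) (M : ℕ) (c : ℂ) : ∃ A C : ℝ, 0 < A ∧ 0 ≤ C ∧ ∀ (n : ℕ) (k l : ℤ),
      (1 + ((q ^ 2) ^ k + (q ^ 2) ^ l)) ^ M *
        ‖(latWeinstein q b a ^ n) (c • hankel (q ^ 2) K b a F) k l‖ ≤ C * A ^ n := by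
  have hp0 : 0 < q ^ 2 := by positivity
  have hp1 : q ^ 2 < 1 := pow_lt_one₀ hq0.le hq1 two_ne_zero
  obtain ⟨C, hC0, hC⟩ := hF.quotBound M
  obtain ⟨c0, hc0, hc⟩ := exists_hankel_bound hp0 hp1 hb0 hb1 ha0 ha1 K (k1 - M)
  refine ⟨2 * ((q ^ 2)⁻¹ ^ M * (q ^ 2) ^ k1 + (q ^ 2)⁻¹ ^ M),
    ‖c‖ * (c0 * ((1 + 4 * ‖qScale q ^ 2‖) ^ M * C)), by positivity, by positivity,
    fun n k l => ?_⟩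
  have h1 := hc _ _ ((hs.R_pow (p := q ^ 2) n).one_sub_latWeinstein_pow (q := q) (b := b) (a := a) M)
    ((hC.R_pow hp0 hp1 hs n).one_sub_latWeinstein_pow hq0 hq1 hb0 hb1 ha0 ha1) k l
  rw [← one_add_R_pow_hankel hq0 hq1 hK hb0 hb1 ha0 ha1 (hF.R_pow hp0 n), norm_mul,
    Complex.norm_of_nonneg (by positivity)] at h1
  rw [map_smul, latWeinstein_pow_hankel hq0 hq1 hK hb0 hb1 ha0 ha1 hF]
  simp only [Pi.smul_apply, norm_smul, norm_pow, norm_neg, norm_one, one_pow, one_mul]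
  calc _ = ‖c‖ * ((1 + ((q ^ 2) ^ k + (q ^ 2) ^ l)) ^ M
        * ‖hankel (q ^ 2) K b a ((R (q ^ 2) ^ n) F) k l‖) := by ring
    _ ≤ ‖c‖ * _ := mul_le_mul_of_nonneg_left h1 (norm_nonneg c)
    _ = _ := by rw [norm_pow]; ring

end PaleyWiener

section Characterization

variable {p q : ℝ} {K : ℤ} {b a : ℝ} {F G : LatFun}

/-! ### Supports of inverse transforms -/

lemma latWeinstein_swapL (F : LatFun) :
    latWeinstein q b a (swapL F) = swapL (latWeinstein q a b F) := by
  rw [latWeinstein, latWeinstein, LinearMap.smul_apply, LinearMap.add_apply, add_comm]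
  rfl

lemma latWeinstein_pow_swapL (n : ℕ) (F : LatFun) :
    (latWeinstein q b a ^ n) (swapL F) = swapL ((latWeinstein q a b ^ n) F) := by
  induction n with
  | zero => rfl
  | succ n ih =>
    rw [pow_succ' (latWeinstein q b a), Module.End.mul_apply, ih, latWeinstein_swapL,
      pow_succ' (latWeinstein q a b), Module.End.mul_apply]

lemma R_pow_hankelInv (hq0 : 0 < q) (hq1 : q < 1) (hK : 1 - q = q ^ K) (hb0 : 0 < b)
    (hb1 : b < 1) (ha0 : 0 < a) (ha1 : a < 1) (hF : IsRapid (q ^ 2) F) (n : ℕ) :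
    (R (q ^ 2) ^ n) (hankelInv (q ^ 2) K b a F)
      = ((-1) ^ n : ℂ) • hankelInv (q ^ 2) K b a ((latWeinstein q b a ^ n) F) := by
  rw [hankelInv_eq, R_pow_swapL, R_pow_hankel hq0 hq1 hK ha0 ha1 hb0 hb1 hF.swapL, map_smul,
    latWeinstein_pow_swapL, ← hankelInv_eq]

lemma IsRapid.hankelInv (hp0 : 0 < p) (hp1 : p < 1) (hb0 : 0 < b) (hb1 : b < 1) (ha0 : 0 < a)
    (ha1 : a < 1) (hF : IsRapid p F) : IsRapid p (hankelInv p K b a F) :=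
  (hF.hankel2 hp0 hp1 ha0 ha1).hankel1 hp0 hp1 hb0 hb1

lemma exists_tsum_besselSeq_bound (hp0 : 0 < p) (hp1 : p < 1) (hb0 : 0 < b) {v : ℝ}
    (hbv : b < v) (n : ℤ) : ∃ c : ℝ, 0 ≤ c ∧ ∀ (u : ℤ → ℂ) (D : ℝ),
      (∀ k, ‖u k‖ ≤ D * (v ^ k)⁻¹) →
        ‖∑' k : ℤ, ((b ^ k : ℝ) : ℂ) * besselSeq p b n k * u k‖ ≤ c * D := by
  have hv0 := hb0.trans hbv
  obtain ⟨C, r, hC, hr0, hr1, h⟩ := besselSeq_geometric hp0 hp1 b (div_pos hb0 hv0)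
    ((div_lt_one hv0).2 hbv) n
  refine ⟨C * ∑' k : ℤ, r ^ k.natAbs, mul_nonneg hC.le (tsum_nonneg fun k => by positivity),
    fun u D hu => ?_⟩
  have hD : 0 ≤ D := by simpa using (norm_nonneg _).trans (hu 0)
  rw [mul_right_comm]
  refine tsum_of_norm_bounded ((summable_pow_natAbs hr0 hr1).hasSum.mul_left (C * D)) fun k => ?_
  have hb := zpow_pos hb0 k
  have hv := zpow_pos hv0 k
  rw [norm_mul, norm_mul, Complex.norm_of_nonneg hb.le]
  calc _ ≤ b ^ k * ‖besselSeq p b n k‖ * (D * (v ^ k)⁻¹) := by gcongr; exact hu k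
    _ = (b / v) ^ k * ‖besselSeq p b n k‖ * D := by rw [div_zpow]; ring
    _ ≤ C * r ^ k.natAbs * D := mul_le_mul_of_nonneg_right (h k) hD
    _ = _ := by ring

lemma exists_hankelInv_bound (hp0 : 0 < p) (hp1 : p < 1) (hb0 : 0 < b) (ha0 : 0 < a) (ha1 : a < 1)
    {v : ℝ} (hbv : b < v) (K k l : ℤ) : ∃ c : ℝ, 0 ≤ c ∧ ∀ (W : LatFun) (D : ℝ),
      (∀ i j, ‖W i j‖ ≤ D * (v ^ i)⁻¹) → ‖hankelInv p K b a W k l‖ ≤ c * D := by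
  obtain ⟨c1, h1, hc1⟩ := exists_tsum_besselSeq_bound hp0 hp1 ha0 ha1 (l + K)
  obtain ⟨c2, h2, hc2⟩ := exists_tsum_besselSeq_bound hp0 hp1 hb0 hbv (k + K)
  refine ⟨c2 * c1, mul_nonneg h2 h1, fun W D hW => ?_⟩
  rw [mul_assoc]
  refine hc2 (fun i => hankel2 p K a W i l) (c1 * D) fun i => ?_
  rw [mul_assoc]
  exact hc1 (fun j => W i j) _ fun j => by simpa using hW i j

lemma exists_latSupp_hankelInv (hq0 : 0 < q) (hq1 : q < 1) (hK : 1 - q = q ^ K) (hb0 : 0 < b)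
    (hb1 : b < 1) (ha0 : 0 < a) (ha1 : a < 1) (hG : IsRapid (q ^ 2) G) {v : ℝ} (hbv : b < v)
    {A C : ℝ} (hA : 0 < A) {m : ℕ}
    (h : ∀ n, m ≤ n → ∀ k l, ‖(latWeinstein q b a ^ n) G k l‖ ≤ C * A ^ n * (v ^ k)⁻¹) :
    ∃ k1, LatSupp k1 (hankelInv (q ^ 2) K b a G) := by
  have hp0 : 0 < q ^ 2 := by positivity
  have hp1 : q ^ 2 < 1 := pow_lt_one₀ hq0.le hq1 two_ne_zero
  obtain ⟨k1, hk1⟩ := exists_zpow_gt hp0 hp1 A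
  refine ⟨k1, fun k l hkl => ?_⟩
  obtain ⟨c, hc0, hc⟩ := exists_hankelInv_bound hp0 hp1 hb0 ha0 ha1 hbv K k l
  set x := (q ^ 2) ^ k + (q ^ 2) ^ l
  have hx : A < x := by
    have hk := zpow_pos hp0 k
    have hl := zpow_pos hp0 l
    rcases hkl with hkl | hkl
    · linarith [hk1 k hkl]
    · linarith [hk1 l hkl]
  have hx0 : 0 < x := hA.trans hx
  have hbound : ∀ n, m ≤ n → ‖hankelInv (q ^ 2) K b a G k l‖ ≤ c * C * (A / x) ^ n := by
    intro n hn
    have h1 := congrArg norm (congrFun (congrFun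
      (R_pow_hankelInv hq0 hq1 hK hb0 hb1 ha0 ha1 hG n) k) l)
    rw [R_pow_apply, norm_mul, Complex.norm_of_nonneg (pow_pos hx0 n).le] at h1
    simp only [Pi.smul_apply, norm_smul, norm_pow, norm_neg, norm_one, one_pow, one_mul] at h1
    have h2 := hc _ _ (h n hn)
    rw [← h1] at h2
    rw [div_pow, ← mul_div_assoc, le_div_iff₀ (pow_pos hx0 n)]
    linarith
  have hlim : Tendsto (fun n : ℕ => c * C * (A / x) ^ n) atTop (𝓝 (c * C * 0)) :=
    (tendsto_pow_atTop_nhds_zero_of_lt_one (div_pos hA hx0).le ((div_lt_one hx0).2 hx)).const_mul _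
  rw [mul_zero] at hlim
  exact norm_le_zero_iff.1 (ge_of_tendsto hlim (eventually_atTop.2 ⟨m, hbound⟩))

/-! ### Test functions -/

lemma enorm2_le_zpow_idx (hq0 : 0 < q) (x : Rq2 q) : enorm2 x ≤ q ^ idx x.1 + q ^ idx x.2 := by
  have h1 := zpow_pos hq0 (idx x.1)
  have h2 := zpow_pos hq0 (idx x.2)
  rw [enorm2, ← sq_abs (x.1 : ℝ), ← sq_abs (x.2 : ℝ), abs_eq_zpow_idx hq0, abs_eq_zpow_idx hq0]
  exact Real.sqrt_le_iff.2 ⟨by positivity, by nlinarith⟩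

lemma LatSupp.smul {k1 : ℤ} (hF : LatSupp k1 F) (c : ℂ) : LatSupp k1 (c • F) := fun k l h => by
  simp [hF k l h]

lemma assemble_mem_testSpace (hq0 : 0 < q) (hq1 : q < 1) {E O : LatFun} (hE : IsRapid (q ^ 2) E)
    (hO : IsRapid (q ^ 2) O) {k1 k2 : ℤ} (hsE : LatSupp k1 E) (hsO : LatSupp k2 O) :
    assemble E O ∈ testSpace q := by
  refine ⟨qSmooth_assemble hq0 hq1 hE hO, evenLast_assemble hq0 hq1 E O, 2 * q ^ min k1 k2,
    by positivity, fun x hx => ?_⟩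
  have h1 := hx.trans_le (enorm2_le_zpow_idx hq0 x)
  have h2 : idx x.1 < min k1 k2 ∨ idx x.2 < min k1 k2 := by
    by_contra! h
    have h3 := (zpow_le_zpow_iff_right_of_lt_one₀ hq0 hq1).2 h.1
    have h4 := (zpow_le_zpow_iff_right_of_lt_one₀ hq0 hq1).2 h.2
    linarith
  rw [assemble_apply, hsE.mono (min_le_left _ _) _ _ h2, hsO.mono (min_le_right _ _) _ _ h2]
  simp

lemma integrableQ_assemble (hq0 : 0 < q) (hq1 : q < 1) {α : ℝ} (hα : -1 < α) {E O : LatFun}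
    (hE : IsRapid (q ^ 2) E) (hO : IsRapid (q ^ 2) O) :
    IntegrableQ α (assemble (q := q) E O) := by
  have hp0 : 0 < q ^ 2 := by positivity
  have hp1 : q ^ 2 < 1 := pow_lt_one₀ hq0.le hq1 two_ne_zero
  have hx : 0 < α + 1 := by linarith
  have ha0 := Real.rpow_pos_of_pos hp0 (α + 1)
  have ha1 := Real.rpow_lt_one hp0.le hp1 hx
  have hsum : ∀ {F : LatFun} {b : ℝ}, IsRapid (q ^ 2) F → 0 < b → b < 1 →
      Summable fun k : ℤ × ℤ => b ^ k.1 * ((q ^ 2) ^ (α + 1)) ^ k.2 * ‖F k.1 k.2‖ := by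
    intro F b hF hb0 hb1
    obtain ⟨C, r, r', hC, hr0, hr1, hr0', hr1', h⟩ := hF.decay.geometric hp0 hp1 hb0 hb1 ha0 ha1
    refine Summable.of_nonneg_of_le (fun k => ?_) (fun k => h k.1 k.2)
      (((summable_pow_natAbs hr0 hr1).mul_of_nonneg (summable_pow_natAbs hr0' hr1')
        (fun _ => by positivity) (fun _ => by positivity)).mul_left C)
    have := zpow_pos hb0 k.1
    have := zpow_pos ha0 k.2
    positivity
  refine Summable.of_nonneg_of_le (fun k => ?_) (fun k => ?_)
    (((hsum hE hq0 hq1).add (hsum hO hp0 hp1)).mul_left 2)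
  · have := zpow_pos hq0 k.1
    have := zpow_pos hq0 k.2
    positivity
  · have h1 := zpow_pos hq0 k.1
    have h2 := zpow_pos ha0 k.2
    have h3 : (q ^ 2) ^ k.1 = q ^ k.1 * q ^ k.1 := by
      rw [← mul_zpow, sq]
    have h4 : ‖assemble E O (pos q k.1, pos q k.2)‖ ≤ ‖E k.1 k.2‖ + q ^ k.1 * ‖O k.1 k.2‖ := by
      rw [assemble_apply, idx_pos hq0 hq1, idx_pos hq0 hq1]
      refine (norm_add_le _ _).trans (le_of_eq ?_)
      rw [norm_mul, Complex.norm_real, Real.norm_eq_abs, abs_eq_zpow_idx hq0, idx_pos hq0 hq1]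
    have h5 : ‖assemble E O (neg q k.1, pos q k.2)‖ ≤ ‖E k.1 k.2‖ + q ^ k.1 * ‖O k.1 k.2‖ := by
      rw [assemble_apply, idx_neg hq0 hq1, idx_pos hq0 hq1]
      refine (norm_add_le _ _).trans (le_of_eq ?_)
      rw [norm_mul, Complex.norm_real, Real.norm_eq_abs, abs_eq_zpow_idx hq0, idx_neg hq0 hq1]
    rw [mul_assoc (q ^ k.1), zpow_mul_zpow_rpow hq0 hα, h3]
    calc _ ≤ q ^ k.1 * ((q ^ 2) ^ (α + 1)) ^ k.2 * ((‖E k.1 k.2‖ + q ^ k.1 * ‖O k.1 k.2‖)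
          + (‖E k.1 k.2‖ + q ^ k.1 * ‖O k.1 k.2‖)) := by gcongr
      _ = _ := by ring

/-! ### The Paley–Wiener space -/

lemma weightB_bounds (hq0 : 0 < q) (hq1 : q < 1) {n m : ℕ} (h : m ≤ n) :
    ((1 - q) ^ (2 * m)) ^ 2 ≤ weightB n m q ∧ weightB n m q ≤ 1 := by
  have h1q : 0 < 1 - q := sub_pos.2 hq1
  have hf : ∀ k ∈ Finset.range (2 * m), 1 - q ≤ 1 - q ^ (2 * n) * q⁻¹ ^ k ∧
      1 - q ^ (2 * n) * q⁻¹ ^ k ≤ 1 := by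
    intro k hk
    have hk := Finset.mem_range.1 hk
    have : q ^ (2 * n) * q⁻¹ ^ k = q ^ (2 * n - k) := by
      rw [inv_pow, pow_sub₀ q hq0.ne' (by omega)]
    rw [this]
    have h1 := pow_le_of_le_one hq0.le hq1.le (show 2 * n - k ≠ 0 by omega)
    have h2 := pow_pos hq0 (2 * n - k)
    constructor <;> linarith
  have hl : (1 - q) ^ (2 * m) ≤ qPoch (q ^ (2 * n)) q⁻¹ (2 * m) := by
    have := Finset.prod_le_prod (fun k _ => h1q.le) fun k hk => (hf k hk).1
    simpa [qPoch] using this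
  have hu : qPoch (q ^ (2 * n)) q⁻¹ (2 * m) ≤ 1 :=
    Finset.prod_le_one (fun k hk => h1q.le.trans (hf k hk).1) fun k hk => (hf k hk).2
  have hpos : 0 < (1 - q) ^ (2 * m) := by positivity
  have hP := hpos.trans_le hl
  constructor
  · exact pow_le_pow_left₀ hpos.le ((le_div_iff₀ hP).2 (mul_le_of_le_one_right hpos.le hu)) 2
  · exact pow_le_one₀ (by positivity) ((div_le_one hP).2 hl)

lemma assemble_mem_paleyWiener (hq0 : 0 < q) (hq1 : q < 1) (α : ℝ) (m : ℕ) {E O : LatFun}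
    (hE : IsRapid (q ^ 2) E) (hO : IsRapid (q ^ 2) O)
    (hbE : ∃ A C : ℝ, 0 < A ∧ 0 ≤ C ∧ ∀ (n : ℕ) (k l : ℤ),
      (1 + ((q ^ 2) ^ k + (q ^ 2) ^ l)) ^ (m + 1) *
        ‖(latWeinstein q q ((q ^ 2) ^ (α + 1)) ^ n) E k l‖ ≤ C * A ^ n)
    (hbO : ∃ A C : ℝ, 0 < A ∧ 0 ≤ C ∧ ∀ (n : ℕ) (k l : ℤ),
      (1 + ((q ^ 2) ^ k + (q ^ 2) ^ l)) ^ (m + 1) *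
        ‖(latWeinstein q (q ^ 3) ((q ^ 2) ^ (α + 1)) ^ n) O k l‖ ≤ C * A ^ n) :
    assemble E O ∈ paleyWiener q α m := by
  obtain ⟨A, C, hA, hC, hE'⟩ := hbE
  obtain ⟨A', C', hA', hC', hO'⟩ := hbO
  have hM : 0 < max A A' := lt_max_of_lt_left hA
  refine ⟨assemble_mem_schwartzSpace hq0 hq1 hE hO, Real.sqrt (max A A'), Real.sqrt_pos.2 hM,
    C + C', ?_⟩
  rintro s ⟨x, n, hn, rfl⟩
  have hw := (weightB_bounds hq0 hq1 hn).2
  rw [pow_mul, Real.sq_sqrt hM.le, iterate_weinsteinOp_assemble hq0 hq1, assemble_apply]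
  have h1 := hE' n (idx x.1) (idx x.2)
  have h2 := hO' n (idx x.1) (idx x.2)
  have hρ := enorm2_pow hq0 x 1
  rw [mul_one, pow_one] at hρ
  rw [hρ]
  set ρ := (q ^ 2) ^ idx x.1 + (q ^ 2) ^ idx x.2 with hρdef
  set u := (latWeinstein q q ((q ^ 2) ^ (α + 1)) ^ n) E (idx x.1) (idx x.2)
  set w := (latWeinstein q (q ^ 3) ((q ^ 2) ^ (α + 1)) ^ n) O (idx x.1) (idx x.2)
  have hk := zpow_pos (pow_pos hq0 2) (idx x.1)
  have hl := zpow_pos (pow_pos hq0 2) (idx x.2)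
  have hρ0 : 0 < ρ := by positivity
  have hx1 : |(x.1 : ℝ)| ≤ 1 + ρ := by
    have := sq_eq_zpow_idx hq0 x.1
    rw [← sq_abs] at this
    nlinarith [sq_nonneg (|(x.1 : ℝ)| - 1)]
  have hnorm : ‖u + ((x.1 : ℝ) : ℂ) * w‖ ≤ (1 + ρ) * (‖u‖ + ‖w‖) := by
    refine (norm_add_le _ _).trans ?_
    rw [norm_mul, Complex.norm_real, Real.norm_eq_abs]
    nlinarith [norm_nonneg u, norm_nonneg w]
  have hpow : C * A ^ n + C' * A' ^ n ≤ (C + C') * max A A' ^ n := by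
    rw [add_mul]
    gcongr
    · exact le_max_left _ _
    · exact le_max_right _ _
  have hMn := pow_pos hM n
  calc _ ≤ (max A A' ^ n)⁻¹ * 1 * (1 + ρ) ^ m * ((1 + ρ) * (‖u‖ + ‖w‖)) := by gcongr
    _ = (max A A' ^ n)⁻¹ * ((1 + ρ) ^ (m + 1) * ‖u‖ + (1 + ρ) ^ (m + 1) * ‖w‖) := by ring
    _ ≤ (max A A' ^ n)⁻¹ * ((C + C') * max A A' ^ n) := by
      gcongr
      exact (add_le_add h1 h2).trans hpow
    _ = C + C' := by field_simp

lemma latWeinstein_pow_bounds_of_mem_paleyWiener (hq0 : 0 < q) (hq1 : q < 1) {α : ℝ} {m : ℕ}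
    {E O : LatFun} (h : assemble E O ∈ paleyWiener q α m) :
    ∃ A C : ℝ, 0 < A ∧ ∀ n, m ≤ n → ∀ k l,
      ‖(latWeinstein q q ((q ^ 2) ^ (α + 1)) ^ n) E k l‖ ≤ C * A ^ n * (1 ^ k)⁻¹ ∧
      ‖(latWeinstein q (q ^ 3) ((q ^ 2) ^ (α + 1)) ^ n) O k l‖ ≤ C * A ^ n * (q ^ k)⁻¹ := by
  obtain ⟨-, a, ha, C, hC⟩ := h
  have h1q : 0 < 1 - q := sub_pos.2 hq1
  set δ := ((1 - q) ^ (2 * m)) ^ 2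
  have hδ : 0 < δ := by positivity
  refine ⟨a ^ 2, C / δ, by positivity, fun n hn => ?_⟩
  set g := (weinsteinOp α)^[n] (assemble (q := q) E O) with hg
  have hb : ∀ x, ‖g x‖ ≤ C / δ * (a ^ 2) ^ n := by
    intro x
    have h1 := hC ⟨x, n, hn, rfl⟩
    have h2 := (weightB_bounds hq0 hq1 hn).1
    have h3 : 1 ≤ (1 + enorm2 x ^ 2) ^ m := one_le_pow₀ (by nlinarith [sq_nonneg (enorm2 x)])
    have h4 : (a ^ (2 * n))⁻¹ * δ * 1 * ‖g x‖ ≤ C := by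
      refine le_trans ?_ h1
      have : 0 < weightB n m q := hδ.trans_le h2
      gcongr
    rw [← pow_mul, div_mul_eq_mul_div, le_div_iff₀ hδ]
    have h5 : 0 < a ^ (2 * n) := by positivity
    calc ‖g x‖ * δ = ((a ^ (2 * n))⁻¹ * δ * 1 * ‖g x‖) * a ^ (2 * n) := by field_simp
      _ ≤ _ := by gcongr
  rw [iterate_weinsteinOp_assemble hq0 hq1] at hg
  intro k l
  have hk := zpow_pos hq0 k
  have h1 := hb (pos q k, pos q l)
  have h2 := hb (neg q k, pos q l)
  constructor
  · rw [← evenPart_assemble hq0 hq1 ((latWeinstein q q ((q ^ 2) ^ (α + 1)) ^ n) E), ← hg, evenPart,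
      norm_div, one_zpow, inv_one, mul_one, div_le_iff₀ (by simp)]
    refine (norm_add_le _ _).trans ((add_le_add h1 h2).trans (le_of_eq ?_))
    simp
    ring
  · rw [← oddPart_assemble hq0 hq1 _ ((latWeinstein q (q ^ 3) ((q ^ 2) ^ (α + 1)) ^ n) O), ← hg,
      oddPart, norm_div, ← div_eq_mul_inv, norm_mul, Complex.norm_of_nonneg hk.le,
      Complex.norm_two, div_le_div_iff₀ (by positivity) hk]
    have := mul_le_mul_of_nonneg_right ((norm_sub_le _ _).trans (add_le_add h1 h2)) hk.le
    linarith

end Characterization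

end QWeinstein

end

theorem mainTheorem2 (q α : ℝ) (hq0 : 0 < q) (hq1 : q < 1)
    (hq : ∃ k : ℤ, 1 - q = q ^ k) (hα : -(1 / 2) ≤ α) (m : ℕ) (hm : α + 3 / 2 < m) :
    (∀ f ∈ QWeinstein.testSpace q, QWeinstein.IntegrableQ α f) ∧
    Set.BijOn (QWeinstein.weinsteinTransform α)
      (QWeinstein.testSpace q) (QWeinstein.paleyWiener q α m) := by
  obtain ⟨K, hK⟩ := hq
  have hα' : -1 < α := by linarith
  have hp0 : 0 < q ^ 2 := by positivity
  have hp1 : q ^ 2 < 1 := pow_lt_one₀ hq0.le hq1 two_ne_zero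
  have h30 : 0 < q ^ 3 := by positivity
  have h31 : q ^ 3 < 1 := pow_lt_one₀ hq0.le hq1 three_ne_zero
  have h3q : q ^ 3 < q := pow_lt_self_of_lt_one₀ hq0 hq1 (by norm_num)
  have ha0 := Real.rpow_pos_of_pos hp0 (α + 1)
  have ha1 := Real.rpow_lt_one hp0.le hp1 (show 0 < α + 1 by linarith)
  have hcE := QWeinstein.transformConst_ne_zero hq0 hq1 hα' false
  have hcO := QWeinstein.transformConst_ne_zero hq0 hq1 hα' true
  have hdE := QWeinstein.hankelConst_ne_zero (K := K) hp0 hp1 hq0 hq1 ha0 ha1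
  have hdO := QWeinstein.hankelConst_ne_zero (K := K) hp0 hp1 h30 h31 ha0 ha1
  refine ⟨fun f hf => ?_, fun f hf => ?_, fun f hf g hg hfg => ?_, fun f hf => ?_⟩
  · obtain ⟨E, O, k1, rfl, hE, hO, -, -⟩ := QWeinstein.testSpace_components hq0 hq1 hf
    exact QWeinstein.integrableQ_assemble hq0 hq1 hα' hE hO
  · obtain ⟨E, O, k1, rfl, hE, hO, hsE, hsO⟩ := QWeinstein.testSpace_components hq0 hq1 hf
    rw [QWeinstein.weinsteinTransform_assemble hq0 hq1 hK hα' hE hO]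
    exact QWeinstein.assemble_mem_paleyWiener hq0 hq1 α m
      ((hE.hankel hp0 hp1 hq0 hq1 ha0 ha1).smul _) ((hO.hankel hp0 hp1 h30 h31 ha0 ha1).smul _)
      (QWeinstein.exists_latWeinstein_pow_hankel_bound hq0 hq1 hK hq0 hq1 ha0 ha1 hE hsE _ _)
      (QWeinstein.exists_latWeinstein_pow_hankel_bound hq0 hq1 hK h30 h31 ha0 ha1 hO hsO _ _)
  · obtain ⟨E, O, k1, rfl, hE, hO, -, -⟩ := QWeinstein.testSpace_components hq0 hq1 hf
    obtain ⟨E', O', k1', rfl, hE', hO', -, -⟩ := QWeinstein.testSpace_components hq0 hq1 hg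
    rw [QWeinstein.weinsteinTransform_assemble hq0 hq1 hK hα' hE hO,
      QWeinstein.weinsteinTransform_assemble hq0 hq1 hK hα' hE' hO'] at hfg
    have e1 := congrArg QWeinstein.evenPart hfg
    have e2 := congrArg QWeinstein.oddPart hfg
    rw [QWeinstein.evenPart_assemble hq0 hq1, QWeinstein.evenPart_assemble hq0 hq1] at e1
    rw [QWeinstein.oddPart_assemble hq0 hq1, QWeinstein.oddPart_assemble hq0 hq1] at e2
    have e1 := congrArg (QWeinstein.hankelInv (q ^ 2) K q ((q ^ 2) ^ (α + 1)))
      (smul_right_injective _ hcE e1)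
    have e2 := congrArg (QWeinstein.hankelInv (q ^ 2) K (q ^ 3) ((q ^ 2) ^ (α + 1)))
      (smul_right_injective _ hcO e2)
    rw [QWeinstein.hankelInv_hankel hp0 hp1 hq0 hq1 ha0 ha1 hE,
      QWeinstein.hankelInv_hankel hp0 hp1 hq0 hq1 ha0 ha1 hE'] at e1
    rw [QWeinstein.hankelInv_hankel hp0 hp1 h30 h31 ha0 ha1 hO,
      QWeinstein.hankelInv_hankel hp0 hp1 h30 h31 ha0 ha1 hO'] at e2
    rw [smul_right_injective _ hdE e1, smul_right_injective _ hdO e2]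
  · obtain ⟨E, O, rfl, hE, hO⟩ := QWeinstein.schwartzSpace_components hq0 hq1 hf.1
    obtain ⟨A, C, hA, hb⟩ := QWeinstein.latWeinstein_pow_bounds_of_mem_paleyWiener hq0 hq1 hf
    obtain ⟨k1, hk1⟩ := QWeinstein.exists_latSupp_hankelInv hq0 hq1 hK hq0 hq1 ha0 ha1 hE hq1 hA
      fun n hn k l => (hb n hn k l).1
    obtain ⟨k2, hk2⟩ := QWeinstein.exists_latSupp_hankelInv hq0 hq1 hK h30 h31 ha0 ha1 hO h3q hA
      fun n hn k l => (hb n hn k l).2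
    have hiE := hE.hankelInv (K := K) hp0 hp1 hq0 hq1 ha0 ha1
    have hiO := hO.hankelInv (K := K) hp0 hp1 h30 h31 ha0 ha1
    refine ⟨_, QWeinstein.assemble_mem_testSpace hq0 hq1
      (hiE.smul (QWeinstein.transformConst q α false
        * QWeinstein.hankelConst (q ^ 2) K q ((q ^ 2) ^ (α + 1)))⁻¹)
      (hiO.smul (QWeinstein.transformConst q α true
        * QWeinstein.hankelConst (q ^ 2) K (q ^ 3) ((q ^ 2) ^ (α + 1)))⁻¹)
      (hk1.smul _) (hk2.smul _), ?_⟩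
    rw [QWeinstein.weinsteinTransform_assemble hq0 hq1 hK hα' (hiE.smul _) (hiO.smul _),
      QWeinstein.hankel_smul, QWeinstein.hankel_smul,
      QWeinstein.hankel_hankelInv hp0 hp1 hq0 hq1 ha0 ha1 hE,
      QWeinstein.hankel_hankelInv hp0 hp1 h30 h31 ha0 ha1 hO, smul_smul, smul_smul, smul_smul,
      smul_smul, mul_right_comm, mul_right_comm _ _ (QWeinstein.hankelConst _ _ (q ^ 3) _),
      mul_inv_cancel₀ (mul_ne_zero hcE hdE), mul_inv_cancel₀ (mul_ne_zero hcO hdO), one_smul,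
      one_smul]
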